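/- Let $\Bbbk$ be a field of characteristic zero. On $\bigoplus_{n\ge 0}\Bbbk[S_n]\text{-mod}$ let $\mathsf P$ be the induction functor, $\mathsf P(M)=\mathrm{Ind}_{S_n}^{S_{n+1}}M$, and $\mathsf Q$ the restriction functor, $\mathsf Q(M)=\mathrm{Res}^{S_n}_{S_{n-1}}M$, for $M\in\Bbbk[S_n]\text{-mod}$ (with $\mathsf Q=0$ on $\Bbbk[S_0]\text{-mod}$). The group $S_x$ acts on $\mathsf P^x$ and on $\mathsf Q^x$ by natural transformations; for $x\ge 0$ let $\mathsf P^{(x)},\mathsf Q^{(x)}$ be the images of the symmetrizing idempotent, and $\mathsf P^{(x)^t},\mathsf Q^{(x)^t}$ the images of the antisymmetrizing idempotent, of $\Bbbk[S_x]$. For $a\in\mathbb Z$ the categorical Bernstein operators are the chain complexes (differentials lower the homological degree by one) $$\mathsf B_a=\Big[\cdots\to\mathsf P^{(a+y)}\mathsf Q^{(y)^t}\to\mathsf P^{(a+y-1)}\mathsf Q^{(y-1)^t}\to\cdots\Big],\qquad \mathsf P^{(x)}\mathsf Q^{(y)^t}\ (x-y=a;\ x,y\ge 0)\text{ in homological degree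 }y,$$ $$\mathsf B_a^*=\Big[\cdots\to\mathsf P^{(x)^t}\mathsf Q^{(a+x)}\to\mathsf P^{(x+1)^t}\mathsf Q^{(a+x+1)}\to\cdots\Big],\qquad \mathsf P^{(x)^t}\mathsf Q^{(y)}\ (y-x=a;\ x,y\ge 0)\text{ in homological degree }-x.$$ The differential of $\mathsf B_a$ is the cap, that is, the counit $\mathsf P\mathsf Q\to\mathrm{id}$ of the adjunction between induction and restriction, applied to the rightmost $\mathsf P$ and the leftmost $\mathsf Q$ and composed on both sides with the idempotents; the differential of $\mathsf B_a^*$ is the cup, that is, the unit $\mathrm{id}\to\mathsf P\mathsf Q$ of the adjunction between restriction and (co)induction, inserted between $\mathsf P^x$ and $\mathsf Q^y$ and composed on both sides with the idempotents. A complex of functors acts on a complex of modules by forming the total complex. The symbol $\simeq$ denotes homotopy equivalence of chain complexes over $\bigoplus_n\Bbbk[S_n]\text{-mod}$, a module being regarded as a complex concentrated in homological degree $0$. **Theorem.** Let $\lambda=(\lambda_k\ge\dots\ge\lambda_1\ge 0)$ be a partition of $n$ (parts equal to zero are allowed), let $S_\lambda$ be the corresponding Specht module over $\Bbbk[S_n]$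 (the left ideal generated by a Young symmetrizer of shape $\lambda$; the trivial module if $\lambda$ has a single row), and let $\Bbbk$ also denote the trivial one-dimensional module over $\Bbbk[S_0]=\Bbbk$. Then $$\mathsf B_{\lambda_k}\mathsf B_{\lambda_{k-1}}\cdots\mathsf B_{\lambda_1}(\Bbbk)\simeq S_\lambda\qquad\text{and}\qquad \mathsf B^*_{\lambda_1}\cdots\mathsf B^*_{\lambda_{k-1}}\mathsf B^*_{\lambda_k}(S_\lambda)\simeq\Bbbk .$$ -/

import Mathlib

open CategoryTheory Limits
universe u
noncomputable section

/-- The category of `k[S_n]`-modules. -/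
abbrev SymRep (k : Type u) [Field k] (n : ℕ) := Rep.{u} k (Equiv.Perm (Fin n))

/-- The standard inclusion `S_l → S_n` for `l ≤ n`: permute the first `l` letters
(the trivial homomorphism, never used, if `n < l`). -/
def headPerm (l n : ℕ) : Equiv.Perm (Fin l) →* Equiv.Perm (Fin n) :=
  if h : l ≤ n then Equiv.Perm.viaEmbeddingHom (Fin.castLEEmb h) else 1

/-- The copy of `S_{n-l}` in `S_n` that fixes the first `l` letters and permutes the others. It
commutes with `S_l`, hence acts on the functors `Ind_{S_l}^{S_n}` and `Res^{S_n}_{S_l}`; these are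
the permutations of the `n - l` strands of `P^{n-l}`, respectively of `Q^{n-l}`. -/
def strandPerm (n l : ℕ) : Subgroup (Equiv.Perm (Fin n)) where
  carrier := {s | ∀ i : Fin n, (i : ℕ) < l → s i = i}
  one_mem' := fun _ _ => rfl
  mul_mem' := fun {a b} ha hb i hi => by
    rw [Equiv.Perm.mul_apply, hb i hi, ha i hi]
  inv_mem' := fun {a} ha i hi => by
    rw [Equiv.Perm.inv_eq_iff_eq, ha i hi]

instance (n l : ℕ) : DecidablePred (· ∈ strandPerm n l) := fun s =>
  inferInstanceAs (Decidable (∀ i : Fin n, (i : ℕ) < l → s i = i))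

lemma headPerm_apply_lt {l n : ℕ} (σ : Equiv.Perm (Fin l)) (h : l ≤ n) (i : Fin l) :
    headPerm l n σ (Fin.castLE h i) = Fin.castLE h (σ i) := by
  simp only [headPerm, h, dif_pos]
  exact Equiv.Perm.viaEmbedding_apply σ (Fin.castLEEmb h) i

lemma headPerm_apply_ge {l n : ℕ} (σ : Equiv.Perm (Fin l)) (i : Fin n) (hi : l ≤ (i : ℕ)) :
    headPerm l n σ i = i := by
  by_cases h : l ≤ n
  · simp only [headPerm, h, dif_pos]
    refine Equiv.Perm.viaEmbedding_apply_of_notMem σ (Fin.castLEEmb h) i ?_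
    rintro ⟨j, rfl⟩
    have := j.isLt
    simp at hi
    omega
  · simp [headPerm, h]

lemma headPerm_headPerm {l l' n : ℕ} (h : l ≤ l') (h' : l' ≤ n) (σ : Equiv.Perm (Fin l)) :
    headPerm l' n (headPerm l l' σ) = headPerm l n σ := by
  ext i : 1
  rcases lt_or_ge (i : ℕ) l with hi | hi
  · obtain ⟨j, rfl⟩ : ∃ j : Fin l, Fin.castLE (h.trans h') j = i := ⟨⟨i, hi⟩, rfl⟩
    rw [headPerm_apply_lt σ (h.trans h')]
    have e := headPerm_apply_lt (headPerm l l' σ) h' (Fin.castLE h j)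
    rw [headPerm_apply_lt σ h] at e
    exact e
  · rw [headPerm_apply_ge σ i hi]
    rcases lt_or_ge (i : ℕ) l' with hi' | hi'
    · obtain ⟨j, rfl⟩ : ∃ j : Fin l', Fin.castLE h' j = i := ⟨⟨i, hi'⟩, rfl⟩
      rw [headPerm_apply_lt _ h', headPerm_apply_ge σ j hi]
    · exact headPerm_apply_ge _ i hi'

lemma strandPerm_mul_headPerm {n l l' : ℕ} (h : l ≤ l') {s : Equiv.Perm (Fin n)}
    (hs : s ∈ strandPerm n l') (σ : Equiv.Perm (Fin l)) :
    s * headPerm l n σ = headPerm l n σ * s := by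
  by_cases hln : l ≤ n
  swap
  · simp [headPerm, hln]
  have hs' : ∀ i : Fin n, (i : ℕ) < l' → s i = i := hs
  ext i : 1
  simp only [Equiv.Perm.mul_apply]
  rcases lt_or_ge (i : ℕ) l with hi | hi
  · rw [hs' i (hi.trans_le h)]
    obtain ⟨j, rfl⟩ : ∃ j : Fin l, Fin.castLE hln j = i := ⟨⟨i, hi⟩, rfl⟩
    rw [headPerm_apply_lt σ hln]
    exact hs' _ (lt_of_lt_of_le (by simp) h)
  · rw [headPerm_apply_ge σ i hi, headPerm_apply_ge σ]
    by_contra hlt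
    push Not at hlt
    have h1 : s (s i) = s i := hs' _ (hlt.trans_le h)
    rw [s.injective h1] at hlt
    omega

variable {k : Type u} [Field k]

/-- The functor `P^x Q^y`, restricted to `k[S_m]`-modules, where `y = m - l`, `x = n - l`:
restrict from `S_m` to `S_l` (that is, apply `Q^y`) and induce from `S_l` to `S_n` (apply `P^x`).

Elements of the induced module are sums of classes of `g ⊗ v` (see `indResMk`), where
`σ g ⊗ σ v` and `g ⊗ v` are identified for `σ` in `S_l`, and `h` in `S_n` sends the class of
`g ⊗ v` to that of `g h⁻¹ ⊗ v`: the class of `g ⊗ v` here is the element `g⁻¹ ⊗ v` of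
`k[S_n] ⊗_{k[S_l]} M`. -/
abbrev indRes (m n l : ℕ) : SymRep k m ⥤ SymRep k n where
  obj M := Rep.ind (headPerm l n) (Rep.res (headPerm l m) M)
  map f := Rep.indMap (headPerm l n) (Rep.resMap (headPerm l m) f)
  map_id M := ((Rep.resFunctor (headPerm l m) ⋙ Rep.indFunctor k (headPerm l n))).map_id M
  map_comp f g := ((Rep.resFunctor (headPerm l m) ⋙ Rep.indFunctor k (headPerm l n))).map_comp f g

/-- The class of `g ⊗ v` in the induced module. -/
abbrev indResMk {m : ℕ} (n l : ℕ) (M : SymRep k m) (g : Equiv.Perm (Fin n)) :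
    M.V →ₗ[k] Representation.IndV (headPerm l n) (M.ρ.comp (headPerm l m)) :=
  Representation.IndV.mk (headPerm l n) (M.ρ.comp (headPerm l m)) g

lemma indResMk_rel {m n l : ℕ} (M : SymRep k m) (σ : Equiv.Perm (Fin l)) (g : Equiv.Perm (Fin n))
    (v : M.V) : indResMk n l M (headPerm l n σ * g) (M.ρ (headPerm l m σ) v) = indResMk n l M g v := by
  refine (Submodule.Quotient.eq _).2 <| Representation.Coinvariants.mem_ker_of_eq σ
    (TensorProduct.tmul k (MonoidAlgebra.single g 1) v) _ ?_
  simp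

lemma indRes_hom_ext {m n l : ℕ} {M : SymRep k m} {N : SymRep k n}
    {f f' : (indRes m n l).obj M ⟶ N}
    (h : ∀ g v, f.hom (indResMk n l M g v) = f'.hom (indResMk n l M g v)) : f = f' := by
  apply Rep.hom_ext
  apply Representation.IntertwiningMap.toLinearMap_injective
  apply Representation.IndV.hom_ext
  intro g
  ext v
  exact h g v

lemma indRes_map_mk {m n l : ℕ} {M N : SymRep k m} (f : M ⟶ N) (g : Equiv.Perm (Fin n)) (v : M.V) :
    ((indRes m n l).map f).hom (indResMk n l M g v) = indResMk n l N g (f.hom v) := by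
  rfl

lemma indRes_ρ_mk {m n l : ℕ} {M : SymRep k m} (h g : Equiv.Perm (Fin n)) (v : M.V) :
    ((indRes m n l).obj M).ρ h (indResMk n l M g v) = indResMk n l M (g * h⁻¹) v := 
  Representation.ind_mk _ _ _ _ _

instance (m n l : ℕ) : (indRes (k := k) m n l).Additive where
  map_add {M N f g} := by
    apply indRes_hom_ext
    intro x v
    exact map_add (indResMk n l N x) (f.hom v) (g.hom v)

/-- Auxiliary: the linear map between induced modules sending the class of `g ⊗ v` to the sum of
the classes of `a_i g ⊗ b_i v`. -/
def pairMap {m n l l' : ℕ} {ι : Type} [Fintype ι]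
    (a : ι → Equiv.Perm (Fin n)) (b : ι → Equiv.Perm (Fin m))
    (h : ∀ (M : SymRep k m) (σ : Equiv.Perm (Fin l)) (g : Equiv.Perm (Fin n)) (v : M.V),
      ∑ i, indResMk n l' M (a i * (headPerm l n σ * g)) (M.ρ (b i) (M.ρ (headPerm l m σ) v)) =
        ∑ i, indResMk n l' M (a i * g) (M.ρ (b i) v))
    (M : SymRep k m) :
    Representation.IndV (headPerm l n) (M.ρ.comp (headPerm l m)) →ₗ[k]
      Representation.IndV (headPerm l' n) (M.ρ.comp (headPerm l' m)) :=
  Representation.Coinvariants.lift _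
    (∑ i, Representation.Coinvariants.mk _ ∘ₗ
      TensorProduct.map (MonoidAlgebra.mapDomainLinearMap k k fun g => a i * g) (M.ρ (b i)))
    (fun σ => by
      ext g v
      have e := h M σ g v
      simp only [LinearMap.coe_comp, Function.comp_apply, MonoidAlgebra.lsingle_apply,
        TensorProduct.AlgebraTensorModule.curry_apply, LinearMap.restrictScalars_self,
        TensorProduct.curry_apply, Representation.tprod_apply, TensorProduct.map_tmul,
        LinearMap.sum_apply, Representation.ofMulAction_single, smul_eq_mul,
        MonoidHom.comp_apply] at e ⊢
      simpa using e)

lemma pairMap_mk {m n l l' : ℕ} {ι : Type} [Fintype ι]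
    (a : ι → Equiv.Perm (Fin n)) (b : ι → Equiv.Perm (Fin m)) (h) (M : SymRep k m) (g) (v : M.V) :
    pairMap (l := l) (l' := l') a b h M (indResMk n l M g v) =
      ∑ i, indResMk n l' M (a i * g) (M.ρ (b i) v) := by
  simp [pairMap, LinearMap.sum_apply]

/-- The natural transformation given on each module by the class of `g ⊗ v` being sent to the sum
of the classes of `a_i g ⊗ b_i v`. -/
def indResTrans {m n l l' : ℕ} {ι : Type} [Fintype ι]
    (a : ι → Equiv.Perm (Fin n)) (b : ι → Equiv.Perm (Fin m))
    (h : ∀ (M : SymRep k m) (σ : Equiv.Perm (Fin l)) (g : Equiv.Perm (Fin n)) (v : M.V),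
      ∑ i, indResMk n l' M (a i * (headPerm l n σ * g)) (M.ρ (b i) (M.ρ (headPerm l m σ) v)) =
        ∑ i, indResMk n l' M (a i * g) (M.ρ (b i) v)) :
    indRes (k := k) m n l ⟶ indRes m n l' where
  app M := Rep.ofHom
    ⟨pairMap a b h M, fun x => by
      apply Representation.IndV.hom_ext
      intro g
      ext v
      have e1 := indRes_ρ_mk (l := l) (M := M) x g v
      have e2 := fun i => indRes_ρ_mk (l := l') (M := M) x (a i * g) (M.ρ (b i) v)
      refine (congrArg (pairMap a b h M) e1).trans ?_
      refine (pairMap_mk a b h M _ v).trans ?_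
      refine Eq.trans ?_ (congrArg (((indRes m n l').obj M).ρ x) (pairMap_mk a b h M g v)).symm
      rw [map_sum]
      refine Finset.sum_congr rfl fun i _ => ?_
      rw [e2, mul_assoc]⟩
  naturality M N f := by
    apply indRes_hom_ext
    intro g v
    refine (pairMap_mk a b h N g (f.hom v)).trans ?_
    refine Eq.trans ?_ (congrArg ((indRes m n l').map f).hom (pairMap_mk a b h M g v)).symm
    rw [map_sum]
    refine Finset.sum_congr rfl fun i _ => ?_
    rw [indRes_map_mk, Rep.hom_comm_apply]

lemma indResTrans_mk {m n l l' : ℕ} {ι : Type} [Fintype ι]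
    (a : ι → Equiv.Perm (Fin n)) (b : ι → Equiv.Perm (Fin m)) (h) (M : SymRep k m) (g) (v : M.V) :
    ((indResTrans (l := l) (l' := l') a b h).app M).hom (indResMk n l M g v) =
      ∑ i, indResMk n l' M (a i * g) (M.ρ (b i) v) :=
  pairMap_mk a b h M g v

lemma indRes_trans_ext {m n l : ℕ} {F : SymRep k m ⥤ SymRep k n} {f f' : indRes m n l ⟶ F}
    (h : ∀ M g v, (f.app M).hom (indResMk n l M g v) = (f'.app M).hom (indResMk n l M g v)) :
    f = f' := by
  ext M : 2
  exact indRes_hom_ext (h M)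

/-- The permutation `s` of the strands of `P^x` and `t` of the strands of `Q^y`. -/
def strandMap {m n l : ℕ} (s : strandPerm n l) (t : strandPerm m l) :
    indRes (k := k) m n l ⟶ indRes m n l :=
  indResTrans (ι := Unit) (fun _ => s) (fun _ => t) (fun M σ g v => by
    simp only [Finset.univ_unique, Finset.sum_singleton]
    rw [← mul_assoc, strandPerm_mul_headPerm le_rfl s.2, mul_assoc, ← Module.End.mul_apply,
      ← map_mul, strandPerm_mul_headPerm le_rfl t.2, map_mul, Module.End.mul_apply,
      indResMk_rel])

/-- For `l' = l + 1`, the cap `P^x Q^y ⟶ P^{x-1} Q^{y-1}` joining the rightmost strand of `P^x` to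
the leftmost strand of `Q^y`: whiskering of the counit `Ind Res ⟶ id` of the adjunction between
induction from `S_l` to `S_{l+1}` and restriction, `g ⊗ v ↦ g ⊗ v`. -/
def capMap (m n l l' : ℕ) : indRes (k := k) m n l ⟶ indRes m n l' :=
  if h : l ≤ l' ∧ l' ≤ m ∧ l' ≤ n then
    indResTrans (ι := Unit) (fun _ => 1) (fun _ => 1) (fun M σ g v => by
      simp only [Finset.univ_unique, Finset.sum_singleton, one_mul, map_one, Module.End.one_apply]
      rw [← headPerm_headPerm h.1 h.2.2, ← headPerm_headPerm h.1 h.2.1, indResMk_rel])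
  else 0

/-- Auxiliary: the map `g ⊗ v ↦ ∑ c, c g ⊗ c v`, where `c` runs over `S_l`. -/
def cupSum (m n l l' : ℕ) : indRes (k := k) m n l ⟶ indRes m n l' :=
  indResTrans (ι := Equiv.Perm (Fin l)) (headPerm l n) (headPerm l m) (fun M σ g v => by
    refine Fintype.sum_equiv (Equiv.mulRight σ) _ _ fun c => ?_
    simp only [Equiv.coe_mulRight, map_mul, mul_assoc, Module.End.mul_apply])

/-- For `l = l' + 1`, the cup `P^x Q^y ⟶ P^{x+1} Q^{y+1}` creating a new rightmost strand of `P` and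
a new leftmost strand of `Q`: whiskering of the unit `id ⟶ Ind Res` of the adjunction between
restriction from `S_l` to `S_{l'}` and (co)induction, `g ⊗ v ↦ ∑ c, c g ⊗ c v`, where `c` runs over
representatives of the cosets `S_{l'} \ S_l`. As the summand only depends on the coset, we sum
over all of `S_l` and divide by the order of `S_{l'}`. -/
def cupMap (m n l l' : ℕ) : indRes (k := k) m n l ⟶ indRes m n l' :=
  ((Fintype.card (Equiv.Perm (Fin l')) : k)⁻¹) • cupSum m n l l'

/-- The idempotent endomorphism of `P^x Q^y` acting on the strands of `P^x` by the idempotent of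
`k[S_x]` of the character `χ`, and on those of `Q^y` by that of `ψ`. For the trivial character this
is the symmetrizer, for the sign character the antisymmetrizer. -/
def charIdem {m n : ℕ} (χ : Equiv.Perm (Fin n) →* ℤˣ) (ψ : Equiv.Perm (Fin m) →* ℤˣ) (l : ℕ) :
    indRes (k := k) m n l ⟶ indRes m n l :=
  ((Fintype.card (strandPerm n l) : k)⁻¹ * (Fintype.card (strandPerm m l) : k)⁻¹) •
    ∑ s : strandPerm n l, ∑ t : strandPerm m l, (((χ s * ψ t : ℤˣ) : ℤ) : k) • strandMap s t

lemma indRes_app_sum {m n l : ℕ} {F : SymRep k m ⥤ SymRep k n} (f : indRes m n l ⟶ F)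
    (M : SymRep k m) {ι : Type} [Fintype ι] (a : ι → Equiv.Perm (Fin n)) (v : ι → M.V) :
    (f.app M).hom (∑ i, indResMk n l M (a i) (v i)) =
      ∑ i, (f.app M).hom (indResMk n l M (a i) (v i)) :=
  map_sum (f.app M).hom.toLinearMap (fun i => indResMk n l M (a i) (v i)) Finset.univ

section lemmas
variable {m n : ℕ} (χ : Equiv.Perm (Fin n) →* ℤˣ) (ψ : Equiv.Perm (Fin m) →* ℤˣ)

lemma strandMap_mk {l : ℕ} (s : strandPerm n l) (t : strandPerm m l) (M : SymRep k m) (g) (v : M.V) :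
    ((strandMap s t).app M).hom (indResMk n l M g v) = indResMk n l M (s * g) (M.ρ t v) := by
  rw [strandMap, indResTrans_mk]; simp

lemma capMap_mk {l l' : ℕ} (h : l ≤ l' ∧ l' ≤ m ∧ l' ≤ n) (M : SymRep k m) (g) (v : M.V) :
    ((capMap m n l l').app M).hom (indResMk n l M g v) = indResMk n l' M g v := by
  rw [capMap, dif_pos h, indResTrans_mk]; simp

lemma cupSum_mk {l l' : ℕ} (M : SymRep k m) (g) (v : M.V) :
    ((cupSum m n l l').app M).hom (indResMk n l M g v) = ∑ c : Equiv.Perm (Fin l),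
        indResMk n l' M (headPerm l n c * g) (M.ρ (headPerm l m c) v) :=
  indResTrans_mk _ _ _ M g v

lemma comp_app_hom {F F' F'' : SymRep k m ⥤ SymRep k n} (f : F ⟶ F') (f' : F' ⟶ F'')
    (M : SymRep k m) (x : F.obj M) :
    ((f ≫ f').app M).hom x = (f'.app M).hom ((f.app M).hom x) := rfl

lemma strandMap_comp {l : ℕ} (s s' : strandPerm n l) (t t' : strandPerm m l) :
    strandMap (k := k) s t ≫ strandMap s' t' = strandMap (s' * s) (t' * t) := by
  apply indRes_trans_ext
  intro M g v
  refine (congrArg ((strandMap s' t').app M).hom (strandMap_mk s t M g v)).trans ?_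
  refine (strandMap_mk s' t' M _ _).trans ?_
  rw [strandMap_mk]
  simp [mul_assoc]

lemma strandMap_comp_charIdem {l : ℕ} (s : strandPerm n l) (t : strandPerm m l) :
    strandMap s t ≫ charIdem (k := k) χ ψ l = (((χ s * ψ t : ℤˣ) : ℤ) : k) • charIdem χ ψ l := by
  rw [charIdem, Linear.comp_smul, smul_comm]
  congr 1
  simp only [Preadditive.comp_sum, Linear.comp_smul, strandMap_comp, Finset.smul_sum, smul_smul]
  refine Fintype.sum_equiv (Equiv.mulRight s) _ _ fun s' => ?_
  refine Fintype.sum_equiv (Equiv.mulRight t) _ _ fun t' => ?_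
  simp only [Equiv.coe_mulRight]
  congr 1
  rw [← Int.cast_mul, ← Units.val_mul]
  congr 2
  simp only [Subgroup.coe_mul, map_mul]
  calc χ s' * ψ t' = χ s' * ψ t' * (χ s * χ s) * (ψ t * ψ t) := by simp
    _ = _ := by simp only [mul_assoc, mul_comm, mul_left_comm]

lemma charIdem_comp_strandMap {l : ℕ} (s : strandPerm n l) (t : strandPerm m l) :
    charIdem (k := k) χ ψ l ≫ strandMap s t = (((χ s * ψ t : ℤˣ) : ℤ) : k) • charIdem χ ψ l := by
  rw [charIdem, Linear.smul_comp, smul_comm]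
  congr 1
  simp only [Preadditive.sum_comp, Linear.smul_comp, strandMap_comp, Finset.smul_sum, smul_smul]
  refine Fintype.sum_equiv (Equiv.mulLeft s) _ _ fun s' => ?_
  refine Fintype.sum_equiv (Equiv.mulLeft t) _ _ fun t' => ?_
  simp only [Equiv.coe_mulLeft]
  congr 1
  rw [← Int.cast_mul, ← Units.val_mul]
  congr 2
  simp only [Subgroup.coe_mul, map_mul]
  calc χ s' * ψ t' = χ s' * ψ t' * (χ s * χ s) * (ψ t * ψ t) := by simp
    _ = _ := by simp only [mul_assoc, mul_comm, mul_left_comm]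

/-- A natural transformation on which the strand permutations act by the characters is unchanged
by the idempotent. -/
lemma comp_charIdem_of_forall [CharZero k] {l : ℕ} {F : SymRep k m ⥤ SymRep k n}
    (f : F ⟶ indRes m n l)
    (h : ∀ (s : strandPerm n l) (t : strandPerm m l),
      f ≫ strandMap s t = (((χ s * ψ t : ℤˣ) : ℤ) : k) • f) :
    f ≫ charIdem χ ψ l = f := by
  rw [charIdem, Linear.comp_smul]
  simp only [Preadditive.comp_sum, Linear.comp_smul, h, smul_smul]
  have e : ∀ (u : ℤˣ), ((u : ℤ) : k) * ((u : ℤ) : k) = 1 := fun u => by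
    rw [← Int.cast_mul, ← Units.val_mul]; simp
  simp only [e, one_smul, Finset.sum_const, Finset.card_univ, ← Nat.cast_smul_eq_nsmul k, smul_smul]
  have h1 : (Fintype.card (strandPerm n l) : k) ≠ 0 := by exact_mod_cast Fintype.card_ne_zero
  have h2 : (Fintype.card (strandPerm m l) : k) ≠ 0 := by exact_mod_cast Fintype.card_ne_zero
  rw [show ∀ a b : k, a⁻¹ * b⁻¹ * (a * b) = (a⁻¹ * a) * (b⁻¹ * b) by intros; ring,
    inv_mul_cancel₀ h1, inv_mul_cancel₀ h2, one_mul, one_smul]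

lemma charIdem_comp_of_forall [CharZero k] {l : ℕ} {F : SymRep k m ⥤ SymRep k n}
    (f : indRes m n l ⟶ F)
    (h : ∀ (s : strandPerm n l) (t : strandPerm m l),
      strandMap s t ≫ f = (((χ s * ψ t : ℤˣ) : ℤ) : k) • f) :
    charIdem χ ψ l ≫ f = f := by
  rw [charIdem, Linear.smul_comp]
  simp only [Preadditive.sum_comp, Linear.smul_comp, h, smul_smul]
  have e : ∀ (u : ℤˣ), ((u : ℤ) : k) * ((u : ℤ) : k) = 1 := fun u => by
    rw [← Int.cast_mul, ← Units.val_mul]; simp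
  simp only [e, one_smul, Finset.sum_const, Finset.card_univ, ← Nat.cast_smul_eq_nsmul k, smul_smul]
  have h1 : (Fintype.card (strandPerm n l) : k) ≠ 0 := by exact_mod_cast Fintype.card_ne_zero
  have h2 : (Fintype.card (strandPerm m l) : k) ≠ 0 := by exact_mod_cast Fintype.card_ne_zero
  rw [show ∀ a b : k, a⁻¹ * b⁻¹ * (a * b) = (a⁻¹ * a) * (b⁻¹ * b) by intros; ring,
    inv_mul_cancel₀ h1, inv_mul_cancel₀ h2, one_mul, one_smul]

lemma charIdem_idem [CharZero k] (l : ℕ) :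
    charIdem (k := k) χ ψ l ≫ charIdem χ ψ l = charIdem χ ψ l :=
  comp_charIdem_of_forall χ ψ _ (charIdem_comp_strandMap χ ψ)

/-- Strand permutations of fewer strands, seen as permutations of more strands. -/
def strandIncl (n : ℕ) {l l' : ℕ} (h : l ≤ l') (s : strandPerm n l') : strandPerm n l :=
  ⟨s, fun i hi => s.2 i (hi.trans_le h)⟩

lemma strandMap_comp_capMap {l l' : ℕ} (h : l ≤ l' ∧ l' ≤ m ∧ l' ≤ n)
    (s : strandPerm n l') (t : strandPerm m l') :
    capMap (k := k) m n l l' ≫ strandMap s t =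
      strandMap (strandIncl n h.1 s) (strandIncl m h.1 t) ≫ capMap m n l l' := by
  apply indRes_trans_ext
  intro M g v
  refine (congrArg ((strandMap s t).app M).hom (capMap_mk h M g v)).trans ?_
  refine (strandMap_mk s t M _ _).trans ?_
  refine Eq.trans ?_ (congrArg ((capMap m n l l').app M).hom (strandMap_mk _ _ M g v)).symm
  exact (capMap_mk h M _ _).symm

lemma cupMap_comp_strandMap {l l' : ℕ} (h : l' ≤ l)
    (s : strandPerm n l) (t : strandPerm m l) :
    cupMap (k := k) m n l l' ≫ strandMap (strandIncl n h s) (strandIncl m h t) =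
      strandMap s t ≫ cupMap m n l l' := by
  rw [cupMap, Linear.smul_comp, Linear.comp_smul]
  congr 1
  apply indRes_trans_ext
  intro M g v
  have e1 := cupSum_mk (l := l) (l' := l') M g v
  have e2 := cupSum_mk (l := l) (l' := l') M ((s : Equiv.Perm (Fin n)) * g) (M.ρ (t : Equiv.Perm (Fin m)) v)
  rw [comp_app_hom, comp_app_hom, strandMap_mk, e1, e2, indRes_app_sum]
  refine Finset.sum_congr rfl fun c _ => ?_
  rw [strandMap_mk]
  simp only [strandIncl]
  rw [← mul_assoc, strandPerm_mul_headPerm le_rfl s.2, mul_assoc, ← Module.End.mul_apply,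
      ← map_mul, strandPerm_mul_headPerm le_rfl t.2, map_mul, Module.End.mul_apply]

lemma charIdem_capMap_charIdem [CharZero k] {l l' : ℕ} (h : l ≤ l' ∧ l' ≤ m ∧ l' ≤ n) :
    charIdem (k := k) χ ψ l ≫ capMap m n l l' ≫ charIdem χ ψ l' =
      charIdem χ ψ l ≫ capMap m n l l' := by
  rw [← Category.assoc]
  apply comp_charIdem_of_forall
  intro s t
  rw [Category.assoc, strandMap_comp_capMap h, ← Category.assoc, charIdem_comp_strandMap,
    Linear.smul_comp]
  rfl

lemma charIdem_cupMap_charIdem [CharZero k] {l l' : ℕ} (h : l' ≤ l) :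
    charIdem (k := k) χ ψ l ≫ cupMap m n l l' ≫ charIdem χ ψ l' =
      cupMap m n l l' ≫ charIdem χ ψ l' := by
  apply charIdem_comp_of_forall
  intro s t
  rw [← Category.assoc, ← cupMap_comp_strandMap h, Category.assoc, strandMap_comp_charIdem,
    Linear.comp_smul]
  rfl

/-- The transposition of the letters at positions `l` and `l + 1`. -/
def strandSwap (n l : ℕ) (h : l + 2 ≤ n) : strandPerm n l :=
  ⟨Equiv.swap ⟨l, by omega⟩ ⟨l + 1, by omega⟩, fun i hi =>
    Equiv.swap_apply_of_ne_of_ne (by rintro rfl; simp at hi) (by rintro rfl; simp at hi)⟩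

lemma headPerm_swap {l n : ℕ} (h : l + 2 ≤ n) :
    headPerm (l + 2) n (Equiv.swap ⟨l, by omega⟩ ⟨l + 1, by omega⟩) = strandSwap n l h := by
  ext i : 1
  rcases lt_or_ge (i : ℕ) (l + 2) with hi | hi
  · obtain ⟨j, rfl⟩ : ∃ j : Fin (l + 2), Fin.castLE h j = i := ⟨⟨i, hi⟩, rfl⟩
    rw [headPerm_apply_lt _ h, strandSwap]
    simp only [Equiv.swap_apply_def]
    split_ifs <;> simp_all [Fin.ext_iff]
  · rw [headPerm_apply_ge _ i hi]
    exact (Equiv.swap_apply_of_ne_of_ne (by rintro rfl; simp at hi) (by rintro rfl; simp at hi)).symm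

lemma strandSwap_comp_capMap {l : ℕ} (hm : l + 2 ≤ m) (hn : l + 2 ≤ n) :
    strandMap (k := k) (strandSwap n l hn) (strandSwap m l hm) ≫
      capMap m n l (l + 1) ≫ capMap m n (l + 1) (l + 2) =
      capMap m n l (l + 1) ≫ capMap m n (l + 1) (l + 2) := by
  apply indRes_trans_ext
  intro M g v
  have h1 : l ≤ l + 1 ∧ l + 1 ≤ m ∧ l + 1 ≤ n := by omega
  have h2 : l + 1 ≤ l + 2 ∧ l + 2 ≤ m ∧ l + 2 ≤ n := by omega
  have e : ∀ g v, ((capMap m n l (l + 1) ≫ capMap m n (l + 1) (l + 2)).app M).hom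
      (indResMk n l M g v) = indResMk n (l + 2) M g v := fun g v =>
    (congrArg ((capMap m n (l + 1) (l + 2)).app M).hom (capMap_mk h1 M g v)).trans
      (capMap_mk h2 M g v)
  refine (congrArg ((capMap m n l (l + 1) ≫ capMap m n (l + 1) (l + 2)).app M).hom
    (strandMap_mk _ _ M g v)).trans ?_
  refine (e _ _).trans (Eq.trans ?_ (e g v).symm)
  rw [← headPerm_swap, ← headPerm_swap, indResMk_rel]

lemma cupSum_cupSum_mk {l : ℕ} (hm : l + 2 ≤ m) (hn : l + 2 ≤ n) (M : SymRep k m) (g) (v : M.V) :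
    ((cupSum m n (l + 2) (l + 1) ≫ cupSum m n (l + 1) l).app M).hom (indResMk n (l + 2) M g v) =
      ∑ p : Equiv.Perm (Fin (l + 1)) × Equiv.Perm (Fin (l + 2)),
        indResMk n l M (headPerm (l + 2) n (headPerm (l + 1) (l + 2) p.1 * p.2) * g)
          (M.ρ (headPerm (l + 2) m (headPerm (l + 1) (l + 2) p.1 * p.2)) v) := by
  rw [Fintype.sum_prod_type_right]
  have e1 := cupSum_mk (l := l + 2) (l' := l + 1) M g v
  rw [comp_app_hom, e1, indRes_app_sum]
  refine Finset.sum_congr rfl fun d _ => ?_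
  rw [cupSum_mk]
  refine Finset.sum_congr rfl fun c _ => ?_
  rw [map_mul, map_mul, headPerm_headPerm (by omega) hn, headPerm_headPerm (by omega) hm,
    map_mul, Module.End.mul_apply, mul_assoc]

lemma cupMap_comp_strandSwap {l : ℕ} (hm : l + 2 ≤ m) (hn : l + 2 ≤ n) :
    (cupMap (k := k) m n (l + 2) (l + 1) ≫ cupMap m n (l + 1) l) ≫
      strandMap (strandSwap n l hn) (strandSwap m l hm) =
    cupMap m n (l + 2) (l + 1) ≫ cupMap m n (l + 1) l := by
  rw [cupMap, cupMap, Linear.smul_comp, Linear.comp_smul, smul_smul, Linear.smul_comp]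
  congr 1
  apply indRes_trans_ext
  intro M g v
  refine (congrArg ((strandMap (strandSwap n l hn) (strandSwap m l hm)).app M).hom
    (cupSum_cupSum_mk hm hn M g v)).trans (Eq.trans ?_ (cupSum_cupSum_mk hm hn M g v).symm)
  refine (indRes_app_sum (strandMap (strandSwap n l hn) (strandSwap m l hm)) M
    (fun p : Equiv.Perm (Fin (l + 1)) × Equiv.Perm (Fin (l + 2)) =>
      headPerm (l + 2) n (headPerm (l + 1) (l + 2) p.1 * p.2) * g)
    (fun p => M.ρ (headPerm (l + 2) m (headPerm (l + 1) (l + 2) p.1 * p.2)) v)).trans ?_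
  rw [Fintype.sum_prod_type, Fintype.sum_prod_type]
  refine Finset.sum_congr rfl fun c _ => ?_
  refine Fintype.sum_equiv (Equiv.mulLeft ((headPerm (l + 1) (l + 2) c)⁻¹ *
    Equiv.swap ⟨l, by omega⟩ ⟨l + 1, by omega⟩ * headPerm (l + 1) (l + 2) c)) _ _ fun d => ?_
  refine (strandMap_mk _ _ M _ _).trans ?_
  rw [← headPerm_swap, ← headPerm_swap, ← mul_assoc, ← map_mul, ← Module.End.mul_apply,
    ← map_mul, ← map_mul, Equiv.coe_mulLeft]
  simp only [mul_assoc, mul_inv_cancel_left]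

/-- Caps compose to zero. -/
lemma cap_cap [CharZero k] {l : ℕ} (hm : l + 2 ≤ m) (hn : l + 2 ≤ n)
    (hχψ : χ (strandSwap n l hn) * ψ (strandSwap m l hm) = -1) :
    charIdem (k := k) χ ψ l ≫ capMap m n l (l + 1) ≫ charIdem χ ψ (l + 1) ≫
      capMap m n (l + 1) (l + 2) ≫ charIdem χ ψ (l + 2) = 0 := by
  have h1 : l ≤ l + 1 ∧ l + 1 ≤ m ∧ l + 1 ≤ n := by omega
  have e : charIdem (k := k) χ ψ l ≫ capMap m n l (l + 1) ≫ capMap m n (l + 1) (l + 2) = 0 := by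
    have e1 := congrArg (charIdem (k := k) χ ψ l ≫ ·) (strandSwap_comp_capMap (k := k) hm hn)
    rw [← Category.assoc, charIdem_comp_strandMap, hχψ] at e1
    simp only [Units.val_neg, Units.val_one, Int.cast_neg, Int.cast_one, neg_smul, one_smul,
      Preadditive.neg_comp] at e1
    have e2 : (2 : k) • (charIdem (k := k) χ ψ l ≫ capMap m n l (l + 1) ≫
        capMap m n (l + 1) (l + 2)) = 0 := by
      rw [two_smul]
      nth_rewrite 1 [← e1]
      exact neg_add_cancel _
    exact (smul_eq_zero.1 e2).resolve_left two_ne_zero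
  have e3 := charIdem_capMap_charIdem (k := k) χ ψ h1
  calc _ = (charIdem (k := k) χ ψ l ≫ capMap m n l (l + 1) ≫ charIdem χ ψ (l + 1)) ≫
      capMap m n (l + 1) (l + 2) ≫ charIdem χ ψ (l + 2) := by simp only [Category.assoc]
    _ = (charIdem (k := k) χ ψ l ≫ capMap m n l (l + 1) ≫ capMap m n (l + 1) (l + 2)) ≫
      charIdem χ ψ (l + 2) := by rw [e3]; simp only [Category.assoc]
    _ = 0 := by rw [e, zero_comp]

/-- Cups compose to zero. -/
lemma cup_cup [CharZero k] {l : ℕ} (hm : l + 2 ≤ m) (hn : l + 2 ≤ n)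
    (hχψ : χ (strandSwap n l hn) * ψ (strandSwap m l hm) = -1) :
    charIdem (k := k) χ ψ (l + 2) ≫ cupMap m n (l + 2) (l + 1) ≫ charIdem χ ψ (l + 1) ≫
      cupMap m n (l + 1) l ≫ charIdem χ ψ l = 0 := by
  have e : (cupMap (k := k) m n (l + 2) (l + 1) ≫ cupMap m n (l + 1) l) ≫ charIdem χ ψ l = 0 := by
    have e1 := congrArg (· ≫ charIdem (k := k) χ ψ l) (cupMap_comp_strandSwap (k := k) hm hn)
    rw [Category.assoc, strandMap_comp_charIdem, hχψ] at e1
    simp only [Units.val_neg, Units.val_one, Int.cast_neg, Int.cast_one, neg_smul, one_smul,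
      Preadditive.comp_neg] at e1
    have e2 : (2 : k) • ((cupMap (k := k) m n (l + 2) (l + 1) ≫ cupMap m n (l + 1) l) ≫
        charIdem χ ψ l) = 0 := by
      rw [two_smul]
      nth_rewrite 1 [← e1]
      exact neg_add_cancel _
    exact (smul_eq_zero.1 e2).resolve_left two_ne_zero
  rw [charIdem_cupMap_charIdem χ ψ (Nat.le_succ l), ← Category.assoc (cupMap m n (l + 2) (l + 1)),
    e, comp_zero]

end lemmas

section image
variable {C : Type*} [Category* C] {G : Type} [Group G]

/-- The image of an endomorphism (in practice, an idempotent) `e` of a functor with values in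
representations. For an idempotent this is the object `(F, e)` of the Karoubi envelope. -/
def imageFunctor {F : C ⥤ Rep.{u} k G} (e : F ⟶ F) : C ⥤ Rep.{u} k G where
  obj M := (F.obj M).subrepresentation (LinearMap.range (e.app M).hom.toLinearMap) (by
    rintro g _ ⟨v, rfl⟩
    exact ⟨(F.obj M).ρ g v, Rep.hom_comm_apply _ _ _⟩)
  map {M N} f := Rep.ofHom ⟨(F.map f).hom.toLinearMap.restrict (by
    rintro _ ⟨v, rfl⟩
    exact ⟨(F.map f).hom v, congrArg (fun h => h.hom v) (e.naturality f)⟩), fun g => by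
      ext v
      exact Rep.hom_comm_apply (F.map f) g v.1⟩
  map_id M := by
    ext v
    exact congrArg (fun h => h.hom v.1) (F.map_id M)
  map_comp f f' := by
    ext v
    exact congrArg (fun h => h.hom v.1) (F.map_comp f f')

instance [Preadditive C] {F : C ⥤ Rep.{u} k G} [F.Additive] (e : F ⟶ F) :
    (imageFunctor e).Additive where
  map_add {M N f f'} := by
    ext v
    exact Subtype.ext (congrArg (fun h => h.hom v.1) (F.map_add (f := f) (g := f')))

/-- The map `e' f e` between the images of `e` and `e'`. -/
def imageMap {F F' : C ⥤ Rep.{u} k G} (e : F ⟶ F) (e' : F' ⟶ F') (f : F ⟶ F') :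
    imageFunctor e ⟶ imageFunctor e' where
  app M := Rep.ofHom ⟨((f ≫ e').app M).hom.toLinearMap.restrict (fun v _ =>
    ⟨(f.app M).hom v, rfl⟩), fun g => by
      ext v
      exact Rep.hom_comm_apply ((f ≫ e').app M) g v.1⟩
  naturality M N h := by
    ext v
    exact Subtype.ext (congrArg (fun h => h.hom v.1) ((f ≫ e').naturality h))

lemma imageMap_comp_eq_zero {F F' F'' : C ⥤ Rep.{u} k G} {e : F ⟶ F} {e' : F' ⟶ F'}
    {e'' : F'' ⟶ F''} {f : F ⟶ F'} {f' : F' ⟶ F''} (h : e ≫ f ≫ e' ≫ f' ≫ e'' = 0) :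
    imageMap e e' f ≫ imageMap e' e'' f' = 0 := by
  ext M ⟨_, v, rfl⟩
  exact Subtype.ext (congrArg (fun h => (h.app M).hom v) h)

end image

section complexes

/-- The usual signs `(-1)^i` for total complexes, in homological grading over the integers. -/
instance tensorSignsDownInt : ComplexShape.TensorSigns (ComplexShape.down ℤ) where
  ε' := MonoidHom.mk' Int.negOnePow Int.negOnePow_add
  rel_add p q r (hpq : q + 1 = p) := by
    change q + r + 1 = p + r
    omega
  add_rel p q r (hpq : q + 1 = p) := by
    change r + q + 1 = r + p
    omega
  ε'_succ := by
    intro p q (hpq : q + 1 = p)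
    subst hpq
    change Int.negOnePow q = -Int.negOnePow (q + 1)
    rw [Int.negOnePow_succ, neg_neg]

instance forgetObjPreservesZero {C D : Type*} [Category* C] [Category* D] [Preadditive C]
    [Preadditive D] (F : C ⥤+ D) : ((AdditiveFunctor.forget C D).obj F).PreservesZeroMorphisms :=
  haveI : ((AdditiveFunctor.forget C D).obj F).Additive := F.property
  inferInstance

/-- The action of a complex `B` of additive functors on a complex `X` of modules: the total complex
of the double complex `B_i (X_j)`. -/
def actOn {m n : ℕ} (B : ChainComplex (SymRep k m ⥤+ SymRep k n) ℤ)
    (X : ChainComplex (SymRep k m) ℤ) : ChainComplex (SymRep k n) ℤ :=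
  HomologicalComplex.mapBifunctor B X (AdditiveFunctor.forget _ _) (ComplexShape.down ℤ)

end complexes

section blocks
variable {m n : ℕ} (χ : Equiv.Perm (Fin n) →* ℤˣ) (ψ : Equiv.Perm (Fin m) →* ℤˣ)

/-- The idempotent of `charIdem` for `P^x Q^y`, `x = n - L`, `y = m - L`, if `0 ≤ x`, `0 ≤ y` and
`0 ≤ L` (if `L < 0` then `y > m`, so that `Q^y` is zero on `k[S_m]`-modules), and zero otherwise. -/
def stepIdem (L : ℤ) : indRes (k := k) m n L.toNat ⟶ indRes m n L.toNat :=
  if 0 ≤ L ∧ L ≤ m ∧ L ≤ n then charIdem χ ψ L.toNat else 0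

/-- The image of `P^x Q^y` under the idempotent of the characters `χ` and `ψ`, on `k[S_m]`-modules,
where `x = n - L`, `y = m - L`; it is zero unless `0 ≤ x` and `0 ≤ y ≤ m`. -/
def stepFunctor (L : ℤ) : SymRep k m ⥤+ SymRep k n :=
  AdditiveFunctor.of (imageFunctor (stepIdem χ ψ L))

/-- The cap, between the idempotents. -/
def capStep (L L' : ℤ) : stepFunctor (k := k) χ ψ L ⟶ stepFunctor χ ψ L' :=
  ⟨imageMap _ _ (capMap m n L.toNat L'.toNat)⟩

/-- The cup, between the idempotents. -/
def cupStep (L L' : ℤ) : stepFunctor (k := k) χ ψ L ⟶ stepFunctor χ ψ L' :=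
  ⟨imageMap _ _ (cupMap m n L.toNat L'.toNat)⟩

lemma capStep_capStep [CharZero k]
    (hχψ : ∀ l (hm : l + 2 ≤ m) (hn : l + 2 ≤ n),
      χ (strandSwap n l hn) * ψ (strandSwap m l hm) = -1)
    {L L' L'' : ℤ} (h' : L' = L + 1) (h'' : L'' = L + 2) :
    capStep (k := k) χ ψ L L' ≫ capStep χ ψ L' L'' = 0 := by
  subst h' h''
  apply ObjectProperty.hom_ext
  refine imageMap_comp_eq_zero ?_
  by_cases h0 : 0 ≤ L ∧ L ≤ m ∧ L ≤ n
  swap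
  · rw [stepIdem, if_neg h0, zero_comp]
  by_cases h2 : 0 ≤ L + 2 ∧ L + 2 ≤ m ∧ L + 2 ≤ n
  swap
  · rw [show stepIdem (k := k) χ ψ (L + 2) = 0 from if_neg h2]
    simp only [comp_zero]
  lift L to ℕ using h0.1
  rw [stepIdem, stepIdem, stepIdem, if_pos h0, if_pos (by omega), if_pos h2]
  exact cap_cap χ ψ (by omega) (by omega) (hχψ _ _ _)

lemma cupStep_cupStep [CharZero k]
    (hχψ : ∀ l (hm : l + 2 ≤ m) (hn : l + 2 ≤ n),
      χ (strandSwap n l hn) * ψ (strandSwap m l hm) = -1)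
    {L L' L'' : ℤ} (h' : L' = L'' + 1) (h'' : L = L'' + 2) :
    cupStep (k := k) χ ψ L L' ≫ cupStep χ ψ L' L'' = 0 := by
  subst h' h''
  apply ObjectProperty.hom_ext
  refine imageMap_comp_eq_zero ?_
  by_cases h0 : 0 ≤ L'' ∧ L'' ≤ m ∧ L'' ≤ n
  swap
  · rw [show stepIdem (k := k) χ ψ L'' = 0 from if_neg h0]
    simp only [comp_zero]
  by_cases h2 : 0 ≤ L'' + 2 ∧ L'' + 2 ≤ m ∧ L'' + 2 ≤ n
  swap
  · rw [stepIdem, if_neg h2, zero_comp]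
  lift L'' to ℕ using h0.1
  rw [stepIdem, stepIdem, stepIdem, if_pos h2, if_pos (by omega), if_pos h0]
  exact cup_cup χ ψ (by omega) (by omega) (hχψ _ _ _)

lemma sign_strandSwap (n l : ℕ) (h : l + 2 ≤ n) :
    Equiv.Perm.sign (strandSwap n l h : Equiv.Perm (Fin n)) = -1 :=
  Equiv.Perm.sign_swap (by simp [Fin.ext_iff])

variable (k) [CharZero k]

/-- The categorical Bernstein operator `B_a`, `a = n - m`, on `k[S_m]`-modules. In homological degree
`i = y` it is `P^{(x)} Q^{(y)^t}` with `x - y = a` (symmetrizer on `P^x`, antisymmetrizer on `Q^y`),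
which restricts to `S_L` with `L = m - i` and then induces to `S_n`; the differential is the cap. -/
def bernsteinBlock (m n : ℕ) : ChainComplex (SymRep k m ⥤+ SymRep k n) ℤ where
  X i := stepFunctor 1 Equiv.Perm.sign (m - i)
  d i j := if j + 1 = i then capStep 1 Equiv.Perm.sign (m - i) (m - j) else 0
  shape i j h := if_neg h
  d_comp_d' i j l (hij : j + 1 = i) (hjl : l + 1 = j) := by
    rw [if_pos hij, if_pos hjl]
    exact capStep_capStep _ _ (fun l hm hn => by simp [sign_strandSwap]) (by omega) (by omega)

/-- The categorical Bernstein operator `B_a^*`, `a = m - n`, on `k[S_m]`-modules. In homological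
degree `i = -x` it is `P^{(x)^t} Q^{(y)}` with `y - x = a` (antisymmetrizer on `P^x`, symmetrizer on
`Q^y`), which restricts to `S_L` with `L = n - x = n + i` and then induces to `S_n`; the differential
is the cup. -/
def dualBernsteinBlock (m n : ℕ) : ChainComplex (SymRep k m ⥤+ SymRep k n) ℤ where
  X i := stepFunctor Equiv.Perm.sign 1 (n + i)
  d i j := if j + 1 = i then cupStep Equiv.Perm.sign 1 (n + i) (n + j) else 0
  shape i j h := if_neg h
  d_comp_d' i j l (hij : j + 1 = i) (hjl : l + 1 = j) := by
    rw [if_pos hij, if_pos hjl]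
    exact cupStep_cupStep _ _ (fun l hm hn => by simp [sign_strandSwap]) (by omega) (by omega)

end blocks

section Fock
variable (k)

/-- Categorical Fock space: families of a `k[S_n]`-module for every `n`. The direct sum
`⊕_n k[S_n]`-mod is the full subcategory of the families of finite-dimensional modules of which all
but finitely many are zero; being full, it has the same chain maps and homotopies. -/
abbrev Fock := ∀ n : ℕ, SymRep k n

instance fockPreadditive : Preadditive (Fock k) where
  homGroup X Y := (inferInstance : AddCommGroup (∀ n, X n ⟶ Y n))
  add_comp X Y Z f f' g := funext fun n =>
    Preadditive.add_comp (X n) (Y n) (Z n) (f n) (f' n) (g n)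
  comp_add X Y Z f g g' := funext fun n =>
    Preadditive.comp_add (X n) (Y n) (Z n) (f n) (g n) (g' n)

variable {k}

/-- The `k[S_n]`-component of a complex. -/
def fockComponent (X : ChainComplex (Fock k) ℤ) (n : ℕ) : ChainComplex (SymRep k n) ℤ where
  X i := X.X i n
  d i j := X.d i j n
  shape i j h := congrFun (X.shape i j h) n
  d_comp_d' i j l _ _ := congrFun (X.d_comp_d i j l) n

/-- The complex with given components. -/
def fockAssemble (Y : ∀ n, ChainComplex (SymRep k n) ℤ) : ChainComplex (Fock k) ℤ where
  X i := fun n => (Y n).X i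
  d i j := fun n => (Y n).d i j
  shape i j h := funext fun n => (Y n).shape i j h
  d_comp_d' i j l _ _ := funext fun n => (Y n).d_comp_d i j l

open scoped ZeroObject

/-- A `k[S_n]`-module, as an object of Fock space, placed in homological degree zero. -/
def concentrated {n : ℕ} (M : SymRep k n) : ChainComplex (Fock k) ℤ :=
  fockAssemble fun j =>
    if h : n = j then (HomologicalComplex.single _ (ComplexShape.down ℤ) 0).obj (h ▸ M) else 0

variable [CharZero k]

/-- The categorical Bernstein operator `B_a` acting on complexes over Fock space: the
`k[S_n]`-component of the result comes from the component at `m = n - a`. -/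
def bernsteinOp (a : ℤ) (X : ChainComplex (Fock k) ℤ) : ChainComplex (Fock k) ℤ :=
  fockAssemble fun n =>
    if 0 ≤ (n : ℤ) - a then
      actOn (bernsteinBlock k (n - a).toNat n) (fockComponent X (n - a).toNat)
    else 0

/-- The categorical Bernstein operator `B_a^*` acting on complexes over Fock space: the
`k[S_n]`-component of the result comes from the component at `m = n + a`. -/
def dualBernsteinOp (a : ℤ) (X : ChainComplex (Fock k) ℤ) : ChainComplex (Fock k) ℤ :=
  fockAssemble fun n =>
    if 0 ≤ (n : ℤ) + a then
      actOn (dualBernsteinBlock k (n + a).toNat n) (fockComponent X (n + a).toNat)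
    else 0

end Fock

section Specht

lemma leftRegular_apply {G : Type} [Group G] (g : G) (x : MonoidAlgebra k G) :
    (Rep.leftRegular k G).ρ g x = MonoidAlgebra.single g 1 * x := by
  rw [← Representation.asAlgebraHom_ofMulAction_smul_eq_mul, Representation.asAlgebraHom_single,
    one_smul]

variable (k) {r : ℕ} (lam : Fin r → ℕ)

/-- The row of the letter `p` in the tableau of shape `lam` which is filled row by row. -/
def cellRow (p : Fin (∑ i, lam i)) : ℕ := (finSigmaFinEquiv.symm p).1
/-- The column of the letter `p` in the tableau of shape `lam` which is filled row by row. -/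
def cellCol (p : Fin (∑ i, lam i)) : ℕ := (finSigmaFinEquiv.symm p).2

/-- The row symmetrizer of this tableau. -/
def rowSum : MonoidAlgebra k (Equiv.Perm (Fin (∑ i, lam i))) :=
  ∑ g : Equiv.Perm (Fin (∑ i, lam i)) with ∀ p, cellRow lam (g p) = cellRow lam p,
    MonoidAlgebra.single g 1

/-- The column antisymmetrizer of this tableau. -/
def colSum : MonoidAlgebra k (Equiv.Perm (Fin (∑ i, lam i))) :=
  ∑ g : Equiv.Perm (Fin (∑ i, lam i)) with ∀ p, cellCol lam (g p) = cellCol lam p,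
    MonoidAlgebra.single g ((Equiv.Perm.sign g : ℤ) : k)

/-- The Specht module: the left ideal of `k[S_n]` generated by the Young symmetrizer (the column
antisymmetrizer times the row symmetrizer), `n = |lam|`. One row gives the trivial module, one
column the sign module. -/
def specht : SymRep k (∑ i, lam i) :=
  (Rep.leftRegular k (Equiv.Perm (Fin (∑ i, lam i)))).subrepresentation
    (LinearMap.range (LinearMap.mulRight k (colSum k lam * rowSum k lam))) (by
      rintro g _ ⟨x, rfl⟩
      refine ⟨MonoidAlgebra.single g 1 * x, ?_⟩
      change (MonoidAlgebra.single g 1 * x) * _ = _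
      rw [mul_assoc]
      exact (leftRegular_apply g _).symm)

end Specht

end

/-! The Specht module of $\lambda$ is modelled by `hwRep`, the functions on words of length $n$ in
$r$ letters which have weight $\lambda$ and are killed by all raising operators. This is Schur–Weyl
duality; `hwRepIsoSpecht` matches a highest weight vector with the Young symmetrizer. In this model
the sum of all transpositions acts by the scalar `casimir lam` (`swapSum_of_mem_highestWeight`), and
this scalar separates partitions that are comparable in the dominance order
(`casimir_injective_of_dominates`).

By induction on the rows it is enough to treat one operator $B_a$ or $B_a^*$, where
$\lambda=(a,\mu)$ and $a$ is the largest part.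

For $B_a(S_\mu)$ the argument is Hodge-theoretic. A rescaled cup serves as adjoint of the cap
differential. On generators, the Laplacian of the two is the sum of all transpositions in the
induced module, minus the one in $S_\mu$, plus a constant (`two_smul_laplaceGen`,
`laplacian_stepTerm`); on $S_\mu$ this becomes the sum of all transpositions minus the scalar of
$\lambda$ (`bernsteinLaplacian_apply`). Hence the kernel of the Laplacian is an eigenspace. The term
of degree $i$ maps to functions on words with $a+i$ letters $0$, of weights dominating $\lambda$. An
eigenfunction for the scalar of $\lambda$ must then have weight exactly $\lambda$
(`mem_highestWeight_of_eigen`), which is impossible for $i>0$ (`eq_zero_of_eigen`) and leaves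
exactly $S_\lambda$ for $i=0$ (`lowestMap_injective`, `exists_lowestMap_eq`). By finite dimension
the Laplacian is invertible in positive degrees, and its inverse gives an explicit contraction onto
$S_\lambda$ (`homotopyEquivSingleOfLaplacian`).

For $B_a^*(S_\lambda)$ all terms outside degree $0$ vanish, because a function of weight $\lambda$
lives on words with only $a$ letters $0$ (`dual_stepTerm_eq_zero`). In degree $0$, restriction to
the words ending in $a$ letters $0$ identifies the term with $S_\mu$: it is injective on invariants,
and surjective since $S_\mu$ is irreducible. Irreducibility (`highestWeight_irreducible`) comes from
the same restriction map, by induction on the number of rows together with Maschke's theorem. -/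

section Words

/-! ### Functions on words, highest weights and the eigenvalue of the sum of all transpositions. -/

variable {k : Type u} [Field k] {n r : ℕ}

/-- The number of occurrences of the letter `i` in the word `w`. -/
def content (w : Fin n → Fin r) (i : Fin r) : ℕ := (Finset.univ.filter fun p => w p = i).card

variable (k n r) in
/-- The permutation representation on functions on words of length `n` in `r` letters. -/
def wordRep : Representation k (Equiv.Perm (Fin n)) ((Fin n → Fin r) → k) where
  toFun g := LinearMap.funLeft k k fun w => w ∘ g
  map_one' := rfl
  map_mul' _ _ := rfl

lemma wordRep_apply (g : Equiv.Perm (Fin n)) (f : (Fin n → Fin r) → k) (w) :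
    wordRep k n r g f w = f (w ∘ g) := rfl

/-- The raising operator, changing one letter `j` into a letter `i`. -/
def raise (i j : Fin r) : ((Fin n → Fin r) → k) →ₗ[k] ((Fin n → Fin r) → k) where
  toFun f w := ∑ p with w p = i, f (Function.update w p j)
  map_add' f g := by ext w; simp [Finset.sum_add_distrib]
  map_smul' c f := by ext w; simp [Finset.mul_sum]

lemma raise_apply (i j : Fin r) (f : (Fin n → Fin r) → k) (w) :
    raise i j f w = ∑ p with w p = i, f (Function.update w p j) := rfl

/-- The sum of all `ρ (p q)` over all ordered pairs of letters. -/
def swapSum {V : Type*} [AddCommGroup V] [Module k V]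
    (ρ : Representation k (Equiv.Perm (Fin n)) V) : V →ₗ[k] V :=
  ∑ p, ∑ q, ρ (Equiv.swap p q)

lemma swapSum_apply {V : Type*} [AddCommGroup V] [Module k V]
    (ρ : Representation k (Equiv.Perm (Fin n)) V) (v : V) :
    swapSum ρ v = ∑ p, ∑ q, ρ (Equiv.swap p q) v := by
  simp [swapSum, LinearMap.sum_apply]

lemma sum_content (w : Fin n → Fin r) : ∑ i, content w i = n := by
  have := Finset.card_eq_sum_card_fiberwise (s := Finset.univ) (t := Finset.univ) (f := w)
    (fun _ _ => Finset.mem_coe.2 (Finset.mem_univ _))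
  simpa [content] using this.symm

lemma content_comp (w : Fin n → Fin r) (g : Equiv.Perm (Fin n)) : content (w ∘ g) = content w := by
  ext i
  refine Finset.card_bij (fun p _ => g p) (by simp) (by simp) ?_
  intro b hb
  exact ⟨g.symm b, by simpa using hb, by simp⟩

/-- Words of the same content are related by a permutation of the positions. -/
lemma exists_comp_eq_of_content_eq {w w' : Fin n → Fin r} (h : content w = content w') :
    ∃ g : Equiv.Perm (Fin n), w ∘ g = w' := by
  have e : ∀ i, Nonempty ({p // w' p = i} ≃ {p // w p = i}) := fun i => by
    refine ⟨Fintype.equivOfCardEq ?_⟩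
    have := congrFun h i
    rw [Fintype.card_subtype, Fintype.card_subtype]
    exact this.symm
  exact ⟨Equiv.ofFiberEquiv (f := w') (g := w) fun i => (e i).some,
    funext fun p => Equiv.ofFiberEquiv_map _ p⟩

/-- Raising operators act on the letters and permutations on the positions, so they commute: the
easy half of Schur–Weyl duality. -/
lemma raise_wordRep (i j : Fin r) (g : Equiv.Perm (Fin n)) (f : (Fin n → Fin r) → k) :
    raise i j (wordRep k n r g f) = wordRep k n r g (raise i j f) := by
  ext w
  rw [wordRep_apply, raise_apply, raise_apply]
  simp only [wordRep_apply]
  refine (Finset.sum_bij (fun p _ => g p) (by simp) (by simp) ?_ ?_).symm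
  · intro b hb
    exact ⟨g.symm b, by simpa using hb, by simp⟩
  · intro p _
    congr 1
    rw [Function.update_comp_eq_of_injective w g.injective]

lemma swapSum_raise (i j : Fin r) (f : (Fin n → Fin r) → k) :
    swapSum (wordRep k n r) (raise i j f) = raise i j (swapSum (wordRep k n r) f) := by
  simp only [swapSum_apply, map_sum, raise_wordRep]

variable (k n) in
/-- The highest weight functions of weight `lam`. -/
def highestWeight (lam : Fin r → ℕ) : Submodule k ((Fin n → Fin r) → k) where
  carrier := {f | (∀ w, f w ≠ 0 → content w = lam) ∧ ∀ i j, i < j → raise i j f = 0}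
  zero_mem' := ⟨fun w h => (h rfl).elim, fun i j _ => map_zero _⟩
  add_mem' {f g} hf hg := ⟨fun w h => by
    by_cases h1 : f w = 0
    · exact hg.1 w fun h2 => h (by simp [h1, h2])
    · exact hf.1 w h1, fun i j h => by rw [map_add, hf.2 i j h, hg.2 i j h, add_zero]⟩
  smul_mem' c f hf := ⟨fun w h => hf.1 w fun h1 => h (by simp [h1]), fun i j h => by
    rw [map_smul, hf.2 i j h, smul_zero]⟩

lemma wordRep_mem_highestWeight {lam : Fin r → ℕ} (g : Equiv.Perm (Fin n))
    {f : (Fin n → Fin r) → k} (hf : f ∈ highestWeight k n lam) :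
    wordRep k n r g f ∈ highestWeight k n lam :=
  ⟨fun w h => by rw [← content_comp w g]; exact hf.1 _ h, fun i j h => by
    rw [raise_wordRep, hf.2 i j h, map_zero]⟩

/-- The equation `raise i (w q) f = 0` at the word obtained from `w` by changing the letter at `q`
into `i`. -/
lemma raise_exchange {f : (Fin n → Fin r) → k} {i : Fin r} {w : Fin n → Fin r} {q : Fin n}
    (hq : w q ≠ i) (h : raise i (w q) f = 0) :
    f w + ∑ p with w p = i, f (w ∘ Equiv.swap p q) = 0 := by
  have h1 := congrFun h (Function.update w q i)
  rw [raise_apply] at h1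
  have h2 : (Finset.univ.filter fun p => Function.update w q i p = i) =
      insert q (Finset.univ.filter fun p => w p = i) := by
    ext p
    by_cases hp : p = q <;> simp [hp, Function.update_apply]
  rw [h2, Finset.sum_insert (by simp [hq])] at h1
  rw [Pi.zero_apply] at h1
  rw [← h1]
  congr 1
  · simp
  · refine Finset.sum_congr rfl fun p hp => ?_
    have hp : w p = i := by simpa using hp
    have hpq : p ≠ q := fun e => hq (e ▸ hp)
    congr 1
    ext s : 1
    simp only [Function.comp_apply, Function.update_apply, Equiv.swap_apply_def]
    split_ifs <;> simp_all

/-- The eigenvalue of `swapSum` on highest weight functions. -/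
def casimir (lam : Fin r → ℕ) : ℤ := ∑ i : Fin r, ((lam i : ℤ) ^ 2 - 2 * (i : ℕ) * lam i)

lemma sum_comp_content (w : Fin n → Fin r) {A : Type*} [AddCommMonoid A] (h : Fin r → A) :
    ∑ q, h (w q) = ∑ i, content w i • h i := by
  rw [← Finset.sum_fiberwise_of_maps_to (s := Finset.univ) (t := Finset.univ) (g := w)
    (fun _ _ => Finset.mem_univ _)]
  refine Finset.sum_congr rfl fun i _ => ?_
  rw [content, ← Finset.sum_const]
  refine Finset.sum_congr rfl fun q hq => ?_
  rw [(Finset.mem_filter.1 hq).2]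

/-- Split the ordered pairs of positions by comparing their letters. Pairs with equal letters fix
`w` and contribute $\sum_i\lambda_i^2$. For fixed `q` and a letter `i < w q`, `raise_exchange` says
that the positions with letter `i` contribute $-f(w)$ in total; there are `w q` such letters, which
gives $-\sum_i i\lambda_i$. The pairs in the opposite order contribute the same amount. -/
lemma swapSum_of_mem_highestWeight {lam : Fin r → ℕ} {f : (Fin n → Fin r) → k}
    (hf : f ∈ highestWeight k n lam) :
    swapSum (wordRep k n r) f = (casimir lam : k) • f := by
  ext w
  rw [swapSum_apply, Finset.sum_apply]
  simp only [Finset.sum_apply, wordRep_apply, Pi.smul_apply, smul_eq_mul]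
  by_cases hw : content w = lam
  swap
  · have h0 : ∀ g : Equiv.Perm (Fin n), f (w ∘ g) = 0 := fun g => by
      by_contra h
      exact hw ((content_comp w g).symm.trans (hf.1 _ h))
    have : f w = 0 := h0 1
    simp [h0, this]
  subst hw
  have e1 : ∀ p q : Fin n, f (w ∘ Equiv.swap p q) =
      (if w p = w q then f w else 0) + (if w p < w q then f (w ∘ Equiv.swap p q) else 0) +
        (if w q < w p then f (w ∘ Equiv.swap q p) else 0) := fun p q => by
    rcases lt_trichotomy (w p) (w q) with h | h | h
    · simp [h, h.ne, h.not_gt]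
    · have : w ∘ Equiv.swap p q = w := by
        ext s : 1
        simp only [Function.comp_apply, Equiv.swap_apply_def]
        split_ifs <;> simp_all
      simp [h, this]
    · simp [h, h.ne', h.not_gt, Equiv.swap_comm p q]
  have e2 : ∑ p, ∑ q, (if w p < w q then f (w ∘ Equiv.swap p q) else 0) =
      ∑ q, -((w q : ℕ) : k) * f w := by
    rw [Finset.sum_comm]
    refine Finset.sum_congr rfl fun q _ => ?_
    rw [← Finset.sum_fiberwise_of_maps_to (s := Finset.univ) (t := Finset.univ) (g := w)
      (fun _ _ => Finset.mem_univ _)]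
    have : ∀ i, ∑ p with w p = i, (if w p < w q then f (w ∘ Equiv.swap p q) else 0) =
        if i < w q then - f w else 0 := fun i => by
      by_cases hi : i < w q
      · rw [if_pos hi, eq_neg_iff_add_eq_zero, add_comm, ← raise_exchange hi.ne' (hf.2 _ _ hi)]
        congr 1
        refine Finset.sum_congr rfl fun p hp => ?_
        rw [(Finset.mem_filter.1 hp).2, if_pos hi]
      · rw [if_neg hi]
        refine Finset.sum_eq_zero fun p hp => ?_
        rw [(Finset.mem_filter.1 hp).2, if_neg hi]
    simp only [this]
    rw [← Finset.sum_filter, Finset.sum_const]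
    have hc : (Finset.univ.filter fun i => i < w q).card = (w q : ℕ) := by
      have : (Finset.univ.filter fun i => i < w q) = Finset.Iio (w q) := by ext; simp
      rw [this, Fin.card_Iio]
    rw [hc, nsmul_eq_mul]
    ring
  have e3 : ∑ p : Fin n, ∑ q : Fin n, (if w p = w q then f w else 0) =
      ∑ q, (content w (w q) : k) * f w := by
    rw [Finset.sum_comm]
    refine Finset.sum_congr rfl fun q _ => ?_
    rw [← Finset.sum_filter, Finset.sum_const, nsmul_eq_mul, content]
  have e4 : ∑ p, ∑ q, (if w q < w p then f (w ∘ Equiv.swap q p) else 0) =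
      ∑ q, -((w q : ℕ) : k) * f w := by rw [Finset.sum_comm, e2]
  simp only [Finset.sum_congr rfl fun p _ => Finset.sum_congr rfl fun q _ => e1 p q,
    Finset.sum_add_distrib, e2, e3, e4]
  rw [← Finset.sum_add_distrib, ← Finset.sum_add_distrib,
    sum_comp_content w (fun i => (content w i : k) * f w + -((i : ℕ) : k) * f w +
      -((i : ℕ) : k) * f w), casimir]
  push_cast
  rw [Finset.sum_mul]
  refine Finset.sum_congr rfl fun i _ => ?_
  rw [nsmul_eq_mul]
  ring

/-- A function which is invariant under the permutations of a set `B` of positions and killed by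
raising operators into the letter `i` is determined by its values at the words with letter `i` at
all positions in `B`. -/
lemma eq_zero_of_swap_invariant [CharZero k] {f : (Fin n → Fin r) → k} {i : Fin r}
    (B : Finset (Fin n))
    (hB : ∀ p ∈ B, ∀ q ∈ B, ∀ w, f (w ∘ Equiv.swap p q) = f w) (J : Fin r → Prop)
    (hJ : ∀ j, J j → j ≠ i ∧ raise i j f = 0)
    (h0 : ∀ w : Fin n → Fin r, (∀ p ∈ B, w p = i) → f w = 0) (w : Fin n → Fin r)
    (hw : ∀ p ∈ B, w p = i ∨ J (w p)) : f w = 0 := by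
  induction hd : (B.filter fun p => w p ≠ i).card using Nat.strong_induction_on generalizing w with
  | _ d ih =>
  subst hd
  by_cases hs : ∀ p ∈ B, w p = i
  · exact h0 w hs
  push Not at hs
  obtain ⟨s, hs, hsi⟩ := hs
  have hJs := hJ _ ((hw s hs).resolve_left hsi)
  have e := raise_exchange hsi hJs.2
  -- If `p` is in `B`, invariance gives back `f w`. Otherwise the exchange puts the letter `i` at
  -- `s`, so fewer positions of `B` carry a wrong letter and the induction gives zero. The exchange
  -- equation becomes a positive integer times `f w` equal to zero.
  have e1 : ∀ p, w p = i → f (w ∘ Equiv.swap p s) = if p ∈ B then f w else 0 := fun p hp => by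
    split_ifs with hpB
    · exact hB p hpB s hs w
    · have hw' : ∀ q ∈ B, (w ∘ Equiv.swap p s) q = if q = s then i else w q := fun q hq => by
        have hqp : q ≠ p := fun e => hpB (e ▸ hq)
        by_cases hqs : q = s
        · simp [hqs, hp]
        · simp [hqs, Equiv.swap_apply_of_ne_of_ne hqp hqs]
      refine ih _ ?_ _ ?_ rfl
      · refine Finset.card_lt_card ⟨?_, fun h => ?_⟩
        · intro q hq
          rw [Finset.mem_filter] at hq ⊢
          refine ⟨hq.1, fun hqi => hq.2 ?_⟩
          rw [hw' q hq.1]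
          split_ifs <;> simp [hqi]
        · have := h (Finset.mem_filter.2 ⟨hs, hsi⟩)
          rw [Finset.mem_filter, hw' s hs] at this
          simp at this
      · intro q hq
        rw [hw' q hq]
        split_ifs
        · exact Or.inl rfl
        · exact hw q hq
  rw [Finset.sum_congr rfl (fun p hp => e1 p (Finset.mem_filter.1 hp).2), ← Finset.sum_filter,
    Finset.sum_const, nsmul_eq_mul] at e
  have e2 : ((((Finset.univ.filter fun p => w p = i).filter (· ∈ B)).card + 1 : ℕ) : k) * f w = 0 := by
    push_cast
    linear_combination e
  exact (mul_eq_zero.1 e2).resolve_left (Nat.cast_ne_zero.2 (Nat.succ_ne_zero _))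

/-- Averaging over the permutations of a set of positions at which `w` has equal letters. -/
lemma exists_swap_invariant [CharZero k] (X : Submodule k ((Fin n → Fin r) → k))
    (hX : ∀ g, ∀ f ∈ X, wordRep k n r g f ∈ X) {f : (Fin n → Fin r) → k} (hf : f ∈ X)
    (B : Finset (Fin n)) (w : Fin n → Fin r) (hw : ∀ p ∈ B, ∀ q ∈ B, w p = w q) (hfw : f w ≠ 0) :
    ∃ f' ∈ X, f' w ≠ 0 ∧ ∀ p ∈ B, ∀ q ∈ B, ∀ w, f' (w ∘ Equiv.swap p q) = f' w := by
  classical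
  refine ⟨∑ g : Equiv.Perm (Fin n) with ∀ p, p ∉ B → g p = p, wordRep k n r g f,
    Submodule.sum_mem _ fun g _ => hX g f hf, ?_, ?_⟩
  · rw [Finset.sum_apply]
    -- Permutations that move only positions of `B` fix `w`, which is constant there. So nothing
    -- cancels at `w`: the value is multiplied by the order of the group.
    have : ∀ g ∈ (Finset.univ.filter fun g : Equiv.Perm (Fin n) => ∀ p, p ∉ B → g p = p),
        wordRep k n r g f w = f w := fun g hg => by
      have hg : ∀ p, p ∉ B → g p = p := (Finset.mem_filter.1 hg).2
      rw [wordRep_apply]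
      congr 1
      ext p : 1
      by_cases hp : p ∈ B
      · refine hw _ ?_ _ hp
        by_contra h
        have := g.injective (hg _ h)
        exact h (this.symm ▸ hp)
      · simp [hg p hp]
    rw [Finset.sum_congr rfl this, Finset.sum_const, nsmul_eq_mul]
    refine mul_ne_zero (Nat.cast_ne_zero.2 (Finset.card_ne_zero.2 ⟨1, ?_⟩)) hfw
    simp
  · intro p hp q hq w'
    rw [Finset.sum_apply, Finset.sum_apply]
    refine Finset.sum_bij (fun g _ => Equiv.swap p q * g) ?_ (by simp) ?_ ?_
    · intro g hg
      simp only [Finset.mem_filter, Finset.mem_univ, true_and] at hg ⊢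
      intro s hs
      rw [Equiv.Perm.mul_apply, hg s hs]
      exact Equiv.swap_apply_of_ne_of_ne (fun e => hs (e ▸ hp)) (fun e => hs (e ▸ hq))
    · intro g hg
      simp only [Finset.mem_filter, Finset.mem_univ, true_and] at hg
      refine ⟨Equiv.swap p q * g, ?_, by simp [← mul_assoc]⟩
      simp only [Finset.mem_filter, Finset.mem_univ, true_and]
      intro s hs
      rw [Equiv.Perm.mul_apply, hg s hs]
      exact Equiv.swap_apply_of_ne_of_ne (fun e => hs (e ▸ hp)) (fun e => hs (e ▸ hq))
    · intro g _
      rfl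

/-- If $\lambda_i<\lambda_j$ for some $i<j$, average over the $\lambda_j$ positions where a word of
the support has the letter `j`. By `eq_zero_of_swap_invariant` the average is determined by words
with the letter `i` at all these positions, and such a word has too many letters `i`. -/
lemma antitone_of_highestWeight_ne_zero [CharZero k] {lam : Fin r → ℕ}
    {f : (Fin n → Fin r) → k} (hf : f ∈ highestWeight k n lam) (hne : f ≠ 0) : Antitone lam := by
  obtain ⟨w, hw⟩ := Function.ne_iff.1 hne
  have hcw := hf.1 w hw
  intro i j hij
  rcases hij.eq_or_lt with rfl | hij
  · exact le_rfl
  by_contra hlt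
  push Not at hlt
  obtain ⟨f', hf', hfw, hinv⟩ := exists_swap_invariant (highestWeight k n lam)
    (fun g f hf => wordRep_mem_highestWeight g hf) hf (Finset.univ.filter fun p => w p = j) w
    (fun p hp q hq => ((Finset.mem_filter.1 hp).2.trans (Finset.mem_filter.1 hq).2.symm)) hw
  refine hfw (eq_zero_of_swap_invariant (i := i) _ hinv (fun s => s = j) ?_ ?_ w ?_)
  · rintro _ rfl
    exact ⟨hij.ne', hf'.2 _ _ hij⟩
  · intro w' hw'
    by_contra h
    have hc' := hf'.1 w' h
    have : content w j ≤ content w' i := Finset.card_le_card fun p hp => by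
      simpa using hw' p hp
    rw [hcw, hc'] at this
    omega
  · intro p hp
    exact Or.inr (Finset.mem_filter.1 hp).2

lemma content_update (w : Fin n → Fin r) (p : Fin n) (j t : Fin r) :
    content (Function.update w p j) t + (if t = w p then 1 else 0) =
      content w t + (if t = j then 1 else 0) := by
  have h : ∀ w : Fin n → Fin r, content w t =
      (if w p = t then 1 else 0) + ∑ q ∈ Finset.univ.erase p, if w q = t then 1 else 0 := fun w => by
    rw [content, Finset.card_filter, ← Finset.add_sum_erase _ _ (Finset.mem_univ p)]
  rw [h, h w]
  have : ∑ q ∈ Finset.univ.erase p, (if Function.update w p j q = t then 1 else 0) =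
      ∑ q ∈ Finset.univ.erase p, if w q = t then 1 else 0 :=
    Finset.sum_congr rfl fun q hq => by rw [Function.update_of_ne (Finset.ne_of_mem_erase hq)]
  rw [this, Function.update_self]
  simp only [@eq_comm _ t]
  omega

/-- The number of letters less than `t` in words of content `ν`. -/
def partialSum (ν : Fin r → ℕ) (t : ℕ) : ℕ :=
  ∑ i ∈ Finset.univ.filter (fun i : Fin r => (i : ℕ) < t), ν i

/-- The operators raising letters lead from any eigenfunction of `swapSum` to a highest weight
function of greater weight in the dominance order. -/
lemma exists_highestWeight (ν : Fin r → ℕ) (c : k) {f : (Fin n → Fin r) → k} (hf : f ≠ 0)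
    (hν : ∀ w, f w ≠ 0 → content w = ν) (hc : swapSum (wordRep k n r) f = c • f) :
    ∃ θ : Fin r → ℕ, ∃ g ∈ highestWeight k n θ, g ≠ 0 ∧ swapSum (wordRep k n r) g = c • g ∧
      ∀ t : ℕ, partialSum ν t ≤ partialSum θ t := by
  -- A nonzero raising operator replaces a letter `j` by a smaller letter `i`, so the weighted sum
  -- of the letters drops while the partial sums of the weight can only grow.
  induction hM : ∑ i : Fin r, (i : ℕ) * ν i using Nat.strong_induction_on generalizing ν f with
  | _ M ih =>
  subst hM
  by_cases h : ∀ i j, i < j → raise i j f = 0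
  · exact ⟨ν, f, ⟨hν, h⟩, hf, hc, fun _ => le_rfl⟩
  push Not at h
  obtain ⟨i, j, hij, hne⟩ := h
  have key : ∀ w, raise i j f w ≠ 0 → ∀ t, ν t + (if t = i then 1 else 0) =
      content w t + (if t = j then 1 else 0) := fun w hw t => by
    rw [raise_apply] at hw
    obtain ⟨p, hp, hp'⟩ := Finset.exists_ne_zero_of_sum_ne_zero hw
    rw [← hν _ hp', ← content_update w p j t, (Finset.mem_filter.1 hp).2]
  obtain ⟨w0, hw0⟩ := Function.ne_iff.1 hne
  have k0 := key w0 hw0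
  obtain ⟨θ, g, hg, hg0, hgc, hd⟩ := ih (∑ i : Fin r, (i : ℕ) * content w0 i) (by
      have e : ∑ t : Fin r, (t : ℕ) * (ν t + (if t = i then 1 else 0)) =
        ∑ t : Fin r, (t : ℕ) * (content w0 t + (if t = j then 1 else 0)) :=
        Finset.sum_congr rfl fun t _ => by rw [k0 t]
      simp only [mul_add, Finset.sum_add_distrib, mul_ite, mul_one, mul_zero, Finset.sum_ite_eq',
        Finset.mem_univ, if_true] at e
      have : (i : ℕ) < j := hij
      omega) (content w0) hne (fun w hw => by
        ext t
        have := key w hw t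
        have := k0 t
        omega) (by rw [swapSum_raise, hc, map_smul]) rfl
  refine ⟨θ, g, hg, hg0, hgc, fun t => le_trans ?_ (hd t)⟩
  have e : ∑ s ∈ Finset.univ.filter (fun s : Fin r => (s : ℕ) < t), (ν s + (if s = i then 1 else 0)) =
      ∑ s ∈ Finset.univ.filter (fun s : Fin r => (s : ℕ) < t), (content w0 s + (if s = j then 1 else 0)) :=
    Finset.sum_congr rfl fun s _ => by rw [k0 s]
  have hij' : (i : ℕ) < j := hij
  simp only [Finset.sum_add_distrib, Finset.sum_ite_eq', Finset.mem_filter, Finset.mem_univ,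
    true_and] at e
  simp only [partialSum]
  split_ifs at e <;> omega

/-- Abel summation, used to turn a difference of `casimir` values into a sum over the partial sums
that define dominance. -/
lemma sum_by_parts_int (δ b : ℕ → ℤ) (r : ℕ) :
    ∑ i ∈ Finset.range r, δ i * b i = (∑ i ∈ Finset.range r, δ i) * b r +
      ∑ i ∈ Finset.range r, (∑ j ∈ Finset.range (i + 1), δ j) * (b i - b (i + 1)) := by
  induction r with
  | zero => simp
  | succ r ih =>
    rw [Finset.sum_range_succ, ih, Finset.sum_range_succ _ r,
      Finset.sum_range_succ (fun i => (∑ j ∈ Finset.range (i + 1), δ j) * (b i - b (i + 1))),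
      Finset.sum_range_succ _ r]
    ring

lemma partialSum_eq_sum_range (f : Fin r → ℕ) (t : ℕ) (ht : t ≤ r) :
    partialSum f t = ∑ i ∈ Finset.range t, if h : i < r then f ⟨i, h⟩ else 0 := by
  refine Finset.sum_bij (fun i _ => (i : ℕ)) ?_ ?_ ?_ ?_
  · simp
  · intro a _ b _ h
    exact Fin.ext h
  · intro b hb
    have : b < t := by simpa using hb
    exact ⟨⟨b, by omega⟩, by simpa using this, rfl⟩
  · intro a _
    simp

/-- The difference of the two values is $\sum_i(\theta_i-\lambda_i)(\theta_i+\lambda_i-2i)$. The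
second factors strictly decrease in $i$, while the partial sums of the first ones are nonnegative
with total zero. After Abel summation all terms are nonnegative, so a zero sum forces every partial
sum to vanish. -/
lemma casimir_injective_of_dominates {lam θ : Fin r → ℕ} (hlam : Antitone lam) (hθ : Antitone θ)
    (hsum : ∑ i, lam i = ∑ i, θ i)
    (hd : ∀ t : ℕ, partialSum lam t ≤ partialSum θ t)
    (hc : casimir lam = casimir θ) : lam = θ := by
  set L : ℕ → ℕ := fun i => if h : i < r then lam ⟨i, h⟩ else 0 with hL
  set T : ℕ → ℕ := fun i => if h : i < r then θ ⟨i, h⟩ else 0 with hT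
  have hLa : ∀ i, i + 1 < r → L (i + 1) ≤ L i := fun i hi => by
    simp only [hL, hi, (Nat.lt_of_succ_lt hi), dif_pos]
    exact hlam (Fin.mk_le_mk.2 (Nat.le_succ i))
  have hTa : ∀ i, i + 1 < r → T (i + 1) ≤ T i := fun i hi => by
    simp only [hT, hi, (Nat.lt_of_succ_lt hi), dif_pos]
    exact hθ (Fin.mk_le_mk.2 (Nat.le_succ i))
  have hcas : ∀ f : Fin r → ℕ, casimir f = ∑ i ∈ Finset.range r,
      (((if h : i < r then f ⟨i, h⟩ else 0 : ℕ) : ℤ) ^ 2 -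
        2 * i * (if h : i < r then f ⟨i, h⟩ else 0 : ℕ)) := fun f => by
    rw [casimir, Finset.sum_range]
    simp
  have hD : ∀ t ≤ r, 0 ≤ ∑ i ∈ Finset.range t, ((T i : ℤ) - L i) := fun t ht => by
    have := hd t
    rw [partialSum_eq_sum_range _ t ht, partialSum_eq_sum_range _ t ht] at this
    rw [Finset.sum_sub_distrib, sub_nonneg]
    exact_mod_cast this
  have hDr : ∑ i ∈ Finset.range r, ((T i : ℤ) - L i) = 0 := by
    have e1 : ∑ i ∈ Finset.range r, L i = ∑ i ∈ Finset.range r, T i := by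
      rw [Finset.sum_range, Finset.sum_range]
      simpa [hL, hT] using hsum
    rw [Finset.sum_sub_distrib, sub_eq_zero]
    exact_mod_cast e1.symm
  have h1 := sum_by_parts_int (fun i => (T i : ℤ) - L i) (fun i => T i + L i - 2 * i) r
  have h2 : ∑ i ∈ Finset.range r, ((T i : ℤ) - L i) * (T i + L i - 2 * i) = 0 := by
    have : ∑ i ∈ Finset.range r, ((T i : ℤ) - L i) * (T i + L i - 2 * i) =
        casimir θ - casimir lam := by
      rw [hcas θ, hcas lam, ← Finset.sum_sub_distrib]
      refine Finset.sum_congr rfl fun i _ => ?_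
      change _ = (T i : ℤ) ^ 2 - 2 * i * T i - ((L i : ℤ) ^ 2 - 2 * i * L i)
      ring
    rw [this, hc, sub_self]
  rw [h2, hDr, zero_mul, zero_add] at h1
  have h3 : ∀ i ∈ Finset.range r, 0 ≤ (∑ j ∈ Finset.range (i + 1), ((T j : ℤ) - L j)) *
      (((T i : ℤ) + L i - 2 * i) - (T (i + 1) + L (i + 1) - 2 * (i + 1 : ℕ))) := fun i hi => by
    have hi : i < r := by simpa using hi
    -- The monotonicity of the parts is only available inside the range; at the last index the
    -- partial sum is the total, which is zero.
    rcases (Nat.succ_le_of_lt hi).eq_or_lt with h | h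
    · have h : i + 1 = r := h
      rw [h, hDr, zero_mul]
    · refine mul_nonneg (hD _ h.le) ?_
      have := hLa i h
      have := hTa i h
      push_cast
      omega
  have h4 := (Finset.sum_eq_zero_iff_of_nonneg h3).1 h1.symm
  have h5 : ∀ t ≤ r, ∑ i ∈ Finset.range t, ((T i : ℤ) - L i) = 0 := fun t ht => by
    rcases t with _ | t
    · simp
    rcases ht.eq_or_lt with h | h
    · rw [h, hDr]
    have := h4 t (by simpa using ht)
    refine (mul_eq_zero.1 this).resolve_right ?_
    have := hLa t h
    have := hTa t h
    push_cast
    omega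
  ext i
  have h6 := h5 (i + 1) i.2
  rw [Finset.sum_range_succ, h5 i i.2.le] at h6
  simp only [hL, hT, i.2, dif_pos] at h6
  simp at h6
  omega

/-- An eigenfunction of `swapSum` of a weight that dominates the partition `lam`, of the eigenvalue
of `lam`, has weight `lam` and is a highest weight function. -/
lemma mem_highestWeight_of_eigen [CharZero k] {lam ν : Fin r → ℕ} (hlam : Antitone lam)
    (hsum : ∑ i, lam i = n)
    (hd : ∀ t : ℕ, partialSum lam t ≤ partialSum ν t)
    {f : (Fin n → Fin r) → k} (hf : f ≠ 0) (hν : ∀ w, f w ≠ 0 → content w = ν)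
    (hc : swapSum (wordRep k n r) f = (casimir lam : k) • f) :
    ν = lam ∧ f ∈ highestWeight k n lam := by
  -- Raise `f` to a highest weight function of some weight `θ` above `ν`, hence above `lam`. It has
  -- the same eigenvalue, so `θ = lam`, and `ν` is squeezed between.
  have main : ∀ (ν : Fin r → ℕ)
    (_ : ∀ t : ℕ, partialSum lam t ≤ partialSum ν t)
    (f : (Fin n → Fin r) → k) (_ : f ≠ 0) (_ : ∀ w, f w ≠ 0 → content w = ν)
    (_ : swapSum (wordRep k n r) f = (casimir lam : k) • f),
    ∀ t : ℕ, partialSum ν t ≤ partialSum lam t := by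
    intro ν hd f hf hν hc
    obtain ⟨θ, g, hg, hg0, hgc, hd'⟩ := exists_highestWeight ν _ hf hν hc
    rw [swapSum_of_mem_highestWeight hg] at hgc
    have e : casimir lam = casimir θ := by
      have := smul_left_injective k hg0 hgc
      exact_mod_cast this.symm
    obtain ⟨w, hw⟩ := Function.ne_iff.1 hg0
    have hθ := hg.1 w hw
    have := casimir_injective_of_dominates hlam (antitone_of_highestWeight_ne_zero hg hg0)
      (by rw [hsum, ← hθ, sum_content]) (fun t => (hd t).trans (hd' t)) e
    rwa [← this] at hd'
  have eqv : ∀ ν : Fin r → ℕ, (∀ t : ℕ, partialSum lam t = partialSum ν t) →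
      ν = lam := fun ν h => by
    ext i
    have h1 := h (i + 1)
    have h2 := h i
    simp only [partialSum] at h1 h2
    have : (Finset.univ.filter fun j : Fin r => (j : ℕ) < i + 1) =
        insert i (Finset.univ.filter fun j : Fin r => (j : ℕ) < i) := by
      ext j
      simp only [Finset.mem_filter, Finset.mem_univ, true_and, Finset.mem_insert, Fin.ext_iff]
      omega
    rw [this, Finset.sum_insert (by simp), Finset.sum_insert (by simp), h2] at h1
    omega
  have e1 : ν = lam := eqv ν fun t => (hd t).antisymm (main ν hd f hf hν hc t)
  refine ⟨e1, fun w hw => (hν w hw).trans e1, fun i j hij => ?_⟩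
  subst e1
  -- A nonzero raised function is again an eigenfunction with the same eigenvalue, so `main` applies
  -- to it; but its weight is strictly larger.
  by_contra hne
  have key : ∀ w, raise i j f w ≠ 0 → ∀ t, ν t + (if t = i then 1 else 0) =
      content w t + (if t = j then 1 else 0) := fun w hw t => by
    rw [raise_apply] at hw
    obtain ⟨p, hp, hp'⟩ := Finset.exists_ne_zero_of_sum_ne_zero hw
    rw [← hν _ hp', ← content_update w p j t, (Finset.mem_filter.1 hp).2]
  obtain ⟨w0, hw0⟩ := Function.ne_iff.1 hne
  have k0 := key w0 hw0
  have hd2 : ∀ t : ℕ, partialSum ν t ≤ partialSum (content w0) t := fun t => by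
    have e : ∑ s ∈ Finset.univ.filter (fun s : Fin r => (s : ℕ) < t), (ν s + (if s = i then 1 else 0)) =
        ∑ s ∈ Finset.univ.filter (fun s : Fin r => (s : ℕ) < t), (content w0 s + (if s = j then 1 else 0)) :=
      Finset.sum_congr rfl fun s _ => by rw [k0 s]
    have hij' : (i : ℕ) < j := hij
    simp only [Finset.sum_add_distrib, Finset.sum_ite_eq', Finset.mem_filter, Finset.mem_univ,
      true_and] at e
    simp only [partialSum]
    split_ifs at e <;> omega
  have hle := main _ hd2 _ hne (fun w hw => by
        ext t
        have := key w hw t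
        have := k0 t
        omega) (by rw [swapSum_raise, hc, map_smul])
  have e2 := eqv (content w0) fun t => (hd2 t).antisymm (hle t)
  have e3 := k0 i
  rw [e2] at e3
  simp [hij.ne] at e3

end Words

/-! ### Restriction of words and irreducibility of the highest weight modules. -/

section Restriction

variable {k : Type u} [Field k] {n m r : ℕ}

/-- The word of length `n` obtained from the first `l` letters of `u`, shifted by one, followed by
letters `0`. -/
def extWord (n l : ℕ) (u : Fin m → Fin r) (p : Fin n) : Fin (r + 1) :=
  if h : (p : ℕ) < l ∧ (p : ℕ) < m then (u ⟨p, h.2⟩).succ else 0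

lemma extWord_of_le {l : ℕ} (u : Fin m → Fin r) {p : Fin n} (h : l ≤ p) : extWord n l u p = 0 :=
  dif_neg (by omega)

lemma extWord_of_lt {l : ℕ} (u : Fin m → Fin r) {p : Fin n} (q : Fin m) (h : (p : ℕ) < l)
    (hq : (q : ℕ) = p) : extWord n l u p = (u q).succ := by
  obtain ⟨q, hqm⟩ := q
  subst hq
  exact dif_pos ⟨h, hqm⟩

lemma extWord_eq_zero_iff {l : ℕ} (hlm : l ≤ m) (u : Fin m → Fin r) {p : Fin n} :
    extWord n l u p = 0 ↔ l ≤ p := by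
  constructor
  · intro h
    by_contra hp
    push Not at hp
    rw [extWord_of_lt u ⟨p, by omega⟩ hp rfl] at h
    exact Fin.succ_ne_zero _ h
  · exact extWord_of_le u

lemma extWord_eq_succ_iff {l : ℕ} (hlm : l ≤ m) (u : Fin m → Fin r) {p : Fin n} {i : Fin r} :
    extWord n l u p = i.succ ↔ ∃ q : Fin m, (q : ℕ) = p ∧ (q : ℕ) < l ∧ u q = i := by
  constructor
  · intro h
    have hp : (p : ℕ) < l := by
      by_contra hp
      rw [extWord_of_le u (by omega)] at h
      exact Fin.succ_ne_zero _ h.symm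
    refine ⟨⟨p, by omega⟩, rfl, hp, ?_⟩
    rw [extWord_of_lt u ⟨p, by omega⟩ hp rfl] at h
    exact Fin.succ_injective _ h
  · rintro ⟨q, hq, hl, rfl⟩
    exact extWord_of_lt u q (by omega) hq

lemma extWord_comp_headPerm {l : ℕ} (hln : l ≤ n) (hlm : l ≤ m) (u : Fin m → Fin r)
    (σ : Equiv.Perm (Fin l)) :
    extWord n l u ∘ headPerm l n σ = extWord n l (u ∘ headPerm l m σ) := by
  ext p : 1
  rcases lt_or_ge (p : ℕ) l with hp | hp
  · obtain ⟨q, rfl⟩ : ∃ q : Fin l, Fin.castLE hln q = p := ⟨⟨p, hp⟩, rfl⟩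
    rw [Function.comp_apply, headPerm_apply_lt σ hln,
      extWord_of_lt u (Fin.castLE hlm (σ q)) (by simp) (by simp),
      extWord_of_lt _ (Fin.castLE hlm q) (by simp) (by simp), Function.comp_apply,
      headPerm_apply_lt σ hlm]
  · rw [Function.comp_apply, headPerm_apply_ge σ p hp, extWord_of_le u hp, extWord_of_le _ hp]

lemma strandPerm_apply_ge {l : ℕ} {s : Equiv.Perm (Fin n)} (hs : s ∈ strandPerm n l) {p : Fin n}
    (hp : l ≤ p) : l ≤ (s p : ℕ) := by
  by_contra h
  push Not at h
  have := s.injective (hs _ h)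
  rw [this] at h
  omega

lemma extWord_comp_strandPerm {l : ℕ} (u : Fin m → Fin r) {s : Equiv.Perm (Fin n)}
    (hs : s ∈ strandPerm n l) : extWord n l u ∘ s = extWord n l u := by
  ext p : 1
  rcases lt_or_ge (p : ℕ) l with hp | hp
  · rw [Function.comp_apply, hs p hp]
  · rw [Function.comp_apply, extWord_of_le u hp, extWord_of_le u (strandPerm_apply_ge hs hp)]

lemma content_extWord_zero {l : ℕ} (hlm : l ≤ m) (u : Fin m → Fin r) :
    content (extWord n l u) 0 = n - l := by
  simp only [content, extWord_eq_zero_iff hlm]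
  have h := Finset.card_filter_add_card_filter_not (s := (Finset.univ : Finset (Fin n))) (fun p => l ≤ (p : ℕ))
  rw [Finset.card_univ, Fintype.card_fin] at h
  have h2 : (Finset.univ.filter fun p : Fin n => ¬ l ≤ (p : ℕ)).card = min l n := by
    simp only [not_le]
    rw [Fin.card_filter_val_lt, min_comm]
  omega

lemma content_extWord_succ {l : ℕ} (hln : l ≤ n) (hlm : l ≤ m) (u : Fin m → Fin r) (i : Fin r) :
    content (extWord n l u) i.succ =
      (Finset.univ.filter fun q : Fin m => u q = i ∧ (q : ℕ) < l).card := by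
  simp only [content, extWord_eq_succ_iff hlm]
  symm
  refine Finset.card_bij (fun q hq => ⟨q, by simp at hq; omega⟩) ?_ ?_ ?_
  · intro q hq
    simp at hq ⊢
    exact ⟨q, rfl, hq.2, hq.1⟩
  · intro a _ b _ h
    simpa [Fin.ext_iff] using h
  · intro p hp
    simp at hp
    obtain ⟨q, hq, hl, hu⟩ := hp
    exact ⟨q, by simp [hl, hu], Fin.ext hq⟩

lemma content_extWord (hmn : m ≤ n) (u : Fin m → Fin r) :
    content (extWord n m u) = Fin.cons (n - m) (content u) := by
  ext i
  refine Fin.cases ?_ (fun i => ?_) i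
  · rw [content_extWord_zero le_rfl, Fin.cons_zero]
  · rw [content_extWord_succ hmn le_rfl, Fin.cons_succ, content]
    simp

variable (k n m r) in
/-- Restriction of functions to the words which end with letters `0` at the positions from `m` on
and have no other letters `0`. -/
def restrWord : ((Fin n → Fin (r + 1)) → k) →ₗ[k] ((Fin m → Fin r) → k) :=
  LinearMap.funLeft k k (extWord n m)

lemma restrWord_apply (f : (Fin n → Fin (r + 1)) → k) (u) :
    restrWord k n m r f u = f (extWord n m u) := rfl

lemma headPerm_self (σ : Equiv.Perm (Fin m)) : headPerm m m σ = σ := by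
  ext p : 1
  exact headPerm_apply_lt σ le_rfl p

lemma restrWord_wordRep (hmn : m ≤ n) (σ : Equiv.Perm (Fin m)) (f : (Fin n → Fin (r + 1)) → k) :
    restrWord k n m r (wordRep k n (r + 1) (headPerm m n σ) f) =
      wordRep k m r σ (restrWord k n m r f) := by
  ext u
  rw [restrWord_apply, wordRep_apply, extWord_comp_headPerm hmn le_rfl, headPerm_self]
  rfl

lemma extWord_update (hmn : m ≤ n) (u : Fin m → Fin r) (q : Fin m) (j : Fin r) :
    extWord n m (Function.update u q j) =
      Function.update (extWord n m u) (Fin.castLE hmn q) j.succ := by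
  ext p : 1
  rw [Function.update_apply]
  split_ifs with hp
  · subst hp
    rw [extWord_of_lt _ q (by simp) (by simp), Function.update_self]
  · rcases lt_or_ge (p : ℕ) m with h | h
    · rw [extWord_of_lt _ ⟨p, h⟩ h rfl, extWord_of_lt _ ⟨p, h⟩ h rfl, Function.update_of_ne]
      rintro rfl
      exact hp rfl
    · rw [extWord_of_le _ h, extWord_of_le _ h]

lemma restrWord_raise (hmn : m ≤ n) (i j : Fin r) (f : (Fin n → Fin (r + 1)) → k) :
    restrWord k n m r (raise i.succ j.succ f) = raise i j (restrWord k n m r f) := by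
  ext u
  rw [restrWord_apply, raise_apply, raise_apply]
  symm
  refine Finset.sum_bij (fun q _ => Fin.castLE hmn q) ?_ ?_ ?_ ?_
  · intro q hq
    simp only [Finset.mem_filter, Finset.mem_univ, true_and, extWord_eq_succ_iff le_rfl] at hq ⊢
    exact ⟨q, rfl, q.2, hq⟩
  · intro a _ b _ h
    exact Fin.castLE_injective hmn h
  · intro p hp
    simp only [Finset.mem_filter, Finset.mem_univ, true_and, extWord_eq_succ_iff le_rfl] at hp
    obtain ⟨q, hq, _, hu⟩ := hp
    exact ⟨q, by simp [hu], Fin.ext hq⟩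
  · intro q _
    rw [restrWord_apply, extWord_update hmn]

lemma restrWord_mem_highestWeight (hmn : m ≤ n) {lam : Fin (r + 1) → ℕ}
    {f : (Fin n → Fin (r + 1)) → k} (hf : f ∈ highestWeight k n lam) :
    restrWord k n m r f ∈ highestWeight k m (Fin.tail lam) :=
  ⟨fun u hu => by
    have := hf.1 _ hu
    rw [content_extWord hmn] at this
    rw [← this, Fin.tail_cons], fun i j hij => by
    rw [← restrWord_raise hmn, hf.2 _ _ (Fin.succ_lt_succ_iff.2 hij), map_zero]⟩

variable (k n) in
/-- The functions which are invariant under the permutations of the positions from `l` on. -/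
def strandInvariants (r l : ℕ) : Submodule k ((Fin n → Fin r) → k) where
  carrier := {f | ∀ p q : Fin n, l ≤ (p : ℕ) → l ≤ (q : ℕ) → ∀ w, f (w ∘ Equiv.swap p q) = f w}
  zero_mem' := fun _ _ _ _ _ => rfl
  add_mem' {f g} hf hg := fun p q hp hq w => by
    rw [Pi.add_apply, hf p q hp hq, hg p q hp hq, Pi.add_apply]
  smul_mem' c f hf := fun p q hp hq w => by
    rw [Pi.smul_apply, hf p q hp hq, Pi.smul_apply]

lemma swap_mem_strandPerm {l : ℕ} {p q : Fin n} (hp : l ≤ (p : ℕ)) (hq : l ≤ (q : ℕ)) :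
    Equiv.swap p q ∈ strandPerm n l := fun i hi =>
  Equiv.swap_apply_of_ne_of_ne (by rintro rfl; omega) (by rintro rfl; omega)

lemma wordRep_headPerm_mem_strandInvariants {l : ℕ} (σ : Equiv.Perm (Fin l))
    {f : (Fin n → Fin r) → k} (hf : f ∈ strandInvariants k n r l) :
    wordRep k n r (headPerm l n σ) f ∈ strandInvariants k n r l := fun p q hp hq w => by
  have h := strandPerm_mul_headPerm le_rfl (swap_mem_strandPerm hp hq) σ
  rw [wordRep_apply, wordRep_apply, Function.comp_assoc, ← Equiv.Perm.coe_mul, h,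
    Equiv.Perm.coe_mul, ← Function.comp_assoc, hf p q hp hq]

/-- A highest weight function which is invariant under the permutations of the positions from `l` on
is determined by its values at the words with letters `0` at these positions. -/
lemma eq_zero_of_mem_strandInvariants [CharZero k] {l : ℕ} {lam : Fin (r + 1) → ℕ}
    {f : (Fin n → Fin (r + 1)) → k} (hf : f ∈ highestWeight k n lam)
    (hinv : f ∈ strandInvariants k n (r + 1) l)
    (h0 : ∀ w, (∀ p : Fin n, l ≤ (p : ℕ) → w p = 0) → content w = lam → f w = 0) : f = 0 := by
  ext w
  refine eq_zero_of_swap_invariant (i := 0) (Finset.univ.filter fun p : Fin n => l ≤ (p : ℕ)) ?_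
    (fun j => j ≠ 0) ?_ ?_ w ?_
  · intro p hp q hq w
    exact hinv p q (Finset.mem_filter.1 hp).2 (Finset.mem_filter.1 hq).2 w
  · intro j hj
    exact ⟨hj, hf.2 _ _ (Fin.pos_iff_ne_zero.2 hj)⟩
  · intro w hw
    by_contra h
    exact h (h0 w (fun p hp => hw p (by simpa using hp)) (hf.1 w h))
  · intro p _
    exact em _

lemma card_filter_ge (l : ℕ) :
    (Finset.univ.filter fun p : Fin n => l ≤ (p : ℕ)).card = n - l := by
  have := content_extWord_zero (n := n) (r := 1) (le_refl l) (fun _ => 0)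
  simpa only [content, extWord_eq_zero_iff le_rfl] using this

/-- The function is determined by words with letters $0$ at all $n-l$ last positions, and a word of
content $\lambda$ has too few of them. This is why $Q^{(y)}$ kills $S_\lambda$ for $y>\lambda_1$. -/
lemma eq_zero_of_mem_strandInvariants_of_lt [CharZero k] {l : ℕ} {lam : Fin (r + 1) → ℕ}
    {f : (Fin n → Fin (r + 1)) → k} (hf : f ∈ highestWeight k n lam)
    (hinv : f ∈ strandInvariants k n (r + 1) l) (hl : lam 0 < n - l) : f = 0 := by
  refine eq_zero_of_mem_strandInvariants hf hinv fun w hw hc => ?_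
  have : n - l ≤ content w 0 := by
    rw [← card_filter_ge]
    exact Finset.card_le_card fun p hp => by simpa using hw p (by simpa using hp)
  rw [hc] at this
  omega

/-- The last $n-m$ positions use up all the letters $0$, so the other letters are nonzero and can be
shifted down by one. -/
lemma eq_extWord_of_content {lam : Fin (r + 1) → ℕ} (hlam : lam 0 = n - m)
    {w : Fin n → Fin (r + 1)} (hw : ∀ p : Fin n, m ≤ (p : ℕ) → w p = 0) (hc : content w = lam)
    (hmn : m ≤ n) : ∃ u : Fin m → Fin r, extWord n m u = w := by
  have hz : (Finset.univ.filter fun p : Fin n => m ≤ (p : ℕ)) =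
      Finset.univ.filter fun p : Fin n => w p = 0 := by
    refine Finset.eq_of_subset_of_card_le (fun p hp => by simpa using hw p (by simpa using hp)) ?_
    rw [card_filter_ge, ← hlam, ← hc, content]
  have hne : ∀ q : Fin m, w (Fin.castLE hmn q) ≠ 0 := fun q hq => by
    have : Fin.castLE hmn q ∈ Finset.univ.filter fun p : Fin n => m ≤ (p : ℕ) := by
      rw [hz]; simpa using hq
    have := (Finset.mem_filter.1 this).2
    simp at this
    omega
  refine ⟨fun q => (w (Fin.castLE hmn q)).pred (hne q), ?_⟩
  ext p : 1
  rcases lt_or_ge (p : ℕ) m with hp | hp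
  · rw [extWord_of_lt _ ⟨p, hp⟩ hp rfl, Fin.succ_pred]
    rfl
  · rw [extWord_of_le _ hp, hw p hp]

/-- Injectivity of restriction on the invariants: the words with letters $0$ at the end, which
determine the function, are exactly the extended words when $\lambda_1=n-m$. -/
lemma eq_zero_of_restrWord_eq_zero [CharZero k] (hmn : m ≤ n) {lam : Fin (r + 1) → ℕ}
    (hlam : lam 0 = n - m) {f : (Fin n → Fin (r + 1)) → k} (hf : f ∈ highestWeight k n lam)
    (hinv : f ∈ strandInvariants k n (r + 1) m) (h0 : restrWord k n m r f = 0) : f = 0 := by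
  refine eq_zero_of_mem_strandInvariants hf hinv fun w hw hc => ?_
  obtain ⟨u, rfl⟩ := eq_extWord_of_content hlam hw hc hmn
  exact congrFun h0 u

lemma exists_content_eq {ν : Fin r → ℕ} (hν : ∑ i, ν i = m) : ∃ u : Fin m → Fin r, content u = ν := by
  subst hν
  refine ⟨fun p => (finSigmaFinEquiv.symm p).1, ?_⟩
  ext i
  rw [content]
  rw [← Fintype.card_fin (ν i), ← Finset.card_univ]
  symm
  refine Finset.card_bij (fun c _ => finSigmaFinEquiv ⟨i, c⟩) (by simp) ?_ ?_
  · intro a _ b _ h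
    simpa using h
  · intro p hp
    obtain rfl : (finSigmaFinEquiv (n := ν).symm p).1 = i := by simpa using hp
    exact ⟨(finSigmaFinEquiv.symm p).2, Finset.mem_univ _, by simp⟩

/-- A word in the support has the content of an extended word, so a permutation moves the support to
that word. Averaging over the last positions, where it is constantly $0$, keeps the value there
nonzero. -/
lemma exists_strandInvariant_ne_zero [CharZero k] (hmn : m ≤ n) {lam : Fin (r + 1) → ℕ}
    (hlam : lam 0 = n - m) (hsum : ∑ i, lam i = n) (X : Submodule k ((Fin n → Fin (r + 1)) → k))
    (hX : ∀ g, ∀ f ∈ X, wordRep k n (r + 1) g f ∈ X) (hle : X ≤ highestWeight k n lam)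
    (hne : X ≠ ⊥) : ∃ f ∈ X, f ∈ strandInvariants k n (r + 1) m ∧ f ≠ 0 := by
  obtain ⟨f, hf, hf0⟩ := (Submodule.ne_bot_iff X).1 hne
  obtain ⟨w, hw⟩ := Function.ne_iff.1 hf0
  have hs : ∑ i, Fin.tail lam i = m := by
    have e : lam 0 + ∑ i, Fin.tail lam i = n := by rw [← hsum, Fin.sum_univ_succ]; rfl
    omega
  obtain ⟨u, hu⟩ := exists_content_eq hs
  have hc : content (extWord n m u) = content w := by
    rw [content_extWord hmn, (hle hf).1 w hw, hu, ← hlam, Fin.cons_self_tail]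
  obtain ⟨g, hg⟩ := exists_comp_eq_of_content_eq hc
  obtain ⟨f', hf', hfw, hinv⟩ := exists_swap_invariant X hX (hX g f hf)
    (Finset.univ.filter fun p : Fin n => m ≤ (p : ℕ)) (extWord n m u) (fun p hp q hq => by
      rw [extWord_of_le u (Finset.mem_filter.1 hp).2, extWord_of_le u (Finset.mem_filter.1 hq).2])
    (by rw [wordRep_apply, hg]; exact hw)
  refine ⟨f', hf', fun p q hp hq w => hinv p (by simpa using hp) q (by simpa using hq) w, ?_⟩
  rintro rfl
  exact hfw rfl

/-- Maschke's theorem, in terms of submodules of the space of functions. -/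
lemma exists_invariant_isCompl [CharZero k] (X : Submodule k ((Fin n → Fin r) → k))
    (hX : ∀ g, ∀ f ∈ X, wordRep k n r g f ∈ X) :
    ∃ Y : Submodule k ((Fin n → Fin r) → k), (∀ g, ∀ f ∈ Y, wordRep k n r g f ∈ Y) ∧
      IsCompl X Y := by
  have : NeZero (Nat.card (Equiv.Perm (Fin n)) : k) :=
    ⟨Nat.cast_ne_zero.2 Nat.card_pos.ne'⟩
  obtain ⟨Y, hY⟩ := exists_isCompl (⟨X, fun g f hf => hX g f hf⟩ : Subrepresentation (wordRep k n r))
  refine ⟨Y.toSubmodule, fun g f hf => Y.apply_mem_toSubmodule g hf, ?_⟩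
  rw [isCompl_iff, disjoint_iff, codisjoint_iff] at hY ⊢
  exact ⟨congrArg Subrepresentation.toSubmodule hY.1, congrArg Subrepresentation.toSubmodule hY.2⟩

/-- Induction on the number of letters. For every nonzero invariant `X`, restriction embeds the
strand invariants of `X` into the highest weight functions of the remaining rows, as a nonzero
submodule, hence by induction onto everything. Two independent submodules `X` and `Y` cannot both
have this full image, because restriction is injective on their sum. -/
theorem highestWeight_irreducible [CharZero k] (lam : Fin r → ℕ) (hsum : ∑ i, lam i = n)
    (X : Submodule k ((Fin n → Fin r) → k)) (hX : ∀ g, ∀ f ∈ X, wordRep k n r g f ∈ X)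
    (hle : X ≤ highestWeight k n lam) (hne : X ≠ ⊥) : X = highestWeight k n lam := by
  induction r generalizing n with
  -- Without letters there is only the empty word, and the functions form a line.
  | zero =>
    have : n = 0 := by simpa using hsum.symm
    subst this
    refine le_antisymm hle fun f _ => ?_
    obtain ⟨f', hf', h0⟩ := (Submodule.ne_bot_iff X).1 hne
    have h1 : f' default ≠ 0 := fun h => h0 (funext fun w => by rw [Subsingleton.elim w default, h]; rfl)
    have : f = (f default / f' default) • f' := by
      ext w
      rw [Subsingleton.elim w default, Pi.smul_apply, smul_eq_mul, div_mul_cancel₀ _ h1]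
    rw [this]
    exact X.smul_mem _ hf'
  | succ r ih =>
    obtain ⟨m, hm⟩ : ∃ m, ∑ i, Fin.tail lam i = m := ⟨_, rfl⟩
    have hn : lam 0 + m = n := by rw [← hsum, Fin.sum_univ_succ, ← hm]; rfl
    have hmn : m ≤ n := by omega
    have hlam : lam 0 = n - m := by omega
    have key : ∀ X : Submodule k ((Fin n → Fin (r + 1)) → k),
        (∀ g, ∀ f ∈ X, wordRep k n (r + 1) g f ∈ X) → X ≤ highestWeight k n lam → X ≠ ⊥ →
        (X ⊓ strandInvariants k n (r + 1) m).map (restrWord k n m r) =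
          highestWeight k m (Fin.tail lam) ∧ highestWeight k m (Fin.tail lam) ≠ ⊥ := by
      intro X hX hle hne
      obtain ⟨f, hf, hinv, hf0⟩ := exists_strandInvariant_ne_zero hmn hlam hsum X hX hle hne
      have h1 : (X ⊓ strandInvariants k n (r + 1) m).map (restrWord k n m r) ≠ ⊥ := fun h => by
        refine hf0 (eq_zero_of_restrWord_eq_zero hmn hlam (hle hf) hinv ?_)
        have := Submodule.mem_map_of_mem (f := restrWord k n m r)
          (show f ∈ X ⊓ strandInvariants k n (r + 1) m from ⟨hf, hinv⟩)
        rwa [h, Submodule.mem_bot] at this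
      have h2 := ih (Fin.tail lam) hm ((X ⊓ strandInvariants k n (r + 1) m).map (restrWord k n m r))
        (by
          rintro σ _ ⟨f, hf, rfl⟩
          rw [← restrWord_wordRep hmn]
          exact Submodule.mem_map_of_mem
            ⟨hX _ _ hf.1, wordRep_headPerm_mem_strandInvariants σ hf.2⟩)
        (by
          rintro _ ⟨f, hf, rfl⟩
          exact restrWord_mem_highestWeight hmn (hle hf.1)) h1
      exact ⟨h2, h2 ▸ h1⟩
    obtain ⟨Y, hY, hc⟩ := exists_invariant_isCompl X hX
    by_cases hYH : Y ⊓ highestWeight k n lam = ⊥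
    · refine le_antisymm hle fun f hf => ?_
      obtain ⟨x, hx, y, hy, rfl⟩ := Submodule.mem_sup.1
        ((codisjoint_iff.1 hc.codisjoint ▸ Submodule.mem_top : f ∈ X ⊔ Y))
      have : y ∈ Y ⊓ highestWeight k n lam := ⟨hy, by
        simpa using (highestWeight k n lam).sub_mem hf (hle hx)⟩
      rw [hYH, Submodule.mem_bot] at this
      simpa [this] using hx
    -- A nonzero vector of the common image has preimages in `X` and in `Y`. Injectivity makes them
    -- equal, so they lie in the zero intersection.
    · obtain ⟨kX, hne'⟩ := key X hX hle hne
      obtain ⟨kY, _⟩ := key (Y ⊓ highestWeight k n lam)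
        (fun g f hf => ⟨hY g f hf.1, wordRep_mem_highestWeight g hf.2⟩) inf_le_right hYH
      obtain ⟨z, hz, hz0⟩ := (Submodule.ne_bot_iff _).1 hne'
      obtain ⟨x, hx, rfl⟩ := kX ▸ hz
      obtain ⟨y, hy, hxy⟩ := kY ▸ hz
      have h0 := eq_zero_of_restrWord_eq_zero hmn hlam
        ((highestWeight k n lam).sub_mem (hle hx.1) hy.1.2)
        ((strandInvariants k n (r + 1) m).sub_mem hx.2 hy.2) (by rw [map_sub, hxy, sub_self])
      rw [sub_eq_zero] at h0
      have : x ∈ X ⊓ Y := ⟨hx.1, h0 ▸ hy.1.1⟩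
      rw [disjoint_iff.1 hc.disjoint, Submodule.mem_bot] at this
      exact absurd (by rw [this, map_zero]) hz0

end Restriction

/-! ### The Specht module as the module of highest weight functions. -/

section SpechtHighestWeight

variable {k : Type u} [Field k] {n r : ℕ}

variable (k n) in
/-- The representation on the highest weight functions of weight `lam`. -/
abbrev hwRep (lam : Fin r → ℕ) : SymRep k n :=
  Rep.of ((wordRep k n r).subrepresentation (highestWeight k n lam)
    fun g _ hf => wordRep_mem_highestWeight g hf)

/-- A bijective morphism of representations, as an isomorphism. -/
noncomputable def repIsoOfBijective {G : Type} [Group G] {A B : Rep.{u} k G} (f : A ⟶ B)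
    (hf : Function.Bijective f.hom) : A ≅ B :=
  haveI : IsIso f := (ConcreteCategory.isIso_iff_bijective f).2 hf
  asIso f

variable (lam : Fin r → ℕ)

/-- The word of the rows of the letters in the tableau which is filled row by row. -/
def rowWord (p : Fin (∑ i, lam i)) : Fin r := (finSigmaFinEquiv.symm p).1

lemma rowWord_mk (i : Fin r) (c : Fin (lam i)) : rowWord lam (finSigmaFinEquiv ⟨i, c⟩) = i := by
  rw [rowWord, Equiv.symm_apply_apply]

lemma cellCol_mk (i : Fin r) (c : Fin (lam i)) : cellCol lam (finSigmaFinEquiv ⟨i, c⟩) = c := by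
  rw [cellCol, Equiv.symm_apply_apply]

lemma content_rowWord : content (rowWord lam) = lam := by
  ext i
  rw [content, ← Fintype.card_fin (lam i), ← Finset.card_univ]
  symm
  refine Finset.card_bij (fun c _ => finSigmaFinEquiv ⟨i, c⟩)
    (fun c _ => Finset.mem_filter.2 ⟨Finset.mem_univ _, rowWord_mk lam i c⟩) ?_ ?_
  · intro a _ b _ h
    simpa using h
  · intro p hp
    obtain rfl : (finSigmaFinEquiv (n := lam).symm p).1 = i := (Finset.mem_filter.1 hp).2
    exact ⟨(finSigmaFinEquiv.symm p).2, Finset.mem_univ _, by simp⟩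

lemma cellRow_eq (p : Fin (∑ i, lam i)) : cellRow lam p = (rowWord lam p : ℕ) := rfl

lemma eq_of_row_col {p q : Fin (∑ i, lam i)} (h : rowWord lam p = rowWord lam q)
    (h' : cellCol lam p = cellCol lam q) : p = q := by
  obtain ⟨⟨i, c⟩, rfl⟩ := (finSigmaFinEquiv (n := lam)).surjective p
  obtain ⟨⟨j, d⟩, rfl⟩ := (finSigmaFinEquiv (n := lam)).surjective q
  rw [rowWord_mk, rowWord_mk] at h
  rw [cellCol_mk, cellCol_mk] at h'
  subst h
  rw [Fin.ext h']

lemma exists_cell_above (hlam : Antitone lam) {i : Fin r} {q : Fin (∑ i, lam i)}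
    (hi : i ≤ rowWord lam q) : ∃ q', rowWord lam q' = i ∧ cellCol lam q' = cellCol lam q := by
  exact ⟨finSigmaFinEquiv ⟨i, ⟨cellCol lam q,
    lt_of_lt_of_le (finSigmaFinEquiv.symm q).2.2 (hlam hi)⟩⟩, rowWord_mk _ _ _, cellCol_mk _ _ _⟩

variable (k) in
/-- The indicator function of a word. -/
def wordDelta (w : Fin n → Fin r) : (Fin n → Fin r) → k := fun w' => if w' = w then 1 else 0

variable (k) in
/-- The sum of the translates of a function by the column group, with signs. -/
noncomputable def colAlt : ((Fin (∑ i, lam i) → Fin r) → k) →ₗ[k]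
    ((Fin (∑ i, lam i) → Fin r) → k) :=
  ∑ g : Equiv.Perm (Fin (∑ i, lam i)) with ∀ p, cellCol lam (g p) = cellCol lam p,
    ((Equiv.Perm.sign g : ℤ) : k) • wordRep k _ r g

lemma colAlt_apply (f : (Fin (∑ i, lam i) → Fin r) → k) : colAlt k lam f =
    ∑ g : Equiv.Perm (Fin (∑ i, lam i)) with ∀ p, cellCol lam (g p) = cellCol lam p,
      ((Equiv.Perm.sign g : ℤ) : k) • wordRep k _ r g f := by
  simp [colAlt, LinearMap.sum_apply]

/-- The terms of `g` and `g * swap p q` have opposite signs and cancel. -/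
lemma colAlt_eq_zero {f : (Fin (∑ i, lam i) → Fin r) → k} {p q : Fin (∑ i, lam i)} (hpq : p ≠ q)
    (hcol : cellCol lam p = cellCol lam q) (hf : wordRep k _ r (Equiv.swap p q) f = f) :
    colAlt k lam f = 0 := by
  rw [colAlt_apply]
  refine Finset.sum_involution (fun g _ => g * Equiv.swap p q) ?_ ?_ ?_ ?_
  · intro g _
    rw [map_mul (wordRep k _ r), Module.End.mul_apply, hf, Equiv.Perm.sign_mul,
      Equiv.Perm.sign_swap hpq]
    simp
  · intro g _ _ h
    have : Equiv.swap p q = 1 := by simpa using h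
    exact hpq (Equiv.swap_eq_one_iff.1 this)
  · intro g hg
    simp only [Finset.mem_filter, Finset.mem_univ, true_and] at hg ⊢
    intro s
    rw [Equiv.Perm.mul_apply, hg, Equiv.swap_apply_def]
    split_ifs with h1 h2
    · rw [h1, hcol]
    · rw [h2, hcol]
    · rfl
  · intro g _
    simp [mul_assoc]

lemma raise_wordDelta (i j : Fin r) (w : Fin n → Fin r) :
    raise i j (wordDelta k w) = ∑ q with w q = j, wordDelta k (Function.update w q i) := by
  ext v
  rw [raise_apply, Finset.sum_apply, Finset.sum_filter, Finset.sum_filter]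
  refine Finset.sum_congr rfl fun p _ => ?_
  simp only [wordDelta, ← ite_and]
  refine if_congr ?_ rfl rfl
  constructor
  · rintro ⟨rfl, rfl⟩
    simp
  · rintro ⟨rfl, rfl⟩
    simp

/-- Raising changes the letter `j` of a cell `q` into `i`. The cell of row `i` above `q` in the same
column, which exists because the rows get shorter, now has the same letter. Exchanging these two
cells fixes the word, so the column alternation vanishes. -/
lemma colAlt_wordDelta_mem (hlam : Antitone lam) :
    colAlt k lam (wordDelta k (rowWord lam)) ∈ highestWeight k (∑ i, lam i) lam := by
  constructor
  · intro w hw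
    rw [colAlt_apply, Finset.sum_apply] at hw
    obtain ⟨g, _, hg⟩ := Finset.exists_ne_zero_of_sum_ne_zero hw
    have : w ∘ g = rowWord lam := by
      by_contra h
      exact hg (by simp [wordRep_apply, wordDelta, h])
    rw [← content_comp w g, this, content_rowWord]
  · intro i j hij
    have : raise i j (colAlt k lam (wordDelta k (rowWord lam))) =
        colAlt k lam (raise i j (wordDelta k (rowWord lam))) := by
      simp only [colAlt_apply, map_sum, map_smul, raise_wordRep]
    rw [this, raise_wordDelta, map_sum]
    refine Finset.sum_eq_zero fun q hq => ?_
    have hq : rowWord lam q = j := (Finset.mem_filter.1 hq).2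
    obtain ⟨q', hq', hc⟩ := exists_cell_above lam hlam (i := i) (q := q) (hq ▸ hij.le)
    have hne : q' ≠ q := fun e => hij.ne (by rw [← hq', e, hq])
    refine colAlt_eq_zero lam hne hc ?_
    ext w
    rw [wordRep_apply]
    simp only [wordDelta]
    refine if_congr ?_ rfl rfl
    have e : Function.update (rowWord lam) q i ∘ Equiv.swap q' q =
        Function.update (rowWord lam) q i := by
      ext s : 1
      simp only [Function.comp_apply, Equiv.swap_apply_def]
      split_ifs with h1 h2
      · simp [h1, hne, hq']
      · simp [h2, hne, hq']
      · rfl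
    constructor
    · intro h
      rw [← e, ← h, Function.comp_assoc, ← Equiv.Perm.coe_mul, Equiv.swap_mul_self,
        Equiv.Perm.coe_one, Function.comp_id]
    · rintro rfl
      exact e

/-- The value at `rowWord lam` is one, since only the identity preserves both the row and the column
of every cell. -/
lemma colAlt_wordDelta_ne_zero : colAlt k lam (wordDelta k (rowWord lam)) ≠ 0 := by
  intro h
  have h1 := congrFun h (rowWord lam)
  rw [colAlt_apply, Finset.sum_apply, Finset.sum_eq_single 1] at h1
  · simp [wordDelta] at h1
  · intro g hg hne
    have hg := (Finset.mem_filter.1 hg).2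
    rw [Pi.smul_apply, wordRep_apply, wordDelta, if_neg, smul_zero]
    intro hr
    refine hne (Equiv.ext fun p => ?_)
    exact eq_of_row_col lam (congrFun hr p) (hg p)
  · intro h
    simp at h

/-- The functions on words as elements of the group algebra. -/
noncomputable def wordToAlgebra : ((Fin (∑ i, lam i) → Fin r) → k) →ₗ[k]
    MonoidAlgebra k (Equiv.Perm (Fin (∑ i, lam i))) where
  toFun f := ∑ g : Equiv.Perm (Fin (∑ i, lam i)),
    MonoidAlgebra.single g (f (rowWord lam ∘ (g⁻¹ : Equiv.Perm _)))
  map_add' f f' := by simp [MonoidAlgebra.single_add, Finset.sum_add_distrib]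
  map_smul' c f := by simp [Finset.smul_sum]

lemma wordToAlgebra_apply (f : (Fin (∑ i, lam i) → Fin r) → k) : wordToAlgebra lam f =
    ∑ g : Equiv.Perm (Fin (∑ i, lam i)),
      MonoidAlgebra.single g (f (rowWord lam ∘ (g⁻¹ : Equiv.Perm _))) := rfl

lemma wordToAlgebra_wordRep (h : Equiv.Perm (Fin (∑ i, lam i)))
    (f : (Fin (∑ i, lam i) → Fin r) → k) :
    wordToAlgebra lam (wordRep k _ r h f) = MonoidAlgebra.single h 1 * wordToAlgebra lam f := by
  rw [wordToAlgebra_apply, wordToAlgebra_apply, Finset.mul_sum]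
  symm
  refine Fintype.sum_equiv (Equiv.mulLeft h) _ _ fun g => ?_
  rw [MonoidAlgebra.single_mul_single, one_mul, Equiv.coe_mulLeft, wordRep_apply,
    Function.comp_assoc, ← Equiv.Perm.coe_mul]
  simp

lemma wordToAlgebra_wordDelta :
    wordToAlgebra lam (wordDelta k (rowWord lam)) = rowSum k lam := by
  rw [wordToAlgebra_apply, rowSum, Finset.sum_filter]
  refine Finset.sum_congr rfl fun g _ => ?_
  have : rowWord lam ∘ (g⁻¹ : Equiv.Perm _) = rowWord lam ↔
      ∀ p, cellRow lam (g p) = cellRow lam p := by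
    simp only [cellRow_eq, ← Fin.ext_iff]
    constructor
    · intro h p
      have := congrFun h (g p)
      simpa using this.symm
    · intro h
      ext p : 1
      have := h ((g⁻¹ : Equiv.Perm _) p)
      simpa using this.symm
  rw [wordDelta]
  split_ifs with h1 h2 h2
  · rfl
  · exact absurd (this.1 h1) h2
  · exact absurd (this.2 h2) h1
  · simp

/-- The indicator function of the row word goes to the row symmetrizer and the map is equivariant,
so the alternated highest weight vector goes to the Young symmetrizer. -/
lemma wordToAlgebra_colAlt :
    wordToAlgebra lam (colAlt k lam (wordDelta k (rowWord lam))) =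
      colSum k lam * rowSum k lam := by
  rw [colAlt_apply, map_sum, colSum, Finset.sum_mul]
  refine Finset.sum_congr rfl fun g _ => ?_
  rw [map_smul, wordToAlgebra_wordRep, wordToAlgebra_wordDelta, ← smul_mul_assoc]
  simp

/-- Every word of content `lam` is a rearrangement of `rowWord lam`, so every relevant value of `f`
occurs as a coefficient. -/
lemma wordToAlgebra_injOn {f : (Fin (∑ i, lam i) → Fin r) → k}
    (hf : f ∈ highestWeight k (∑ i, lam i) lam) (h : wordToAlgebra lam f = 0) : f = 0 := by
  ext w
  by_contra hw
  obtain ⟨g, hg⟩ := exists_comp_eq_of_content_eq ((content_rowWord lam).trans (hf.1 w hw).symm)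
  have h1 : (wordToAlgebra lam f).coeff g⁻¹ = f w := by
    rw [wordToAlgebra_apply, MonoidAlgebra.coeff_sum, Finset.sum_apply']
    simp only [MonoidAlgebra.coeff_single]
    rw [Finset.sum_eq_single g⁻¹]
    · simp [hg]
    · intro g' _ hne
      rw [Finsupp.single_apply, if_neg hne]
    · simp
  rw [h] at h1
  exact hw h1.symm

/-- The Young symmetrizer generates the same representation as the highest weight functions. -/
lemma map_wordToAlgebra_highestWeight [CharZero k] (hlam : Antitone lam) :
    (highestWeight k (∑ i, lam i) lam).map (wordToAlgebra lam) =
      LinearMap.range (LinearMap.mulRight k (colSum k lam * rowSum k lam)) := by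
  set J := LinearMap.range (LinearMap.mulRight k (colSum k lam * rowSum k lam)) with hJ
  have hJmul : ∀ x, ∀ y ∈ J, x * y ∈ J := by
    rintro x _ ⟨y, rfl⟩
    exact ⟨x * y, by simp [mul_assoc]⟩
  apply le_antisymm
  -- The highest weight functions whose image lies in the left ideal form an invariant submodule
  -- containing the alternated vector; by irreducibility it is everything.
  · have := highestWeight_irreducible lam rfl
      (J.comap (wordToAlgebra lam) ⊓ highestWeight k (∑ i, lam i) lam)
      (fun g f hf => ⟨by
        change wordToAlgebra lam _ ∈ J
        rw [wordToAlgebra_wordRep]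
        exact hJmul _ _ hf.1, wordRep_mem_highestWeight g hf.2⟩) inf_le_right (by
        refine (Submodule.ne_bot_iff _).2 ⟨_, ⟨?_, colAlt_wordDelta_mem lam hlam⟩,
          colAlt_wordDelta_ne_zero lam⟩
        change wordToAlgebra lam _ ∈ J
        rw [wordToAlgebra_colAlt]
        exact ⟨1, by simp⟩)
    rw [← this, Submodule.map_le_iff_le_comap]
    exact inf_le_left
  · rintro _ ⟨x, rfl⟩
    rw [LinearMap.mulRight_apply]
    induction x using MonoidAlgebra.induction_linear with
    | zero => rw [zero_mul]; exact Submodule.zero_mem _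
    | add x y hx hy => rw [add_mul]; exact Submodule.add_mem _ hx hy
    | single g c =>
      have e : MonoidAlgebra.single g c = c • MonoidAlgebra.single g (1 : k) := by simp
      rw [e, smul_mul_assoc, ← wordToAlgebra_colAlt, ← wordToAlgebra_wordRep]
      exact Submodule.smul_mem _ _ (Submodule.mem_map_of_mem
        (wordRep_mem_highestWeight g (colAlt_wordDelta_mem lam hlam)))

/-- The Specht module as the module of highest weight functions. -/
noncomputable def hwRepIsoSpecht [CharZero k] (hlam : Antitone lam) :
    hwRep k (∑ i, lam i) lam ≅ specht k lam :=
  repIsoOfBijective (Rep.ofHom ⟨(wordToAlgebra lam).restrict (fun f hf => by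
    rw [← map_wordToAlgebra_highestWeight lam hlam]
    exact Submodule.mem_map_of_mem hf), fun g => by
      ext f : 1
      apply Subtype.ext
      exact (wordToAlgebra_wordRep lam g f.1).trans (leftRegular_apply g _).symm⟩) (by
    constructor
    · intro f f' h
      have h1 : wordToAlgebra lam f.1 = wordToAlgebra lam f'.1 := congrArg Subtype.val h
      apply Subtype.ext
      rw [← sub_eq_zero]
      refine wordToAlgebra_injOn lam (Submodule.sub_mem _ f.2 f'.2) ?_
      rw [map_sub, h1, sub_self]
    · rintro ⟨x, hx⟩
      rw [← map_wordToAlgebra_highestWeight lam hlam] at hx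
      obtain ⟨f, hf, rfl⟩ := hx
      exact ⟨⟨f, hf⟩, rfl⟩)

lemma highestWeight_ne_bot {lam : Fin r → ℕ} (hlam : Antitone lam) (hsum : ∑ i, lam i = n) :
    highestWeight k n lam ≠ ⊥ := by
  subst hsum
  exact (Submodule.ne_bot_iff _).2
    ⟨_, colAlt_wordDelta_mem lam hlam, colAlt_wordDelta_ne_zero lam⟩

end SpechtHighestWeight

/-! ### Cap and cup on the generators of the image of the idempotent. -/

section Laplacian

/-- The positions from `l` on. -/
def geFin (n l : ℕ) : Finset (Fin n) := Finset.univ.filter fun p => l ≤ (p : ℕ)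

lemma mem_geFin {n l : ℕ} {p : Fin n} : p ∈ geFin n l ↔ l ≤ (p : ℕ) := by simp [geFin]

lemma card_geFin (n l : ℕ) : (geFin n l).card = n - l := card_filter_ge l

/-- Orbit and stabilizer: all fibres of $s\mapsto s^{-1}o$ over `Ω` have the order of the stabilizer
of `o`, and `F` is constant on each. This reduces averages over symmetric groups to averages over
single transpositions. -/
lemma average_cosets {k A G α : Type*} [Field k] [CharZero k] [AddCommGroup A] [Module k A]
    [Group G] [Fintype G] [MulAction G α] [DecidableEq α] (Ω : Finset α) (o : α)
    (τ : α → G) (hτ : ∀ w ∈ Ω, τ w • w = o) (hΩ : ∀ s : G, s⁻¹ • o ∈ Ω) (F : G → A)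
    (hF : ∀ s, F s = F (τ (s⁻¹ • o))) :
    (Fintype.card G : k)⁻¹ • ∑ s, F s = (Ω.card : k)⁻¹ • ∑ w ∈ Ω, F (τ w) := by
  set N := (Finset.univ.filter fun s : G => s⁻¹ • o = o).card with hN
  have h1 : ∀ w ∈ Ω, (Finset.univ.filter fun s : G => s⁻¹ • o = w).card = N := fun w hw => by
    symm
    refine Finset.card_bij (fun s _ => s * τ w) ?_ ?_ ?_
    · intro s hs
      have hs : s⁻¹ • o = o := by simpa using hs
      have : (τ w)⁻¹ • o = w := by rw [← hτ w hw, inv_smul_smul]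
      simp [mul_smul, hs, this]
    · intro a _ b _ h
      exact mul_right_cancel h
    · intro s hs
      have hs : s⁻¹ • o = w := by simpa using hs
      exact ⟨s * (τ w)⁻¹, by simp [mul_smul, hs, hτ w hw], by simp⟩
  have h2 : ∀ {B : Type _} [AddCommGroup B] (F : G → B), (∀ s, F s = F (τ (s⁻¹ • o))) →
      ∑ s, F s = N • ∑ w ∈ Ω, F (τ w) := fun F hF => by
    rw [← Finset.sum_fiberwise_of_maps_to (s := Finset.univ) (t := Ω) (g := fun s : G => s⁻¹ • o)
      (fun s _ => hΩ s), Finset.smul_sum]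
    refine Finset.sum_congr rfl fun w hw => ?_
    rw [← h1 w hw, ← Finset.sum_const]
    refine Finset.sum_congr rfl fun s hs => ?_
    rw [hF, (Finset.mem_filter.1 hs).2]
  have hcard : Fintype.card G = N * Ω.card := by
    rw [← Finset.card_univ, Finset.card_eq_sum_card_fiberwise (t := Ω) (f := fun s : G => s⁻¹ • o)
      (fun s _ => hΩ s), Finset.sum_congr rfl h1, Finset.sum_const, smul_eq_mul, mul_comm]
  have hN0 : (N : k) ≠ 0 := by
    refine Nat.cast_ne_zero.2 (Finset.card_ne_zero.2 ⟨1, ?_⟩)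
    simp
  rw [h2 F hF, hcard, ← Nat.cast_smul_eq_nsmul k, smul_smul]
  congr 1
  push_cast
  rw [mul_inv, mul_comm (N : k)⁻¹, mul_assoc, inv_mul_cancel₀ hN0, mul_one]

variable {k : Type u} [Field k] {m n : ℕ} (χ : Equiv.Perm (Fin n) →* ℤˣ)
  (ψ : Equiv.Perm (Fin m) →* ℤˣ)

/-- The projection of the class of `g ⊗ v` to the image of the idempotent. -/
noncomputable def stepGen (l : ℕ) (M : SymRep k m) (g : Equiv.Perm (Fin n)) :
    M.V →ₗ[k] ((indRes m n l).obj M).V :=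
  ((charIdem χ ψ l).app M).hom.toLinearMap ∘ₗ indResMk n l M g

lemma stepGen_apply (l : ℕ) (M : SymRep k m) (g : Equiv.Perm (Fin n)) (v : M.V) :
    stepGen χ ψ l M g v = ((charIdem χ ψ l).app M).hom (indResMk n l M g v) := rfl

lemma stepGen_rel {l : ℕ} (M : SymRep k m) (σ : Equiv.Perm (Fin l)) (g : Equiv.Perm (Fin n))
    (v : M.V) :
    stepGen χ ψ l M (headPerm l n σ * g) (M.ρ (headPerm l m σ) v) = stepGen χ ψ l M g v := by
  rw [stepGen_apply, indResMk_rel, stepGen_apply]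

lemma stepGen_strand {l : ℕ} (M : SymRep k m) {s : Equiv.Perm (Fin n)} (hs : s ∈ strandPerm n l)
    {t : Equiv.Perm (Fin m)} (ht : t ∈ strandPerm m l) (g : Equiv.Perm (Fin n)) (v : M.V) :
    stepGen χ ψ l M (s * g) (M.ρ t v) = (((χ s * ψ t : ℤˣ) : ℤ) : k) • stepGen χ ψ l M g v := by
  have h := congrArg (fun f : indRes (k := k) m n l ⟶ indRes m n l =>
    (f.app M).hom (indResMk n l M g v))
    (strandMap_comp_charIdem (k := k) χ ψ (⟨s, hs⟩ : strandPerm n l) ⟨t, ht⟩)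
  exact (congrArg ((charIdem χ ψ l).app M).hom
    (strandMap_mk (⟨s, hs⟩ : strandPerm n l) ⟨t, ht⟩ M g v).symm).trans h

lemma stepGen_ρ {l : ℕ} (M : SymRep k m) (h g : Equiv.Perm (Fin n)) (v : M.V) :
    ((indRes m n l).obj M).ρ h (stepGen χ ψ l M g v) = stepGen χ ψ l M (g * h⁻¹) v := by
  have e := Rep.hom_comm_apply ((charIdem (k := k) χ ψ l).app M) h (indResMk n l M g v)
  refine e.symm.trans ?_
  rw [stepGen_apply]
  exact congrArg ((charIdem χ ψ l).app M).hom (indRes_ρ_mk h g v)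

/-- The set of transpositions is stable under conjugation by `g`, so they can be moved from the
right of `g` to its left, where the relations and the strand permutations act. -/
lemma swapSum_stepGen {l : ℕ} (M : SymRep k m) (g : Equiv.Perm (Fin n)) (v : M.V) :
    swapSum ((indRes m n l).obj M).ρ (stepGen χ ψ l M g v) =
      ∑ p, ∑ q, stepGen χ ψ l M (Equiv.swap p q * g) v := by
  rw [swapSum_apply]
  refine Fintype.sum_equiv g _ _ fun p => Fintype.sum_equiv g _ _ fun q => ?_
  rw [stepGen_ρ, Equiv.swap_inv, Equiv.mul_swap_eq_swap_mul]

lemma stepGen_eq_sum (l : ℕ) (M : SymRep k m) (g : Equiv.Perm (Fin n)) (v : M.V) :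
    stepGen χ ψ l M g v = ((Fintype.card (strandPerm n l) : k)⁻¹ *
      (Fintype.card (strandPerm m l) : k)⁻¹) • ∑ s : strandPerm n l, ∑ t : strandPerm m l,
        (((χ s * ψ t : ℤˣ) : ℤ) : k) • indResMk n l M (s * g) (M.ρ t v) := by
  let E : (indRes (k := k) m n l ⟶ indRes m n l) →ₗ[k] ((indRes m n l).obj M).V :=
    { toFun := fun f => (f.app M).hom (indResMk n l M g v)
      map_add' := fun _ _ => rfl
      map_smul' := fun _ _ => rfl }
  change E (charIdem χ ψ l) = _
  rw [charIdem, map_smul]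
  simp only [map_sum, map_smul]
  congr 1
  refine Finset.sum_congr rfl fun s _ => Finset.sum_congr rfl fun t _ => ?_
  congr 1
  exact strandMap_mk s t M g v

lemma map_stepGen (l : ℕ) (M : SymRep k m) (g : Equiv.Perm (Fin n)) (v : M.V)
    {W : Type*} [AddCommGroup W] [Module k W] (Φ : ((indRes m n l).obj M).V →ₗ[k] W) :
    Φ (stepGen χ ψ l M g v) = ((Fintype.card (strandPerm n l) : k)⁻¹ *
      (Fintype.card (strandPerm m l) : k)⁻¹) • ∑ s : strandPerm n l, ∑ t : strandPerm m l,
        (((χ s * ψ t : ℤˣ) : ℤ) : k) • Φ (indResMk n l M (s * g) (M.ρ t v)) := by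
  rw [stepGen_eq_sum, map_smul]
  congr 1
  refine (map_sum Φ _ _).trans (Finset.sum_congr rfl fun s _ => ?_)
  refine (map_sum Φ _ _).trans (Finset.sum_congr rfl fun t _ => ?_)
  exact map_smul Φ _ _

variable [CharZero k]

/-- The transpositions of `l` with the positions `w ≥ l` represent the cosets of the strands from `l
+ 1` on among those from `l` on. -/
lemma average_strandPerm {A : Type*} [AddCommGroup A] [Module k A] {l : ℕ} (hl : l + 1 ≤ n)
    (F : Equiv.Perm (Fin n) → A) (hF : ∀ s ∈ strandPerm n (l + 1), ∀ s', F (s * s') = F s') :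
    (Fintype.card (strandPerm n l) : k)⁻¹ • ∑ s : strandPerm n l, F s =
      ((n - l : ℕ) : k)⁻¹ • ∑ w ∈ geFin n l, F (Equiv.swap w ⟨l, hl⟩) := by
  classical
  let o : Fin n := ⟨l, hl⟩
  have ho : l ≤ (o : ℕ) := le_rfl
  have h := average_cosets (k := k) (G := strandPerm n l) (α := Fin n)
    (geFin n l) o
    (fun w => if hw : l ≤ (w : ℕ) then ⟨Equiv.swap w o, swap_mem_strandPerm hw ho⟩ else 1)
    (by
      intro w hw
      rw [dif_pos (mem_geFin.1 hw)]
      exact Equiv.swap_apply_left w o)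
    (by
      intro s
      exact mem_geFin.2 (strandPerm_apply_ge (s⁻¹).2 ho))
    (fun s => F s.1) (by
      intro s
      have h1 : l ≤ ((s⁻¹ • o : Fin n) : ℕ) := strandPerm_apply_ge (s⁻¹).2 ho
      rw [dif_pos h1]
      set s1 : Equiv.Perm (Fin n) := s.1 with hs1
      have h2 : (s⁻¹ • o : Fin n) = s1⁻¹ o := rfl
      have e : s1 = (s1 * Equiv.swap (s⁻¹ • o) o) * Equiv.swap (s⁻¹ • o) o := by
        rw [mul_assoc, Equiv.swap_mul_self, mul_one]
      change F s1 = F (Equiv.swap (s⁻¹ • o) o)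
      rw [e]
      refine hF _ ?_ _
      intro i hi
      rcases (Nat.lt_succ_iff_lt_or_eq.1 hi) with hi | hi
      · rw [Equiv.Perm.mul_apply, swap_mem_strandPerm h1 ho i hi]
        exact s.2 i hi
      · have : i = o := Fin.ext hi
        rw [this, Equiv.Perm.mul_apply, Equiv.swap_apply_right, h2]
        simp)
  rw [card_geFin] at h
  rw [h]
  congr 1
  refine Finset.sum_congr rfl fun w hw => ?_
  rw [dif_pos (mem_geFin.1 hw)]

lemma capStep_mk {l : ℕ} (hm : l + 1 ≤ m) (hn : l + 1 ≤ n) (M : SymRep k m)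
    (g : Equiv.Perm (Fin n)) (v : M.V) :
    ((capMap m n l (l + 1) ≫ charIdem χ ψ (l + 1)).app M).hom (indResMk n l M g v) =
      stepGen χ ψ (l + 1) M g v := by
  have h1 : ((capMap m n l (l + 1)).app M).hom (indResMk n l M g v) = indResMk n (l + 1) M g v :=
    capMap_mk ⟨l.le_succ, hm, hn⟩ M g v
  refine (comp_app_hom (capMap (k := k) m n l (l + 1)) (charIdem χ ψ (l + 1)) M _).trans ?_
  rw [h1, stepGen_apply]

lemma capStep_stepGen {l : ℕ} (hm : l + 1 ≤ m) (hn : l + 1 ≤ n) (M : SymRep k m)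
    (g : Equiv.Perm (Fin n)) (v : M.V) :
    ((capMap m n l (l + 1) ≫ charIdem χ ψ (l + 1)).app M).hom (stepGen χ ψ l M g v) =
      ((Fintype.card (strandPerm n l) : k)⁻¹ * (Fintype.card (strandPerm m l) : k)⁻¹) •
        ∑ s : strandPerm n l, ∑ t : strandPerm m l, (((χ s * ψ t : ℤˣ) : ℤ) : k) •
          stepGen χ ψ (l + 1) M (s * g) (M.ρ t v) := by
  obtain ⟨Φ, hΦ⟩ : ∃ Φ : ((indRes (k := k) m n l).obj M).V →ₗ[k] ((indRes m n (l + 1)).obj M).V,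
      ∀ x, Φ x = ((capMap m n l (l + 1) ≫ charIdem χ ψ (l + 1)).app M).hom x :=
    ⟨((capMap (k := k) m n l (l + 1) ≫ charIdem χ ψ (l + 1)).app M).hom.toLinearMap, fun _ => rfl⟩
  have e2 : ∀ g v, Φ (indResMk n l M g v) = stepGen χ ψ (l + 1) M g v := fun g v =>
    (hΦ _).trans (capStep_mk χ ψ hm hn M g v)
  have e3 := map_stepGen χ ψ l M g v Φ
  simp only [e2] at e3
  rw [hΦ] at e3
  exact e3

/-- The idempotent after the cap absorbs the permutations of the remaining strands, so of the
averages in the idempotent before it only coset representatives survive: the choices of the strand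
`w` of $P$ and the strand `q` of $Q$ that are joined. -/
lemma cap_stepGen {l : ℕ} (hm : l + 1 ≤ m) (hn : l + 1 ≤ n) (M : SymRep k m)
    (g : Equiv.Perm (Fin n)) (v : M.V) :
    ((capMap m n l (l + 1) ≫ charIdem χ ψ (l + 1)).app M).hom (stepGen χ ψ l M g v) =
      (((n - l : ℕ) : k)⁻¹ * ((m - l : ℕ) : k)⁻¹) •
        ∑ w ∈ geFin n l, ∑ q ∈ geFin m l,
          (((χ (Equiv.swap w ⟨l, hn⟩) * ψ (Equiv.swap q ⟨l, hm⟩) : ℤˣ) : ℤ) : k) •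
            stepGen χ ψ (l + 1) M (Equiv.swap w ⟨l, hn⟩ * g) (M.ρ (Equiv.swap q ⟨l, hm⟩) v) := by
  have e3 := capStep_stepGen χ ψ hm hn M g v
  rw [e3, mul_smul, Finset.smul_sum]
  have e4 : ∀ s : Equiv.Perm (Fin n), (Fintype.card (strandPerm m l) : k)⁻¹ •
      ∑ t : strandPerm m l, (((χ s * ψ t : ℤˣ) : ℤ) : k) •
        stepGen χ ψ (l + 1) M (s * g) (M.ρ t v) = ((m - l : ℕ) : k)⁻¹ • ∑ q ∈ geFin m l,
          (((χ s * ψ (Equiv.swap q ⟨l, hm⟩) : ℤˣ) : ℤ) : k) •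
            stepGen χ ψ (l + 1) M (s * g) (M.ρ (Equiv.swap q ⟨l, hm⟩) v) := fun s =>
    average_strandPerm hm (fun t => (((χ s * ψ t : ℤˣ) : ℤ) : k) •
        stepGen χ ψ (l + 1) M (s * g) (M.ρ t v)) fun t ht t' => by
      have := stepGen_strand χ ψ M (one_mem (strandPerm n (l + 1))) ht (s * g) (M.ρ t' v)
      rw [one_mul, ← Module.End.mul_apply, ← map_mul] at this
      rw [this, smul_smul]
      congr 1
      rw [map_one, one_mul, map_mul, ← Int.cast_mul, ← Units.val_mul]
      congr 2
      calc χ s * (ψ t * ψ t') * ψ t = χ s * ψ t' * (ψ t * ψ t) := by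
            simp only [mul_assoc, mul_comm, mul_left_comm]
        _ = _ := by simp
  simp only [e4]
  rw [average_strandPerm hn (fun s => ((m - l : ℕ) : k)⁻¹ • ∑ q ∈ geFin m l,
          (((χ s * ψ (Equiv.swap q ⟨l, hm⟩) : ℤˣ) : ℤ) : k) •
            stepGen χ ψ (l + 1) M (s * g) (M.ρ (Equiv.swap q ⟨l, hm⟩) v)), mul_smul]
  · rw [Finset.smul_sum (r := ((m - l : ℕ) : k)⁻¹)]
  · intro s hs s'
    congr 1
    refine Finset.sum_congr rfl fun q _ => ?_
    have := stepGen_strand χ ψ M hs (one_mem (strandPerm m (l + 1))) (s' * g)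
      (M.ρ (Equiv.swap q ⟨l, hm⟩) v)
    rw [map_one, Module.End.one_apply, ← mul_assoc] at this
    rw [this, smul_smul]
    congr 1
    rw [map_one, mul_one, map_mul, ← Int.cast_mul, ← Units.val_mul]
    congr 2
    calc χ s * χ s' * ψ _ * χ s = χ s' * ψ (Equiv.swap q ⟨l, hm⟩) * (χ s * χ s) := by
          simp only [mul_comm, mul_left_comm]
      _ = _ := by simp

/-- The cup of a generator is the sum over the letters joined by the new strands. -/
lemma cup_stepGen {l : ℕ} (hm : l + 1 ≤ m) (hn : l + 1 ≤ n) (M : SymRep k m)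
    (g : Equiv.Perm (Fin n)) (v : M.V) :
    ((cupMap m n (l + 1) l ≫ charIdem χ ψ l).app M).hom (stepGen χ ψ (l + 1) M g v) =
      ∑ i : Fin (l + 1), stepGen χ ψ l M (Equiv.swap (Fin.castLE hn i) ⟨l, hn⟩ * g)
        (M.ρ (Equiv.swap (Fin.castLE hm i) ⟨l, hm⟩) v) := by
  have e1 : ((cupMap m n (l + 1) l ≫ charIdem χ ψ l).app M).hom (stepGen χ ψ (l + 1) M g v) =
      ((cupMap m n (l + 1) l ≫ charIdem χ ψ l).app M).hom (indResMk n (l + 1) M g v) :=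
    congrArg (fun f : indRes (k := k) m n (l + 1) ⟶ indRes m n l =>
      (f.app M).hom (indResMk n (l + 1) M g v))
      (charIdem_cupMap_charIdem (k := k) χ ψ (Nat.le_succ l))
  have hsw : ∀ {N : ℕ} (hN : l + 1 ≤ N) (i : Fin (l + 1)),
      headPerm (l + 1) N (Equiv.swap i (Fin.last l)) = Equiv.swap (Fin.castLE hN i) ⟨l, hN⟩ := by
    intro N hN i
    ext p : 1
    rcases lt_or_ge (p : ℕ) (l + 1) with hp | hp
    · obtain ⟨q, rfl⟩ : ∃ q : Fin (l + 1), Fin.castLE hN q = p := ⟨⟨p, hp⟩, rfl⟩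
      rw [headPerm_apply_lt _ hN]
      exact ((Fin.castLE_injective hN).swap_apply i (Fin.last l) q).symm
    · rw [headPerm_apply_ge _ p hp, Equiv.swap_apply_of_ne_of_ne]
      · rintro rfl
        simp at hp
        omega
      · rintro rfl
        simp at hp
  let F : Equiv.Perm (Fin (l + 1)) → ((indRes m n l).obj M).V := fun c =>
    stepGen χ ψ l M (headPerm (l + 1) n c * g) (M.ρ (headPerm (l + 1) m c) v)
  have e2 : ((cupMap m n (l + 1) l ≫ charIdem χ ψ l).app M).hom (indResMk n (l + 1) M g v) =
      (Fintype.card (Equiv.Perm (Fin l)) : k)⁻¹ • ∑ c, F c := by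
    have h1 : ((cupMap m n (l + 1) l).app M).hom (indResMk n (l + 1) M g v) =
        (Fintype.card (Equiv.Perm (Fin l)) : k)⁻¹ • ∑ c : Equiv.Perm (Fin (l + 1)),
          indResMk n l M (headPerm (l + 1) n c * g) (M.ρ (headPerm (l + 1) m c) v) :=
      congrArg ((Fintype.card (Equiv.Perm (Fin l)) : k)⁻¹ • ·) (cupSum_mk (l' := l) M g v)
    refine (congrArg ((charIdem χ ψ l).app M).hom h1).trans ?_
    refine (map_smul ((charIdem χ ψ l).app M).hom.toLinearMap _ _).trans ?_
    congr 1
    exact map_sum ((charIdem χ ψ l).app M).hom.toLinearMap _ _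
  have hF : ∀ s : Equiv.Perm (Fin (l + 1)), F s = F (Equiv.swap (s⁻¹ • Fin.last l) (Fin.last l)) := by
    intro s
    -- This product fixes the last letter, so it comes from $S_l$ and is absorbed by the relations
    -- of the induced module.
    obtain ⟨c, hc⟩ : ∃ c, c = s * Equiv.swap (s⁻¹ • Fin.last l) (Fin.last l) := ⟨_, rfl⟩
    have hlast : c (Fin.last l) = Fin.last l := by
      rw [hc, Equiv.Perm.mul_apply, Equiv.swap_apply_right]
      exact s.apply_symm_apply _
    have hs : s = c * Equiv.swap (s⁻¹ • Fin.last l) (Fin.last l) := by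
      rw [hc, mul_assoc, Equiv.swap_mul_self, mul_one]
    generalize Equiv.swap (s⁻¹ • Fin.last l) (Fin.last l) = τ at hs
    subst hs
    clear hc
    have hlt : ∀ i : Fin l, (c i.castSucc : ℕ) < l := fun i => by
      have h1 : c i.castSucc ≠ Fin.last l := fun h =>
        (Fin.castSucc_lt_last i).ne (c.injective (h.trans hlast.symm))
      exact Fin.val_lt_last h1
    let σ : Equiv.Perm (Fin l) := Equiv.ofBijective (fun i => ⟨c i.castSucc, hlt i⟩)
      (Finite.injective_iff_bijective.1 fun a b h => by
        have : c a.castSucc = c b.castSucc := Fin.ext (by simpa using h)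
        exact Fin.castSucc_injective l (c.injective this))
    have hσ : headPerm l (l + 1) σ = c := by
      ext p : 1
      rcases lt_or_ge (p : ℕ) l with hp | hp
      · obtain ⟨q, rfl⟩ : ∃ q : Fin l, Fin.castLE l.le_succ q = p := ⟨⟨p, hp⟩, rfl⟩
        rw [headPerm_apply_lt _ l.le_succ]
        rfl
      · rw [headPerm_apply_ge _ p hp]
        obtain rfl : p = Fin.last l := Fin.ext (by have := p.2; simp; omega)
        exact hlast.symm
    change stepGen χ ψ l M _ _ = stepGen χ ψ l M _ _
    rw [map_mul, map_mul, map_mul M.ρ, ← hσ, headPerm_headPerm (Nat.le_succ l) hn,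
      headPerm_headPerm (Nat.le_succ l) hm, mul_assoc, Module.End.mul_apply, stepGen_rel]
  have e3 := average_cosets (k := k) (G := Equiv.Perm (Fin (l + 1))) (α := Fin (l + 1))
    Finset.univ (Fin.last l) (fun w => Equiv.swap w (Fin.last l))
    (fun w _ => Equiv.swap_apply_left _ _) (fun _ => Finset.mem_univ _) F hF
  have h0 : ((l + 1 : ℕ) : k) ≠ 0 := Nat.cast_ne_zero.2 (Nat.succ_ne_zero l)
  rw [e1, e2]
  -- The cup divides by $|S_l|$ and the average by $|S_{l+1}|$; the index $l+1$ turns the average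
  -- over the cosets into their plain sum.
  have e4 : (Fintype.card (Equiv.Perm (Fin l)) : k)⁻¹ =
      ((l + 1 : ℕ) : k) * (Fintype.card (Equiv.Perm (Fin (l + 1))) : k)⁻¹ := by
    rw [Fintype.card_perm, Fintype.card_perm, Fintype.card_fin, Fintype.card_fin,
      Nat.factorial_succ, Nat.cast_mul, mul_inv, ← mul_assoc, mul_inv_cancel₀ h0, one_mul]
  rw [e4, mul_smul, e3, Finset.card_univ, Fintype.card_fin, smul_smul, mul_inv_cancel₀ h0, one_smul]
  refine Finset.sum_congr rfl fun i _ => ?_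
  change stepGen χ ψ l M _ _ = _
  rw [hsw hn, hsw hm]

end Laplacian

/-! ### The Laplacian of cap and cup in terms of transpositions. -/

section Laplacian

variable {k : Type u} [Field k] {m n : ℕ}

lemma sum_castLE_add_geFin {A : Type*} [AddCommMonoid A] {l n : ℕ} (h : l ≤ n) (f : Fin n → A) :
    ∑ p, f p = ∑ i : Fin l, f (Fin.castLE h i) + ∑ w ∈ geFin n l, f w := by
  rw [← Finset.sum_filter_add_sum_filter_not Finset.univ (fun p : Fin n => (p : ℕ) < l)]
  congr 1
  · symm
    refine Finset.sum_bij (fun i _ => Fin.castLE h i) ?_ ?_ ?_ ?_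
    · simp
    · intro a _ b _ e
      exact Fin.castLE_injective h e
    · intro b hb
      exact ⟨⟨b, by simpa using hb⟩, Finset.mem_univ _, rfl⟩
    · simp
  · simp only [not_lt]
    rfl

lemma headPerm_swap_castLE {l n : ℕ} (h : l ≤ n) (i j : Fin l) :
    headPerm l n (Equiv.swap i j) = Equiv.swap (Fin.castLE h i) (Fin.castLE h j) := by
  ext p : 1
  rcases lt_or_ge (p : ℕ) l with hp | hp
  · obtain ⟨q, rfl⟩ : ∃ q : Fin l, Fin.castLE h q = p := ⟨⟨p, hp⟩, rfl⟩
    rw [headPerm_apply_lt _ h]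
    exact ((Fin.castLE_injective h).swap_apply i j q).symm
  · rw [headPerm_apply_ge _ p hp, Equiv.swap_apply_of_ne_of_ne]
    · rintro rfl
      simp at hp
      omega
    · rintro rfl
      simp at hp
      omega

lemma geFin_eq_insert {l n : ℕ} (h : l + 1 ≤ n) :
    geFin n l = insert ⟨l, h⟩ (geFin n (l + 1)) := by
  ext p
  simp [mem_geFin, Fin.ext_iff]
  omega

lemma notMem_geFin_succ {l n : ℕ} (h : l + 1 ≤ n) : (⟨l, h⟩ : Fin n) ∉ geFin n (l + 1) := by
  simp [mem_geFin]

local notation "E" => stepGen (1 : Equiv.Perm (Fin n) →* ℤˣ) (Equiv.Perm.sign (α := Fin m))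

lemma stepGen_head {l : ℕ} (hm : l ≤ m) (hn : l ≤ n) (M : SymRep k m) (i j : Fin l)
    (g : Equiv.Perm (Fin n)) (v : M.V) :
    E l M (Equiv.swap (Fin.castLE hn i) (Fin.castLE hn j) * g)
      (M.ρ (Equiv.swap (Fin.castLE hm i) (Fin.castLE hm j)) v) = E l M g v := by
  rw [← headPerm_swap_castLE, ← headPerm_swap_castLE, stepGen_rel]

lemma stepGen_strand_left {l : ℕ} (M : SymRep k m) {w w' : Fin n} (hw : l ≤ (w : ℕ))
    (hw' : l ≤ (w' : ℕ)) (g : Equiv.Perm (Fin n)) (v : M.V) :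
    E l M (Equiv.swap w w' * g) v = E l M g v := by
  have := stepGen_strand (k := k) 1 Equiv.Perm.sign M (swap_mem_strandPerm hw hw')
    (one_mem (strandPerm m l)) g v
  rw [map_one, Module.End.one_apply] at this
  simpa using this

lemma stepGen_strand_right {l : ℕ} (M : SymRep k m) {q q' : Fin m} (hq : l ≤ (q : ℕ))
    (hq' : l ≤ (q' : ℕ)) (g : Equiv.Perm (Fin n)) (v : M.V) :
    E l M g (M.ρ (Equiv.swap q q') v) =
      (((Equiv.Perm.sign (Equiv.swap q q') : ℤˣ) : ℤ) : k) • E l M g v := by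
  have := stepGen_strand (k := k) 1 Equiv.Perm.sign M (one_mem (strandPerm n l))
    (swap_mem_strandPerm hq hq') g v
  rw [one_mul] at this
  simpa using this

lemma sign_mul_self_cast {α : Type*} [DecidableEq α] [Fintype α] (s : Equiv.Perm α) :
    (((Equiv.Perm.sign s : ℤˣ) : ℤ) : k) * (((Equiv.Perm.sign s : ℤˣ) : ℤ) : k) = 1 := by
  rw [← Int.cast_mul, ← Units.val_mul, Int.units_mul_self]
  simp

lemma swap_mul_swap_conj {α : Type*} [DecidableEq α] {i w o : α} (hio : i ≠ o) (hiw : i ≠ w) :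
    Equiv.swap i o * Equiv.swap w o = Equiv.swap w o * Equiv.swap i w := by
  rw [Equiv.mul_swap_eq_swap_mul (Equiv.swap w o), Equiv.swap_apply_of_ne_of_ne hiw hio,
    Equiv.swap_apply_left]

/-- The value on generators of the Laplacian of the cap differential and the cup. -/
noncomputable def laplaceGen {l : ℕ} (hm : l ≤ m) (hn : l ≤ n) (M : SymRep k m)
    (g : Equiv.Perm (Fin n)) (v : M.V) : ((indRes (k := k) m n l).obj M).V :=
  ((l : k) + ((n - l : ℕ) : k) * ((m - l : ℕ) : k)) • E l M g v +
    ∑ i : Fin l, (∑ w ∈ geFin n l, E l M (Equiv.swap (Fin.castLE hn i) w * g) v -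
      ∑ q ∈ geFin m l, E l M g (M.ρ (Equiv.swap (Fin.castLE hm i) q) v))

lemma sum_geFin_left {l : ℕ} (M : SymRep k m) (g : Equiv.Perm (Fin n)) (v : M.V) :
    ∑ w ∈ geFin n l, ∑ w' ∈ geFin n l, E l M (Equiv.swap w w' * g) v =
      (((n - l : ℕ) : k) ^ 2) • E l M g v := by
  rw [Finset.sum_congr rfl fun w hw => Finset.sum_congr rfl fun w' hw' =>
    stepGen_strand_left M (mem_geFin.1 hw) (mem_geFin.1 hw') g v]
  simp only [Finset.sum_const, card_geFin, pow_two, mul_smul, Nat.cast_smul_eq_nsmul]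

/-- With $y=m-l$, the $y$ diagonal pairs contribute $+1$ and the $y^2-y$ others $-1$, because the
strands of $Q$ are antisymmetrized. -/
lemma sum_geFin_right {l : ℕ} (M : SymRep k m) (g : Equiv.Perm (Fin n)) (v : M.V) :
    ∑ q ∈ geFin m l, ∑ q' ∈ geFin m l, E l M g (M.ρ (Equiv.swap q q') v) =
      (2 * ((m - l : ℕ) : k) - ((m - l : ℕ) : k) ^ 2) • E l M g v := by
  rw [Finset.sum_congr rfl fun q hq => Finset.sum_congr rfl fun q' hq' =>
    stepGen_strand_right M (mem_geFin.1 hq) (mem_geFin.1 hq') g v]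
  simp only [← Finset.sum_smul]
  congr 1
  have : ∀ q q' : Fin m, (((Equiv.Perm.sign (Equiv.swap q q') : ℤˣ) : ℤ) : k) =
      (if q = q' then 2 else 0) - 1 := fun q q' => by
    rw [Equiv.Perm.sign_swap']
    split_ifs <;> norm_num
  simp only [this, Finset.sum_sub_distrib, Finset.sum_ite_eq, Finset.sum_const, card_geFin]
  rw [Finset.sum_congr rfl fun q hq => if_pos hq]
  simp only [Finset.sum_const, card_geFin, nsmul_eq_mul]
  ring

lemma sum_sum_swap {N l : ℕ} (h : l ≤ N) {A : Type*} [AddCommMonoid A]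
    (f : Equiv.Perm (Fin N) → A) :
    ∑ p, ∑ q, f (Equiv.swap p q) =
      ∑ i : Fin l, ∑ j : Fin l, f (Equiv.swap (Fin.castLE h i) (Fin.castLE h j)) +
      2 • ∑ i : Fin l, ∑ w ∈ geFin N l, f (Equiv.swap (Fin.castLE h i) w) +
      ∑ w ∈ geFin N l, ∑ w' ∈ geFin N l, f (Equiv.swap w w') := by
  simp only [sum_castLE_add_geFin h, Finset.sum_add_distrib]
  rw [Finset.sum_comm (s := geFin N l) (t := (Finset.univ : Finset (Fin l))), two_smul]
  have : ∀ i : Fin l, ∑ w ∈ geFin N l, f (Equiv.swap w (Fin.castLE h i)) =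
      ∑ w ∈ geFin N l, f (Equiv.swap (Fin.castLE h i) w) := fun i =>
    Finset.sum_congr rfl fun w _ => by rw [Equiv.swap_comm]
  simp only [this, add_assoc]

/-- The value on generators of the part of the Laplacian which caps first. -/
noncomputable def crossGen {l : ℕ} (hm : l ≤ m) (hn : l ≤ n) (M : SymRep k m)
    (g : Equiv.Perm (Fin n)) (v : M.V) : ((indRes (k := k) m n l).obj M).V :=
  (((n - l : ℕ) : k) * ((m - l : ℕ) : k)) • E l M g v +
    ∑ i : Fin l, ∑ w ∈ geFin n l, ∑ q ∈ geFin m l,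
      E l M (Equiv.swap (Fin.castLE hn i) w * g) (M.ρ (Equiv.swap (Fin.castLE hm i) q) v)

lemma crossGen_eq_zero {l : ℕ} (hm : l ≤ m) (hn : l ≤ n) (h : ¬ (l + 1 ≤ m ∧ l + 1 ≤ n))
    (M : SymRep k m) (g : Equiv.Perm (Fin n)) (v : M.V) : crossGen hm hn M g v = 0 := by
  have h' : l = m ∨ l = n := by omega
  rcases h' with rfl | rfl
  · have : geFin l l = ∅ := Finset.card_eq_zero.1 (by rw [card_geFin, Nat.sub_self])
    simp [crossGen, this]
  · have : geFin l l = ∅ := Finset.card_eq_zero.1 (by rw [card_geFin, Nat.sub_self])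
    simp [crossGen, this]

lemma laplaceGen_zero (M : SymRep k m) (g : Equiv.Perm (Fin n)) (v : M.V) :
    laplaceGen m.zero_le n.zero_le M g v = crossGen m.zero_le n.zero_le M g v := by
  simp [crossGen, laplaceGen]

/-- Split the pairs of letters at `l` on both sides. Pairs below `l` agree by the relations and
cancel; each mixed pair occurs twice and yields the sums of `laplaceGen`. With $x=n-l$ and $y=m-l$,
pairs of strands give $x^2$ and $2y-y^2$, and $x^2-(2y-y^2)+2m-(x-y)^2=2(l+xy)$. -/
lemma two_smul_laplaceGen {l : ℕ} (hm : l ≤ m) (hn : l ≤ n) (M : SymRep k m)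
    (g : Equiv.Perm (Fin n)) (v : M.V) :
    (2 : k) • laplaceGen hm hn M g v =
      swapSum ((indRes (k := k) m n l).obj M).ρ (E l M g v) - E l M g (swapSum M.ρ v) +
        (2 * (m : k) - ((n : k) - (m : k)) ^ 2) • E l M g v := by
  have h1 : swapSum ((indRes (k := k) m n l).obj M).ρ (E l M g v) = _ :=
    (swapSum_stepGen (k := k) 1 Equiv.Perm.sign M g v).trans
      (sum_sum_swap hn fun s => E l M (s * g) v)
  have h2 : E l M g (swapSum M.ρ v) = ∑ p, ∑ q, E l M g (M.ρ (Equiv.swap p q) v) := by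
    rw [swapSum_apply]
    simp only [map_sum]
  rw [sum_geFin_left] at h1
  rw [sum_sum_swap hm fun s => E l M g (M.ρ s v), sum_geFin_right] at h2
  have h3 : ∀ i j : Fin l, E l M (Equiv.swap (Fin.castLE hn i) (Fin.castLE hn j) * g) v =
      E l M g (M.ρ (Equiv.swap (Fin.castLE hm i) (Fin.castLE hm j)) v) := fun i j => by
    rw [← stepGen_head hm hn M i j g, ← Module.End.mul_apply, ← map_mul, Equiv.swap_mul_self,
      map_one, Module.End.one_apply]
  simp only [h3] at h1
  rw [h1, h2, laplaceGen, Finset.sum_sub_distrib]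
  have hx : ((n - l : ℕ) : k) = n - l := Nat.cast_sub hn
  have hy : ((m - l : ℕ) : k) = m - l := Nat.cast_sub hm
  rw [hx, hy, ← Nat.cast_smul_eq_nsmul k]
  push_cast
  module

variable [CharZero k]

/-- The cap chooses strands `w` and `q`, the cup a letter `i ≤ l`. For `i = l` only strand
permutations occur; they act by signs that cancel, giving $xy$ copies of the generator. For `i < l`,
conjugation moves a strand permutation to the outside, where it is absorbed, and leaves the
exchanges of `i` with `w` and with `q`. -/
lemma cup_cap_stepGen {l : ℕ} (hm : l + 1 ≤ m) (hn : l + 1 ≤ n) (M : SymRep k m)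
    (g : Equiv.Perm (Fin n)) (v : M.V) :
    (((n - l : ℕ) : k) * ((m - l : ℕ) : k)) •
      ((cupMap m n (l + 1) l ≫ charIdem 1 Equiv.Perm.sign l).app M).hom
        (((capMap m n l (l + 1) ≫ charIdem 1 Equiv.Perm.sign (l + 1)).app M).hom (E l M g v)) =
      crossGen (Nat.le_of_succ_le hm) (Nat.le_of_succ_le hn) M g v := by
  have hx : ((n - l : ℕ) : k) ≠ 0 := Nat.cast_ne_zero.2 (by omega)
  have hy : ((m - l : ℕ) : k) ≠ 0 := Nat.cast_ne_zero.2 (by omega)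
  obtain ⟨Φ, hΦ⟩ : ∃ Φ : ((indRes (k := k) m n (l + 1)).obj M).V →ₗ[k] ((indRes m n l).obj M).V,
      ∀ x, Φ x = ((cupMap m n (l + 1) l ≫ charIdem 1 Equiv.Perm.sign l).app M).hom x :=
    ⟨((cupMap (k := k) m n (l + 1) l ≫ charIdem 1 Equiv.Perm.sign l).app M).hom.toLinearMap,
      fun _ => rfl⟩
  have hΦ' := fun g v => (hΦ _).trans (cup_stepGen (k := k) 1 Equiv.Perm.sign hm hn M g v)
  rw [cap_stepGen (k := k) 1 Equiv.Perm.sign hm hn M g v, ← hΦ, map_smul, smul_smul,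
    show ((n - l : ℕ) : k) * ((m - l : ℕ) : k) * (((n - l : ℕ) : k)⁻¹ * ((m - l : ℕ) : k)⁻¹) = 1 by
      field_simp, one_smul]
  simp only [map_sum, map_smul, hΦ', MonoidHom.one_apply, one_mul]
  simp only [Fin.sum_univ_castSucc, smul_add, Finset.sum_add_distrib, Finset.smul_sum]
  rw [crossGen, add_comm]
  congr 1
  · have : ∀ w ∈ geFin n l, ∀ q ∈ geFin m l,
        (((Equiv.Perm.sign (Equiv.swap q ⟨l, hm⟩) : ℤˣ) : ℤ) : k) •
          E l M (Equiv.swap (Fin.castLE hn (Fin.last l)) ⟨l, hn⟩ * (Equiv.swap w ⟨l, hn⟩ * g))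
            (M.ρ (Equiv.swap (Fin.castLE hm (Fin.last l)) ⟨l, hm⟩)
              (M.ρ (Equiv.swap q ⟨l, hm⟩) v)) = E l M g v := fun w hw q hq => by
      have e : ∀ {N : ℕ} (h : l + 1 ≤ N), Equiv.swap (Fin.castLE h (Fin.last l)) ⟨l, h⟩ = 1 :=
        fun h => Equiv.swap_self _
      rw [e, e, one_mul, map_one, Module.End.one_apply,
        stepGen_strand_left M (mem_geFin.1 hw) le_rfl,
        stepGen_strand_right M (mem_geFin.1 hq) le_rfl, smul_smul, sign_mul_self_cast, one_smul]
    rw [Finset.sum_congr rfl fun w hw => Finset.sum_congr rfl (this w hw)]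
    simp only [Finset.sum_const, card_geFin, mul_smul, Nat.cast_smul_eq_nsmul]
  · have : ∀ w ∈ geFin n l, ∀ q ∈ geFin m l, ∀ i : Fin l,
        (((Equiv.Perm.sign (Equiv.swap q ⟨l, hm⟩) : ℤˣ) : ℤ) : k) •
          E l M (Equiv.swap (Fin.castLE hn i.castSucc) ⟨l, hn⟩ * (Equiv.swap w ⟨l, hn⟩ * g))
            (M.ρ (Equiv.swap (Fin.castLE hm i.castSucc) ⟨l, hm⟩)
              (M.ρ (Equiv.swap q ⟨l, hm⟩) v)) =
          E l M (Equiv.swap (Fin.castLE (Nat.le_of_succ_le hn) i) w * g)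
            (M.ρ (Equiv.swap (Fin.castLE (Nat.le_of_succ_le hm) i) q) v) := fun w hw q hq i => by
      have e : ∀ {N : ℕ} (h : l + 1 ≤ N) (w : Fin N), w ∈ geFin N l →
          Equiv.swap (Fin.castLE h i.castSucc) ⟨l, h⟩ * Equiv.swap w ⟨l, h⟩ =
          Equiv.swap w ⟨l, h⟩ * Equiv.swap (Fin.castLE (Nat.le_of_succ_le h) i) w :=
        fun h w hw => swap_mul_swap_conj (by simp [Fin.ext_iff]; omega) (by
          have := mem_geFin.1 hw
          simp [Fin.ext_iff]; omega)
      rw [← mul_assoc, e hn w hw, ← Module.End.mul_apply, ← map_mul, e hm q hq, map_mul,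
        Module.End.mul_apply, mul_assoc, stepGen_strand_left M (mem_geFin.1 hw) le_rfl,
        stepGen_strand_right M (mem_geFin.1 hq) le_rfl, smul_smul, sign_mul_self_cast, one_smul]
    rw [Finset.sum_congr rfl fun w hw => Finset.sum_congr rfl fun q hq =>
      Finset.sum_congr rfl fun i _ => this w hw q hq i]
    rw [Finset.sum_congr rfl fun w _ => Finset.sum_comm, Finset.sum_comm]

/-- In this order the sign of `swap q l` survives: it is $+1$ for `q = l` and $-1$ otherwise. So the
terms with exchanges on both sides come with the sign opposite to the one in `cup_cap_stepGen`, and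
the sum of the two orders involves only single transpositions. -/
lemma cap_cup_stepGen {l : ℕ} (hm : l + 1 ≤ m) (hn : l + 1 ≤ n) (M : SymRep k m)
    (g : Equiv.Perm (Fin n)) (v : M.V) :
    (((n - l : ℕ) : k) * ((m - l : ℕ) : k)) •
      ((capMap m n l (l + 1) ≫ charIdem 1 Equiv.Perm.sign (l + 1)).app M).hom
        (((cupMap m n (l + 1) l ≫ charIdem 1 Equiv.Perm.sign l).app M).hom (E (l + 1) M g v)) =
      laplaceGen hm hn M g v - crossGen hm hn M g v := by
  have hx : ((n - l : ℕ) : k) ≠ 0 := Nat.cast_ne_zero.2 (by omega)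
  have hy : ((m - l : ℕ) : k) ≠ 0 := Nat.cast_ne_zero.2 (by omega)
  obtain ⟨Φ, hΦ⟩ : ∃ Φ : ((indRes (k := k) m n l).obj M).V →ₗ[k] ((indRes m n (l + 1)).obj M).V,
      ∀ x, Φ x = ((capMap m n l (l + 1) ≫ charIdem 1 Equiv.Perm.sign (l + 1)).app M).hom x :=
    ⟨((capMap (k := k) m n l (l + 1) ≫ charIdem 1 Equiv.Perm.sign (l + 1)).app M).hom.toLinearMap,
      fun _ => rfl⟩
  have hΦ' := fun g v => (hΦ _).trans (cap_stepGen (k := k) 1 Equiv.Perm.sign hm hn M g v)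
  have hL : laplaceGen hm hn M g v - crossGen hm hn M g v =
      ∑ i : Fin (l + 1), ((E (l + 1) M g v +
          ∑ w ∈ geFin n (l + 1), E (l + 1) M (Equiv.swap (Fin.castLE hn i) w * g) v) -
        ∑ q ∈ geFin m (l + 1), (E (l + 1) M g (M.ρ (Equiv.swap (Fin.castLE hm i) q) v) +
          ∑ w ∈ geFin n (l + 1), E (l + 1) M (Equiv.swap (Fin.castLE hn i) w * g)
            (M.ρ (Equiv.swap (Fin.castLE hm i) q) v))) := by
    have h1 : ((n - (l + 1) : ℕ) : k) = n - (l + 1) := by rw [Nat.cast_sub hn]; push_cast; rfl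
    simp only [laplaceGen, crossGen, Finset.sum_sub_distrib, Finset.sum_add_distrib,
      Finset.sum_const, Finset.card_univ, Fintype.card_fin]
    rw [Finset.sum_congr rfl fun i _ => Finset.sum_comm (s := geFin n (l + 1)),
      ← Nat.cast_smul_eq_nsmul k]
    module
  rw [hL, cup_stepGen (k := k) 1 Equiv.Perm.sign hm hn M g v, ← hΦ, map_sum, Finset.smul_sum]
  refine Finset.sum_congr rfl fun i _ => ?_
  rw [hΦ', smul_smul,
    show ((n - l : ℕ) : k) * ((m - l : ℕ) : k) * (((n - l : ℕ) : k)⁻¹ * ((m - l : ℕ) : k)⁻¹) = 1 by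
      field_simp, one_smul]
  have e : ∀ {N : ℕ} (h : l + 1 ≤ N) (w : Fin N), w ∈ geFin N (l + 1) →
      Equiv.swap w ⟨l, h⟩ * Equiv.swap (Fin.castLE h i) ⟨l, h⟩ =
        Equiv.swap (Fin.castLE h i) ⟨l, h⟩ * Equiv.swap (Fin.castLE h i) w := fun h w hw => by
    have := mem_geFin.1 hw
    rw [Equiv.mul_swap_eq_swap_mul (Equiv.swap (Fin.castLE h i) ⟨l, h⟩), Equiv.swap_apply_left,
      Equiv.swap_apply_of_ne_of_ne, Equiv.swap_comm w]
    · intro h'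
      rw [h'] at this
      have := i.2
      simp at *
      omega
    · rintro rfl
      simp at this
  have e0 : ∀ g v, E (l + 1) M (Equiv.swap (Fin.castLE hn i) ⟨l, hn⟩ * g)
      (M.ρ (Equiv.swap (Fin.castLE hm i) ⟨l, hm⟩) v) = E (l + 1) M g v := fun g v =>
    stepGen_head hm hn M i (Fin.last l) g v
  have e1 : ∀ w ∈ geFin n (l + 1), ∀ g v,
      E (l + 1) M (Equiv.swap w ⟨l, hn⟩ * (Equiv.swap (Fin.castLE hn i) ⟨l, hn⟩ * g))
        (M.ρ (Equiv.swap (Fin.castLE hm i) ⟨l, hm⟩) v) =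
      E (l + 1) M (Equiv.swap (Fin.castLE hn i) w * g) v := fun w hw g v => by
    rw [← mul_assoc, e hn w hw, mul_assoc, e0]
  have e2 : ∀ q ∈ geFin m (l + 1), ∀ v, (M.ρ (Equiv.swap q ⟨l, hm⟩)
        (M.ρ (Equiv.swap (Fin.castLE hm i) ⟨l, hm⟩) v)) =
      M.ρ (Equiv.swap (Fin.castLE hm i) ⟨l, hm⟩) (M.ρ (Equiv.swap (Fin.castLE hm i) q) v) :=
    fun q hq v => by
      rw [← Module.End.mul_apply, ← map_mul, e hm q hq, map_mul, Module.End.mul_apply]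
  have hsgn : ∀ q ∈ geFin m (l + 1), Equiv.Perm.sign (Equiv.swap q (⟨l, hm⟩ : Fin m)) = -1 :=
    fun q hq => Equiv.Perm.sign_swap fun h => notMem_geFin_succ hm (h ▸ hq)
  simp only [MonoidHom.one_apply, one_mul]
  -- Separate `q = l`, which gives the terms with at most an exchange on the left, from `q > l`,
  -- which gives the negative terms.
  rw [Finset.sum_comm, geFin_eq_insert hm, Finset.sum_insert (notMem_geFin_succ hm), sub_eq_add_neg,
    ← Finset.sum_neg_distrib]
  congr 1
  · rw [geFin_eq_insert hn, Finset.sum_insert (notMem_geFin_succ hn)]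
    simp only [Equiv.swap_self, ← Equiv.Perm.one_def, one_mul, map_one, Module.End.one_apply,
      Units.val_one, Int.cast_one, one_smul]
    rw [e0, Finset.sum_congr rfl fun w hw => e1 w hw g v]
  · refine Finset.sum_congr rfl fun q hq => ?_
    simp only [hsgn q hq, e2 q hq]
    rw [geFin_eq_insert hn, Finset.sum_insert (notMem_geFin_succ hn)]
    simp only [Equiv.swap_self, ← Equiv.Perm.one_def, one_mul, Units.val_neg, Units.val_one,
      Int.cast_neg, Int.cast_one, neg_smul, one_smul, Finset.sum_neg_distrib]
    rw [e0, Finset.sum_congr rfl fun w hw => e1 w hw g _, neg_add]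

end Laplacian

/-! ### Coefficients in the induced module, and its eigenvectors for the sum of all transpositions.
-/

section Coefficients

variable {k : Type u} [Field k] {m n : ℕ}

/-- The coefficient of `g` in an element of the induced module, summed over the relations, so that
the class of `g ⊗ v` has the coefficient `σ v` at `σ g` for every `σ` in `S_l`. -/
noncomputable def indCoef (l : ℕ) (M : SymRep k m) (g₀ : Equiv.Perm (Fin n)) :
    ((indRes m n l).obj M).V →ₗ[k] M.V :=
  Representation.Coinvariants.lift _
    (∑ σ : Equiv.Perm (Fin l), (TensorProduct.lid k M.V).toLinearMap ∘ₗ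
      TensorProduct.map (Finsupp.lapply ((headPerm l n σ)⁻¹ * g₀) ∘ₗ
        (MonoidAlgebra.coeffLinearEquiv k).toLinearMap) (M.ρ (headPerm l m σ)))
    (fun τ => by
      classical
      ext g v
      simp only [LinearMap.coe_comp, Function.comp_apply, MonoidAlgebra.lsingle_apply,
        TensorProduct.AlgebraTensorModule.curry_apply, LinearMap.restrictScalars_self,
        TensorProduct.curry_apply, Representation.tprod_apply, TensorProduct.map_tmul,
        LinearMap.sum_apply, Representation.ofMulAction_single, smul_eq_mul,
        MonoidHom.comp_apply]
      refine Fintype.sum_equiv (Equiv.mulRight τ) _ _ fun σ => ?_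
      simp [MonoidAlgebra.coeff_single, Finsupp.single_apply, eq_inv_mul_iff_mul_eq, mul_assoc])

lemma indCoef_mk [DecidableEq (Equiv.Perm (Fin n))] (l : ℕ) (M : SymRep k m) (g₀ g : Equiv.Perm (Fin n)) (v : M.V) :
    indCoef l M g₀ (indResMk n l M g v) =
      ∑ σ : Equiv.Perm (Fin l), if headPerm l n σ * g = g₀ then M.ρ (headPerm l m σ) v else 0 := by
  have : indCoef l M g₀ (indResMk n l M g v) = ∑ σ : Equiv.Perm (Fin l),
      (MonoidAlgebra.coeff (MonoidAlgebra.single g (1 : k)) ((headPerm l n σ)⁻¹ * g₀)) •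
        M.ρ (headPerm l m σ) v := by
    simp [indCoef, LinearMap.sum_apply]
  rw [this]
  refine Finset.sum_congr rfl fun σ _ => ?_
  rw [MonoidAlgebra.coeff_single, Finsupp.single_apply]
  simp only [eq_inv_mul_iff_mul_eq]
  split_ifs <;> simp

lemma indRes_linear_ext {l : ℕ} {M : SymRep k m} {W : Type*} [AddCommGroup W] [Module k W]
    {f f' : ((indRes m n l).obj M).V →ₗ[k] W}
    (h : ∀ g v, f (indResMk n l M g v) = f' (indResMk n l M g v)) : f = f' := by
  apply Representation.IndV.hom_ext
  intro g
  ext v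
  exact h g v

lemma indCoef_head {l : ℕ} (M : SymRep k m) (σ : Equiv.Perm (Fin l)) (g₀ : Equiv.Perm (Fin n))
    (x : ((indRes m n l).obj M).V) :
    indCoef l M (headPerm l n σ * g₀) x = M.ρ (headPerm l m σ) (indCoef l M g₀ x) := by
  classical
  refine LinearMap.congr_fun (f := indCoef l M (headPerm l n σ * g₀))
    (g := M.ρ (headPerm l m σ) ∘ₗ indCoef l M g₀) (indRes_linear_ext fun g v => ?_) x
  change indCoef l M _ (indResMk n l M g v) = M.ρ _ (indCoef l M g₀ (indResMk n l M g v))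
  rw [indCoef_mk, indCoef_mk, map_sum]
  refine Fintype.sum_equiv (Equiv.mulLeft σ⁻¹) _ _ fun τ => ?_
  simp only [Equiv.coe_mulLeft, map_mul, map_inv, mul_assoc, inv_mul_eq_iff_eq_mul]
  split_ifs
  · rw [← Module.End.mul_apply, ← map_mul M.ρ, ← map_mul M.ρ, mul_inv_cancel_left]
  · simp

lemma indCoef_ρ {l : ℕ} (M : SymRep k m) (h g₀ : Equiv.Perm (Fin n))
    (x : ((indRes m n l).obj M).V) :
    indCoef l M g₀ (((indRes m n l).obj M).ρ h x) = indCoef l M (g₀ * h) x := by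
  classical
  refine LinearMap.congr_fun (f := indCoef l M g₀ ∘ₗ ((indRes m n l).obj M).ρ h)
    (g := indCoef l M (g₀ * h)) (indRes_linear_ext fun g v => ?_) x
  rw [LinearMap.comp_apply]
  refine (congrArg (indCoef l M g₀) (indRes_ρ_mk h g v)).trans ?_
  rw [indCoef_mk, indCoef_mk]
  simp only [← mul_assoc, mul_inv_eq_iff_eq_mul]

/-- Each class is counted once for every element of $S_l$. In characteristic zero the coefficients
therefore determine the element. -/
lemma sum_indResMk_indCoef {l : ℕ} (M : SymRep k m) (x : ((indRes m n l).obj M).V) :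
    ∑ g, indResMk n l M g (indCoef l M g x) = (Fintype.card (Equiv.Perm (Fin l)) : k) • x := by
  classical
  have := LinearMap.congr_fun (f := ∑ g, indResMk n l M g ∘ₗ indCoef l M g)
    (g := (Fintype.card (Equiv.Perm (Fin l)) : k) • LinearMap.id) (indRes_linear_ext fun g v => ?_) x
  · simpa [LinearMap.sum_apply] using this
  · rw [LinearMap.sum_apply]
    change ∑ g₀, indResMk n l M g₀ (indCoef l M g₀ (indResMk n l M g v)) =
      (Fintype.card (Equiv.Perm (Fin l)) : k) • indResMk n l M g v
    rw [Finset.sum_congr rfl fun g₀ _ => (congrArg (indResMk n l M g₀)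
      (indCoef_mk l M g₀ g v)).trans (map_sum _ _ _), Finset.sum_comm]
    have : ∀ σ : Equiv.Perm (Fin l), ∑ g₀ : Equiv.Perm (Fin n), indResMk n l M g₀
        (if headPerm l n σ * g = g₀ then M.ρ (headPerm l m σ) v else 0) = indResMk n l M g v :=
      fun σ => by
        rw [Finset.sum_eq_single (headPerm l n σ * g) (fun b _ hb => by rw [if_neg hb.symm, map_zero])
          (fun h => (h (Finset.mem_univ _)).elim), if_pos rfl, indResMk_rel]
    simp only [this, Finset.sum_const, Finset.card_univ, Nat.cast_smul_eq_nsmul]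

lemma eq_zero_of_indCoef [CharZero k] {l : ℕ} (M : SymRep k m) (x : ((indRes m n l).obj M).V)
    (h : ∀ g, indCoef l M g x = 0) : x = 0 := by
  have := sum_indResMk_indCoef M x
  simp only [h, map_zero, Finset.sum_const_zero] at this
  exact (smul_eq_zero.1 this.symm).resolve_left (Nat.cast_ne_zero.2 Fintype.card_ne_zero)

lemma indCoef_strand {l : ℕ} (M : SymRep k m) {s : Equiv.Perm (Fin n)} (hs : s ∈ strandPerm n l)
    (g g₀ : Equiv.Perm (Fin n)) (v : M.V) :
    indCoef l M (s * g₀) (indResMk n l M (s * g) v) = indCoef l M g₀ (indResMk n l M g v) := by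
  classical
  rw [indCoef_mk, indCoef_mk]
  refine Finset.sum_congr rfl fun σ _ => ?_
  rw [← mul_assoc, ← strandPerm_mul_headPerm le_rfl hs, mul_assoc]
  simp only [mul_right_inj]

lemma indCoef_of_mem_range {l : ℕ} (M : SymRep k m) (ψ : Equiv.Perm (Fin m) →* ℤˣ)
    {x : ((indRes m n l).obj M).V}
    (hx : x ∈ LinearMap.range ((charIdem 1 ψ l).app M).hom.toLinearMap)
    {s : Equiv.Perm (Fin n)} (hs : s ∈ strandPerm n l) (g₀ : Equiv.Perm (Fin n)) :
    indCoef l M (s * g₀) x = indCoef l M g₀ x := by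
  obtain ⟨y, rfl⟩ := hx
  have e : ∀ z, indCoef l M (s * g₀)
      (((strandMap (⟨s, hs⟩ : strandPerm n l) (1 : strandPerm m l)).app M).hom z) =
      indCoef l M g₀ z := fun z =>
    LinearMap.congr_fun (f := indCoef l M (s * g₀) ∘ₗ
      ((strandMap (⟨s, hs⟩ : strandPerm n l) (1 : strandPerm m l)).app M).hom.toLinearMap)
      (g := indCoef l M g₀) (indRes_linear_ext fun g v => by
        refine (congrArg (indCoef l M (s * g₀)) (strandMap_mk (⟨s, hs⟩ : strandPerm n l)
          (1 : strandPerm m l) M g v)).trans ?_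
        rw [indCoef_strand M hs]
        simp) z
  rw [← e]
  have h := congrArg (fun f : indRes (k := k) m n l ⟶ indRes m n l => (f.app M).hom y)
    (charIdem_comp_strandMap (k := k) 1 ψ (⟨s, hs⟩ : strandPerm n l) (1 : strandPerm m l))
  refine congrArg (indCoef l M (s * g₀)) (Eq.trans ?_ h.symm)
  simp

/-- The stabilizer of the set of the first `l` letters is $S_l\times S_{n-l}$. -/
lemma exists_head_mul_strand {l n : ℕ} (hl : l ≤ n) (τ : Equiv.Perm (Fin n))
    (hτ : ∀ p : Fin n, (p : ℕ) < l → (τ p : ℕ) < l) :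
    ∃ σ : Equiv.Perm (Fin l), ∃ s ∈ strandPerm n l, τ = headPerm l n σ * s := by
  let σ : Equiv.Perm (Fin l) := Equiv.ofBijective
    (fun i => ⟨τ (Fin.castLE hl i), hτ _ i.2⟩)
    (Finite.injective_iff_bijective.1 fun a b h => by
      have : τ (Fin.castLE hl a) = τ (Fin.castLE hl b) := Fin.ext (by simpa using h)
      exact Fin.castLE_injective hl (τ.injective this))
  refine ⟨σ, (headPerm l n σ)⁻¹ * τ, fun p hp => ?_, by simp⟩
  rw [Equiv.Perm.mul_apply, Equiv.Perm.inv_eq_iff_eq]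
  exact (headPerm_apply_lt σ hl ⟨p, hp⟩).symm

section Words

variable {r : ℕ} (mu : Fin r → ℕ)

/-- The permutations of the positions which take one word to another. -/
def wordPerms (w w' : Fin n → Fin r) : Finset (Equiv.Perm (Fin n)) :=
  Finset.univ.filter fun g : Equiv.Perm (Fin n) => w ∘ g = w'

lemma mem_wordPerms {w w' : Fin n → Fin r} {g : Equiv.Perm (Fin n)} :
    g ∈ wordPerms w w' ↔ w ∘ g = w' := by simp [wordPerms]

/-- The function on words with the value `∑ v_g (u)` at `w`, where `g` runs over the permutations
with `û ∘ g = w` for the extension `û` of the word `u` and `v_g` is the coefficient of `g`. -/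
noncomputable def wordTransform (l : ℕ) (u : Fin m → Fin r) :
    ((indRes m n l).obj (hwRep k m mu)).V →ₗ[k] ((Fin n → Fin (r + 1)) → k) :=
  LinearMap.pi fun w => ∑ g ∈ wordPerms (extWord n l u) w,
    LinearMap.proj u ∘ₗ (highestWeight k m mu).subtype ∘ₗ indCoef l (hwRep k m mu) g

lemma wordTransform_apply (l : ℕ) (u : Fin m → Fin r)
    (x : ((indRes m n l).obj (hwRep k m mu)).V) (w : Fin n → Fin (r + 1)) :
    wordTransform mu l u x w = ∑ g ∈ wordPerms (extWord n l u) w,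
      (indCoef l (hwRep k m mu) g x).1 u := by
  simp [wordTransform, LinearMap.sum_apply]

lemma content_of_wordTransform_ne_zero {l : ℕ} {u : Fin m → Fin r}
    {x : ((indRes m n l).obj (hwRep k m mu)).V} {w : Fin n → Fin (r + 1)}
    (h : wordTransform mu l u x w ≠ 0) : content w = content (extWord n l u) := by
  rw [wordTransform_apply] at h
  obtain ⟨g, hg, -⟩ := Finset.exists_ne_zero_of_sum_ne_zero h
  rw [← (mem_wordPerms.1 hg), content_comp]

lemma wordTransform_ρ (l : ℕ) (u : Fin m → Fin r) (h : Equiv.Perm (Fin n))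
    (x : ((indRes m n l).obj (hwRep k m mu)).V) :
    wordTransform mu l u (((indRes m n l).obj (hwRep k m mu)).ρ h x) =
      wordRep k n (r + 1) h (wordTransform mu l u x) := by
  ext w
  rw [wordRep_apply, wordTransform_apply, wordTransform_apply]
  refine Finset.sum_bij (fun g _ => g * h) ?_ ?_ ?_ ?_
  · intro g hg
    have : extWord n l u ∘ g = w := mem_wordPerms.1 hg
    exact mem_wordPerms.2 (by rw [Equiv.Perm.coe_mul, ← Function.comp_assoc, this])
  · intro a _ b _ e
    exact mul_right_cancel e
  · intro g hg
    have : extWord n l u ∘ g = w ∘ h := mem_wordPerms.1 hg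
    refine ⟨g * h⁻¹, mem_wordPerms.2 ?_, by simp⟩
    rw [Equiv.Perm.coe_mul, ← Function.comp_assoc, this]
    ext p : 1
    simp
  · intro g _
    rw [indCoef_ρ]

/-- The number of permutations fixing a word. -/
def wordStab (w : Fin n → Fin r) : ℕ := (wordPerms w w).card

lemma wordStab_ne_zero (w : Fin n → Fin r) : wordStab w ≠ 0 :=
  Finset.card_ne_zero.2 ⟨1, mem_wordPerms.2 rfl⟩

/-- The permutations producing the same word are `τ * g` with `τ` in the stabilizer of the extended
word. Its letters $0$ are exactly at the positions from `l` on, so `τ` is a strand permutation,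
absorbed by the symmetrizer, times a permutation of the first `l` letters fixing `u`. Hence the
transforms determine all coefficients. -/
lemma wordTransform_comp {l : ℕ} (hln : l ≤ n) (hlm : l ≤ m) (ψ : Equiv.Perm (Fin m) →* ℤˣ)
    (u : Fin m → Fin r) {x : ((indRes m n l).obj (hwRep k m mu)).V}
    (hx : x ∈ LinearMap.range ((charIdem 1 ψ l).app (hwRep k m mu)).hom.toLinearMap)
    (g : Equiv.Perm (Fin n)) :
    wordTransform mu l u x (extWord n l u ∘ g) =
      (wordStab (extWord n l u) : k) * (indCoef l (hwRep k m mu) g x).1 u := by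
  rw [wordTransform_apply, wordStab, ← nsmul_eq_mul, ← Finset.sum_const]
  symm
  refine Finset.sum_bij (fun τ _ => τ * g) ?_ ?_ ?_ ?_
  · intro τ hτ
    have : extWord n l u ∘ τ = extWord n l u := mem_wordPerms.1 hτ
    exact mem_wordPerms.2 (by rw [Equiv.Perm.coe_mul, ← Function.comp_assoc, this])
  · intro a _ b _ e
    exact mul_right_cancel e
  · intro τ hτ
    have : extWord n l u ∘ τ = extWord n l u ∘ g := mem_wordPerms.1 hτ
    refine ⟨τ * g⁻¹, mem_wordPerms.2 ?_, by simp⟩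
    rw [Equiv.Perm.coe_mul, ← Function.comp_assoc, this]
    ext p : 1
    simp
  · intro τ hτ
    have hτ : extWord n l u ∘ τ = extWord n l u := mem_wordPerms.1 hτ
    obtain ⟨σ, s, hs, rfl⟩ := exists_head_mul_strand hln τ fun p hp => by
      by_contra h
      have h1 := congrFun hτ p
      rw [Function.comp_apply, extWord_of_le u (not_lt.1 h)] at h1
      have := (extWord_eq_zero_iff hlm u).1 h1.symm
      omega
    have hσ : u ∘ headPerm l m σ = u := by
      rw [Equiv.Perm.coe_mul, ← Function.comp_assoc, extWord_comp_headPerm hln hlm,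
        extWord_comp_strandPerm _ hs] at hτ
      ext q : 1
      rcases lt_or_ge (q : ℕ) l with hq | hq
      · have h1 := congrFun hτ ⟨q, by omega⟩
        rw [extWord_of_lt (n := n) _ q hq rfl, extWord_of_lt (n := n) _ q hq rfl] at h1
        exact Fin.succ_injective _ h1
      · rw [Function.comp_apply, headPerm_apply_ge _ _ hq]
    have e := indCoef_head (hwRep k m mu) σ (s * g) x
    rw [indCoef_of_mem_range _ ψ hx hs] at e
    rw [mul_assoc, e]
    change _ = (indCoef l (hwRep k m mu) g x).1 (u ∘ headPerm l m σ)
    rw [hσ]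

lemma swapSum_wordTransform (l : ℕ) (u : Fin m → Fin r)
    (x : ((indRes m n l).obj (hwRep k m mu)).V) :
    wordTransform mu l u (swapSum ((indRes m n l).obj (hwRep k m mu)).ρ x) =
      swapSum (wordRep k n (r + 1)) (wordTransform mu l u x) := by
  rw [swapSum_apply, swapSum_apply]
  refine (map_sum _ _ _).trans (Finset.sum_congr rfl fun p _ => (map_sum _ _ _).trans
    (Finset.sum_congr rfl fun q _ => wordTransform_ρ mu l u _ x))

/-- Extension turns the $m-l$ last letters of `u` into letters $0$. Every nonempty partial sum gains
$m-l$ at the letter $0$ and loses at most $m-l$ elsewhere. -/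
lemma partialSum_cons_le {l : ℕ} (hln : l ≤ n) (hlm : l ≤ m) (hmn : m ≤ n) {u : Fin m → Fin r}
    (t : ℕ) : partialSum (Fin.cons (n - m) (content u) : Fin (r + 1) → ℕ) t ≤
      partialSum (content (extWord n l u)) t := by
  rcases t with _ | t
  · simp [partialSum]
  have e : ∀ ν : Fin (r + 1) → ℕ, partialSum ν (t + 1) =
      ν 0 + ∑ i ∈ Finset.univ.filter (fun i : Fin r => (i : ℕ) < t), ν i.succ := fun ν => by
    rw [partialSum, Finset.sum_filter, Fin.sum_univ_succ, Finset.sum_filter]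
    simp
  rw [e, e, content_extWord_zero hlm]
  simp only [Fin.cons_zero, Fin.cons_succ, content_extWord_succ hln hlm]
  have h1 : ∀ i, content u i ≤ (Finset.univ.filter fun q : Fin m => u q = i ∧ (q : ℕ) < l).card +
      (Finset.univ.filter fun q : Fin m => u q = i ∧ l ≤ (q : ℕ)).card := fun i => by
    rw [content, ← Finset.card_union_of_disjoint]
    · refine Finset.card_le_card fun q hq => ?_
      have : u q = i := by simpa using hq
      simp [this, lt_or_ge]
    · rw [Finset.disjoint_left]
      intro q hq hq'
      simp at hq hq'
      omega
  have h2 : ∑ i ∈ Finset.univ.filter (fun i : Fin r => (i : ℕ) < t),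
      (Finset.univ.filter fun q : Fin m => u q = i ∧ l ≤ (q : ℕ)).card ≤ m - l := by
    rw [← card_filter_ge (n := m) l, Finset.card_eq_sum_card_fiberwise (f := u) (t := Finset.univ)
      fun _ _ => Finset.mem_coe.2 (Finset.mem_univ _)]
    refine (Finset.sum_le_sum_of_subset (Finset.filter_subset _ _)).trans
      (Finset.sum_le_sum fun i _ => Finset.card_le_card fun q hq => ?_)
    simp at hq ⊢
    exact ⟨hq.2, hq.1⟩
  have h3 := Finset.sum_le_sum fun i (_ : i ∈ Finset.univ.filter fun i : Fin r => (i : ℕ) < t) => h1 i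
  rw [Finset.sum_add_distrib] at h3
  omega

variable [CharZero k] {mu} {lam : Fin (r + 1) → ℕ}

lemma wordTransform_eigen (hlam : Antitone lam) (hsum : ∑ i, lam i = n) (hmn : m ≤ n)
    (h0 : lam 0 = n - m) {l : ℕ} (hln : l ≤ n) (hlm : l ≤ m)
    {u : Fin m → Fin r} (hu : content u = Fin.tail lam)
    {x : ((indRes m n l).obj (hwRep k m (Fin.tail lam))).V}
    (hx : swapSum ((indRes m n l).obj (hwRep k m (Fin.tail lam))).ρ x = (casimir lam : k) • x)
    (hne : wordTransform (Fin.tail lam) l u x ≠ 0) :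
    content (extWord n l u) = lam ∧ wordTransform (Fin.tail lam) l u x ∈ highestWeight k n lam := by
  refine mem_highestWeight_of_eigen hlam hsum (fun t => ?_) hne
    (fun w hw => content_of_wordTransform_ne_zero _ hw) ?_
  · have := partialSum_cons_le hln hlm hmn (u := u) t
    rwa [hu, ← h0, Fin.cons_self_tail] at this
  · rw [← swapSum_wordTransform, hx]
    exact map_smul _ _ _

/-- A nonzero coefficient gives a nonzero transform, which must have weight exactly `lam`; but for
`l < m` its words contain $n-l>\lambda_1$ letters $0$. -/
lemma eq_zero_of_eigen (hlam : Antitone lam) (hsum : ∑ i, lam i = n) (hmn : m ≤ n)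
    (h0 : lam 0 = n - m) {l : ℕ} (hlm : l < m) (ψ : Equiv.Perm (Fin m) →* ℤˣ)
    {x : ((indRes m n l).obj (hwRep k m (Fin.tail lam))).V}
    (hx : x ∈ LinearMap.range
      ((charIdem 1 ψ l).app (hwRep k m (Fin.tail lam))).hom.toLinearMap)
    (he : swapSum ((indRes m n l).obj (hwRep k m (Fin.tail lam))).ρ x = (casimir lam : k) • x) :
    x = 0 := by
  have hln : l ≤ n := by omega
  refine eq_zero_of_indCoef _ x fun g => Subtype.ext (funext fun u => ?_)
  by_contra hne
  have hu : content u = Fin.tail lam :=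
    (indCoef l (hwRep k m (Fin.tail lam)) g x).2.1 u hne
  have h1 := wordTransform_comp (Fin.tail lam) hln hlm.le ψ u hx g
  have h2 : wordTransform (Fin.tail lam) l u x ≠ 0 := fun h => by
    rw [h] at h1
    exact mul_ne_zero (Nat.cast_ne_zero.2 (wordStab_ne_zero _)) hne h1.symm
  have h3 := congrFun (wordTransform_eigen hlam hsum hmn h0 hln hlm.le hu he h2).1 0
  rw [content_extWord_zero hlm.le] at h3
  omega

end Words

end Coefficients

/-! ### The eigenspace in degree zero. -/

section LowestTerm

variable {k : Type u} [Field k] {m n r : ℕ} (lam : Fin (r + 1) → ℕ)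

/-- The restriction of words, on highest weight vectors. -/
def restrHighest (hmn : m ≤ n) :
    (hwRep k n lam).V →ₗ[k] (hwRep k m (Fin.tail lam)).V :=
  (restrWord k n m r).restrict fun _ hf => restrWord_mem_highestWeight hmn hf

lemma restrHighest_apply (hmn : m ≤ n) (f : (hwRep k n lam).V) (u : Fin m → Fin r) :
    (restrHighest lam hmn f).1 u = f.1 (extWord n m u) := rfl

/-- The embedding of the highest weight vectors into the lowest term of the Bernstein complex. -/
noncomputable def lowestMap (hmn : m ≤ n) :
    hwRep k n lam ⟶ (indRes m n m).obj (hwRep k m (Fin.tail lam)) :=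
  Rep.ofHom ⟨∑ g, indResMk n m (hwRep k m (Fin.tail lam)) g ∘ₗ restrHighest lam hmn ∘ₗ
    (hwRep k n lam).ρ g, fun h => by
      ext f : 1
      have e : ∀ g, ((indRes m n m).obj (hwRep k m (Fin.tail lam))).ρ h
          (indResMk n m (hwRep k m (Fin.tail lam)) g
            (restrHighest lam hmn ((hwRep k n lam).ρ g f))) =
          indResMk n m (hwRep k m (Fin.tail lam)) (g * h⁻¹)
            (restrHighest lam hmn ((hwRep k n lam).ρ g f)) := fun g => indRes_ρ_mk _ _ _
      have e1 : ∀ f, (∑ g, indResMk n m (hwRep k m (Fin.tail lam)) g ∘ₗ restrHighest lam hmn ∘ₗ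
          (hwRep k n lam).ρ g) f = ∑ g, indResMk n m (hwRep k m (Fin.tail lam)) g
          (restrHighest lam hmn ((hwRep k n lam).ρ g f)) := fun f => LinearMap.sum_apply _ _ _
      refine (e1 ((hwRep k n lam).ρ h f)).trans (Eq.trans ?_
        (congrArg (((indRes m n m).obj (hwRep k m (Fin.tail lam))).ρ h) (e1 f)).symm)
      refine Eq.trans ?_ (map_sum (((indRes m n m).obj (hwRep k m (Fin.tail lam))).ρ h) _ _).symm
      refine Fintype.sum_equiv (Equiv.mulRight h) _ _ fun g => ?_
      refine Eq.trans ?_ (e _).symm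
      rw [Equiv.coe_mulRight, mul_inv_cancel_right, map_mul, Module.End.mul_apply]⟩

lemma lowestMap_apply (hmn : m ≤ n) (f : (hwRep k n lam).V) :
    (lowestMap lam hmn).hom f = ∑ g, indResMk n m (hwRep k m (Fin.tail lam)) g
      (restrHighest lam hmn ((hwRep k n lam).ρ g f)) := LinearMap.sum_apply _ _ _

/-- The elements of $S_m$ all contribute the same, because restriction of words is
$S_m$-equivariant. -/
lemma indCoef_lowestMap (hmn : m ≤ n) (f : (hwRep k n lam).V) (g : Equiv.Perm (Fin n)) :
    indCoef m (hwRep k m (Fin.tail lam)) g ((lowestMap lam hmn).hom f) =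
      (Fintype.card (Equiv.Perm (Fin m)) : k) •
        restrHighest lam hmn ((hwRep k n lam).ρ g f) := by
  classical
  rw [lowestMap_apply]
  refine (map_sum (indCoef m (hwRep k m (Fin.tail lam)) g) _ _).trans ?_
  rw [Finset.sum_congr rfl fun g' _ => indCoef_mk m (hwRep k m (Fin.tail lam)) g g' _,
    Finset.sum_comm]
  have : ∀ σ : Equiv.Perm (Fin m), ∑ g' : Equiv.Perm (Fin n), (if headPerm m n σ * g' = g then
      (hwRep k m (Fin.tail lam)).ρ (headPerm m m σ)
        (restrHighest lam hmn ((hwRep k n lam).ρ g' f)) else 0) =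
      restrHighest lam hmn ((hwRep k n lam).ρ g f) := fun σ => by
    rw [Finset.sum_eq_single ((headPerm m n σ)⁻¹ * g), if_pos (by simp)]
    · apply Subtype.ext
      funext u
      change f.1 (extWord n m (u ∘ headPerm m m σ) ∘ ((headPerm m n σ)⁻¹ * g : Equiv.Perm _)) =
        f.1 (extWord n m u ∘ g)
      rw [← extWord_comp_headPerm hmn le_rfl, Function.comp_assoc, ← Equiv.Perm.coe_mul,
        mul_inv_cancel_left]
    · intro g' _ hg'
      refine if_neg fun h => hg' ?_
      rw [← h, inv_mul_cancel_left]
    · intro h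
      exact (h (Finset.mem_univ _)).elim
  simp only [this, Finset.sum_const, Finset.card_univ, Nat.cast_smul_eq_nsmul]

lemma subsingleton_strandPerm_self (n : ℕ) : Subsingleton (strandPerm n n) :=
  ⟨fun s t => Subtype.ext (Equiv.ext fun i => by rw [s.2 i i.2, t.2 i i.2])⟩

lemma card_strandPerm_self (n : ℕ) : Fintype.card (strandPerm n n) = 1 :=
  have := subsingleton_strandPerm_self n
  Fintype.card_eq_one_iff.2 ⟨1, fun _ => Subsingleton.elim _ _⟩

/-- No strands of $Q$ are left in this term, and the strands of $P$ permute the letters $0$ of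
extended words, so they merely reindex the sum over `g`. -/
lemma lowestMap_mem_range [CharZero k] (hmn : m ≤ n) (ψ : Equiv.Perm (Fin m) →* ℤˣ)
    (f : (hwRep k n lam).V) : (lowestMap lam hmn).hom f ∈ LinearMap.range
      ((charIdem 1 ψ m).app (hwRep k m (Fin.tail lam))).hom.toLinearMap := by
  refine ⟨(lowestMap lam hmn).hom f, ?_⟩
  have hsub := subsingleton_strandPerm_self m
  have hcard := card_strandPerm_self m
  set M := hwRep k m (Fin.tail lam) with hM
  have h1 : ((charIdem 1 ψ m).app M).hom.toLinearMap ((lowestMap lam hmn).hom f) =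
      ∑ g, stepGen 1 ψ m M g (restrHighest lam hmn ((hwRep k n lam).ρ g f)) := by
    rw [lowestMap_apply]
    exact map_sum ((charIdem 1 ψ m).app M).hom.toLinearMap _ _
  have h2 : ∀ g (v : M.V), stepGen 1 ψ m M g v = (Fintype.card (strandPerm n m) : k)⁻¹ •
      ∑ s : strandPerm n m, indResMk n m M ((s : Equiv.Perm (Fin n)) * g) v := fun g v => by
    rw [stepGen_eq_sum, hcard]
    simp only [Nat.cast_one, inv_one, mul_one]
    congr 1
    refine Finset.sum_congr rfl fun s _ => ?_
    rw [Fintype.sum_subsingleton _ 1]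
    simp
  refine h1.trans ?_
  rw [Finset.sum_congr rfl fun g _ => h2 g _, ← Finset.smul_sum, Finset.sum_comm,
    inv_smul_eq_iff₀ (Nat.cast_ne_zero.2 Fintype.card_ne_zero), ← Finset.card_univ,
    Nat.cast_smul_eq_nsmul, ← Finset.sum_const, lowestMap_apply]
  refine Finset.sum_congr rfl fun s _ => ?_
  refine Fintype.sum_equiv (Equiv.mulLeft (s : Equiv.Perm (Fin n))) _ _ fun g => ?_
  rw [Equiv.coe_mulLeft]
  congr 1
  apply Subtype.ext
  funext u
  change f.1 (extWord n m u ∘ g) = f.1 (extWord n m u ∘ (s.1 * g : Equiv.Perm (Fin n)))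
  rw [Equiv.Perm.coe_mul, ← Function.comp_assoc, extWord_comp_strandPerm u s.2]

lemma swapSum_hom {A B : SymRep k n} (f : A ⟶ B) (x : A.V) :
    f.hom (swapSum A.ρ x) = swapSum B.ρ (f.hom x) := by
  rw [swapSum_apply, swapSum_apply]
  refine (map_sum f.hom.toLinearMap _ _).trans (Finset.sum_congr rfl fun p _ =>
    (map_sum f.hom.toLinearMap _ _).trans (Finset.sum_congr rfl fun q _ => ?_))
  exact Rep.hom_comm_apply f _ x

lemma swapSum_hwRep {r : ℕ} {lam : Fin r → ℕ} (f : (hwRep k n lam).V) :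
    swapSum (hwRep k n lam).ρ f = (casimir lam : k) • f := by
  apply Subtype.ext
  have h := swapSum_of_mem_highestWeight f.2
  rw [swapSum_apply] at h ⊢
  refine Eq.trans ?_ h
  refine (map_sum (highestWeight k n lam).subtype _ _).trans (Finset.sum_congr rfl fun p _ =>
    (map_sum (highestWeight k n lam).subtype _ _).trans (Finset.sum_congr rfl fun q _ => rfl))

lemma swapSum_lowestMap (hmn : m ≤ n) (f : (hwRep k n lam).V) :
    swapSum ((indRes m n m).obj (hwRep k m (Fin.tail lam))).ρ ((lowestMap lam hmn).hom f) =
      (casimir lam : k) • (lowestMap lam hmn).hom f := by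
  rw [← swapSum_hom, swapSum_hwRep]
  exact map_smul (lowestMap lam hmn).hom.toLinearMap _ _

variable [CharZero k] {lam}

/-- Every word of content `lam` is a rearrangement of an extended word, so each value of `f` can be
read off from a coefficient. -/
lemma lowestMap_injective (hsum : ∑ i, lam i = n) (hmn : m ≤ n) (h0 : lam 0 = n - m) :
    Function.Injective (lowestMap (k := k) lam hmn).hom := by
  refine (injective_iff_map_eq_zero (lowestMap (k := k) lam hmn).hom.toLinearMap).2 fun f hf => ?_
  have hf : (lowestMap (k := k) lam hmn).hom f = 0 := hf
  apply Subtype.ext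
  funext w
  by_contra hne
  have hw : content w = lam := f.2.1 w hne
  obtain ⟨u, hu⟩ := exists_content_eq (m := m) (ν := Fin.tail lam) (by
    rw [Fin.sum_univ_succ] at hsum
    change ∑ i : Fin r, lam i.succ = m
    omega)
  obtain ⟨g, hg⟩ := exists_comp_eq_of_content_eq (w := extWord n m u) (w' := w) (by
    rw [content_extWord hmn, hu, hw, ← h0, Fin.cons_self_tail])
  have h1 := indCoef_lowestMap lam hmn f g
  rw [hf, map_zero] at h1
  have h2 := (smul_eq_zero.1 h1.symm).resolve_left (Nat.cast_ne_zero.2 Fintype.card_ne_zero)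
  have h3 := congrFun (congrArg Subtype.val h2) u
  rw [restrHighest_apply] at h3
  refine hne ?_
  rw [← hg]
  exact h3

/-- A preimage is the transform of `x` at one fixed word `u₀`, a highest weight function by
`wordTransform_eigen`. Every other word of the same content is a rearrangement of `u₀`, so
equivariance of the coefficients settles all words at once. -/
lemma exists_lowestMap_eq (hlam : Antitone lam) (hsum : ∑ i, lam i = n) (hmn : m ≤ n)
    (h0 : lam 0 = n - m) (ψ : Equiv.Perm (Fin m) →* ℤˣ)
    {x : ((indRes m n m).obj (hwRep k m (Fin.tail lam))).V}
    (hx : x ∈ LinearMap.range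
      ((charIdem 1 ψ m).app (hwRep k m (Fin.tail lam))).hom.toLinearMap)
    (he : swapSum ((indRes m n m).obj (hwRep k m (Fin.tail lam))).ρ x = (casimir lam : k) • x) :
    ∃ f, (lowestMap lam hmn).hom f = x := by
  obtain ⟨u₀, hu₀⟩ := exists_content_eq (m := m) (ν := Fin.tail lam) (by
    rw [Fin.sum_univ_succ] at hsum
    change ∑ i : Fin r, lam i.succ = m
    omega)
  set N := wordStab (extWord n m u₀) with hN
  have hN0 : (N : k) ≠ 0 := Nat.cast_ne_zero.2 (wordStab_ne_zero _)
  have hc0 : (Fintype.card (Equiv.Perm (Fin m)) : k) ≠ 0 :=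
    Nat.cast_ne_zero.2 Fintype.card_ne_zero
  let f : (hwRep k n lam).V := ⟨wordTransform (Fin.tail lam) m u₀ x, by
    by_cases hne : wordTransform (Fin.tail lam) m u₀ x = 0
    · rw [hne]
      exact zero_mem _
    · exact (wordTransform_eigen hlam hsum hmn h0 hmn le_rfl hu₀ he hne).2⟩
  -- The order of $S_m$ comes from `indCoef_lowestMap`, the stabilizer `N` from
  -- `wordTransform_comp`.
  refine ⟨((Fintype.card (Equiv.Perm (Fin m)) : k) * N)⁻¹ • f, ?_⟩
  refine (map_smul (lowestMap lam hmn).hom.toLinearMap _ f).trans ?_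
  rw [inv_smul_eq_iff₀ (mul_ne_zero hc0 hN0), ← sub_eq_zero]
  refine eq_zero_of_indCoef (hwRep k m (Fin.tail lam)) _ fun g => ?_
  rw [map_sub, sub_eq_zero]
  refine (indCoef_lowestMap lam hmn f g).trans ?_
  rw [map_smul, mul_smul]
  congr 1
  apply Subtype.ext
  funext u
  change wordTransform (Fin.tail lam) m u₀ x (extWord n m u ∘ g) =
    (N : k) * (indCoef m (hwRep k m (Fin.tail lam)) g x).1 u
  by_cases hu : content u = Fin.tail lam
  · obtain ⟨τ, rfl⟩ := exists_comp_eq_of_content_eq (hu₀.trans hu.symm)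
    have h1 : extWord n m (u₀ ∘ τ) ∘ g = extWord n m u₀ ∘ (headPerm m n τ * g : Equiv.Perm _) := by
      rw [Equiv.Perm.coe_mul, ← Function.comp_assoc, extWord_comp_headPerm hmn le_rfl, headPerm_self]
    rw [h1, wordTransform_comp _ hmn le_rfl ψ u₀ hx, indCoef_head, headPerm_self]
    rfl
  · have h2 : (indCoef m (hwRep k m (Fin.tail lam)) g x).1 u = 0 := by
      by_contra h
      exact hu ((indCoef m (hwRep k m (Fin.tail lam)) g x).2.1 u h)
    rw [h2, mul_zero]
    by_contra h
    have h3 := content_of_wordTransform_ne_zero _ h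
    rw [content_comp, content_extWord hmn, content_extWord hmn, hu₀] at h3
    exact hu (Fin.cons_right_injective (α := fun _ => ℕ) (n - m) h3)

end LowestTerm

/-! ### Contraction of a complex by an invertible Laplacian. -/

section Contraction

variable {C : Type*} [Category* C] [Preadditive C] [HasZeroObject C]

/-- A complex `X` with a square-zero map `h` of degree one, such that the Laplacian `hd + dh` is
invertible in positive degrees, is homotopy equivalent to the kernel of the Laplacian in degree
zero. -/
noncomputable def homotopyEquivSingleOfLaplacian (X : ChainComplex C ℤ) (h : ∀ i j, X.X i ⟶ X.X j)
    (hh : ∀ i : ℤ, h i (i + 1) ≫ h (i + 1) (i + 1 + 1) = 0)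
    (hneg : ∀ i < 0, IsZero (X.X i))
    (Θ : ∀ i, X.X i ⟶ X.X i)
    (hΘ : ∀ i : ℤ, 0 < i → (h i (i + 1) ≫ X.d (i + 1) i + X.d i (i - 1) ≫ h (i - 1) i) ≫ Θ i = 𝟙 _)
    (hΘ' : ∀ i : ℤ, 0 < i → Θ i ≫ (h i (i + 1) ≫ X.d (i + 1) i + X.d i (i - 1) ≫ h (i - 1) i) = 𝟙 _)
    {S : C} (ι : S ⟶ X.X 0) [Mono ι] (hι : ι ≫ h 0 1 ≫ X.d 1 0 = 0)
    (hlift : ∀ f : X.X 0 ⟶ X.X 0, f ≫ h 0 1 = 0 → ∃ f', f' ≫ ι = f) :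
    HomotopyEquiv X ((HomologicalComplex.single C (ComplexShape.down ℤ) 0).obj S) := by
  have hh0 : h 0 1 ≫ h 1 2 = 0 := hh 0
  have hΘ1 : (h 1 2 ≫ X.d 2 1 + X.d 1 0 ≫ h 0 1) ≫ Θ 1 = 𝟙 _ := hΘ 1 one_pos
  have hΘ1' : Θ 1 ≫ (h 1 2 ≫ X.d 2 1 + X.d 1 0 ≫ h 0 1) = 𝟙 _ := hΘ' 1 one_pos
  -- Composing `ι ≫ h` with the Laplacian of degree one gives `ι ≫ h ≫ d ≫ h`, which is zero, and
  -- that Laplacian is invertible.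
  have hι' : ι ≫ h 0 1 = 0 := by
    have e : (ι ≫ h 0 1) ≫ (h 1 2 ≫ X.d 2 1 + X.d 1 0 ≫ h 0 1) = 0 := by
      have e1 : ι ≫ h 0 1 ≫ X.d 1 0 ≫ h 0 1 = (ι ≫ h 0 1 ≫ X.d 1 0) ≫ h 0 1 := by
        simp only [Category.assoc]
      rw [Preadditive.comp_add, Category.assoc, Category.assoc, reassoc_of% hh0, e1, hι]
      simp
    rw [← Category.comp_id (ι ≫ h 0 1), ← hΘ1, ← Category.assoc, e, zero_comp]
  -- The Laplacian commutes with `d`, hence so does its inverse.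
  have hd : ∀ i : ℤ, 0 < i → Θ (i + 1) ≫ X.d (i + 1) i = X.d (i + 1) i ≫ Θ i := fun i hi => by
    have e1 := hΘ i hi
    have e2 := hΘ' (i + 1) (by omega)
    rw [add_sub_cancel_right] at e2
    have e3 : (h (i + 1) (i + 1 + 1) ≫ X.d (i + 1 + 1) (i + 1) + X.d (i + 1) i ≫ h i (i + 1)) ≫
        X.d (i + 1) i =
        X.d (i + 1) i ≫ (h i (i + 1) ≫ X.d (i + 1) i + X.d i (i - 1) ≫ h (i - 1) i) := by
      simp
    calc Θ (i + 1) ≫ X.d (i + 1) i = Θ (i + 1) ≫ (X.d (i + 1) i ≫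
          (h i (i + 1) ≫ X.d (i + 1) i + X.d i (i - 1) ≫ h (i - 1) i)) ≫ Θ i := by
          rw [Category.assoc, e1, Category.comp_id]
      _ = _ := by rw [← e3, ← Category.assoc, ← Category.assoc, e2, Category.id_comp]
  -- The Laplacian also commutes with `h`, so its inverse can be moved past `h` to reach `h ≫ h`.
  have hhΘ : h 0 1 ≫ Θ 1 ≫ h 1 2 = 0 := by
    have e1 := hΘ 2 two_pos
    have e1 : (h 2 3 ≫ X.d 3 2 + X.d 2 1 ≫ h 1 2) ≫ Θ 2 = 𝟙 _ := e1
    have hh1 : h 1 2 ≫ h 2 3 = 0 := hh 1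
    have e3 : h 1 2 ≫ (h 2 3 ≫ X.d 3 2 + X.d 2 1 ≫ h 1 2) =
        (h 1 2 ≫ X.d 2 1 + X.d 1 0 ≫ h 0 1) ≫ h 1 2 := by
      rw [Preadditive.comp_add, Preadditive.add_comp, reassoc_of% hh1, Category.assoc,
        Category.assoc, hh0]
      simp
    calc h 0 1 ≫ Θ 1 ≫ h 1 2 = h 0 1 ≫ Θ 1 ≫ (h 1 2 ≫ (h 2 3 ≫ X.d 3 2 + X.d 2 1 ≫ h 1 2)) ≫ Θ 2 := by
          rw [Category.assoc, e1, Category.comp_id]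
      _ = 0 := by
          rw [e3, Category.assoc, reassoc_of% hΘ1', reassoc_of% hh0, zero_comp]
  -- The projection onto the kernel of `h` along the image of `d`; it factors through `ι` by
  -- `hlift`.
  let p : X.X 0 ⟶ X.X 0 := 𝟙 _ - h 0 1 ≫ Θ 1 ≫ X.d 1 0
  have hp : p ≫ h 0 1 = 0 := by
    have e : X.d 1 0 ≫ h 0 1 = (h 1 2 ≫ X.d 2 1 + X.d 1 0 ≫ h 0 1) - h 1 2 ≫ X.d 2 1 := by abel
    simp only [p, Preadditive.sub_comp, Category.id_comp, Category.assoc]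
    rw [e, Preadditive.comp_sub, hΘ1', Preadditive.comp_sub, Category.comp_id, reassoc_of% hhΘ,
      zero_comp]
    simp
  let q := (hlift p hp).choose
  have hq : q ≫ ι = p := (hlift p hp).choose_spec
  have hdp : X.d 1 0 ≫ p = 0 := by
    have e : X.d 1 0 ≫ h 0 1 = (h 1 2 ≫ X.d 2 1 + X.d 1 0 ≫ h 0 1) - h 1 2 ≫ X.d 2 1 := by abel
    have e1 : Θ 2 ≫ X.d 2 1 = X.d 2 1 ≫ Θ 1 := hd 1 one_pos
    simp only [p, Preadditive.comp_sub, Category.comp_id]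
    have e2 : (X.d 1 0 ≫ h 0 1) ≫ Θ 1 = 𝟙 _ - h 1 2 ≫ Θ 2 ≫ X.d 2 1 := by
      rw [e, Preadditive.sub_comp, hΘ1, Category.assoc, e1]
    have e3 : X.d 1 0 ≫ h 0 1 ≫ Θ 1 ≫ X.d 1 0 = ((X.d 1 0 ≫ h 0 1) ≫ Θ 1) ≫ X.d 1 0 := by
      simp only [Category.assoc]
    rw [e3, e2]
    simp
  have hdq : X.d 1 0 ≫ q = 0 := by
    rw [← cancel_mono ι, Category.assoc, hq, hdp, zero_comp]
  have hιq : ι ≫ q = 𝟙 S := by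
    rw [← cancel_mono ι, Category.assoc, hq, Category.id_comp]
    simp [p, reassoc_of% hι']
  let f : X ⟶ (HomologicalComplex.single C (ComplexShape.down ℤ) 0).obj S :=
    HomologicalComplex.mkHomToSingle q (fun i (hi : 0 + 1 = i) => by
      subst hi
      exact hdq)
  let g : (HomologicalComplex.single C (ComplexShape.down ℤ) 0).obj S ⟶ X :=
    HomologicalComplex.mkHomFromSingle ι (fun i (hi : i + 1 = 0) =>
      (hneg i (by omega)).eq_of_tgt _ _)
  have hf0 : f.f 0 = q ≫ (HomologicalComplex.singleObjXSelf (ComplexShape.down ℤ) 0 S).inv :=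
    HomologicalComplex.mkHomToSingle_f _ _
  have hg0 : g.f 0 = (HomologicalComplex.singleObjXSelf (ComplexShape.down ℤ) 0 S).hom ≫ ι :=
    HomologicalComplex.mkHomFromSingle_f _ _
  have hgf : g ≫ f = 𝟙 _ := by
    refine HomologicalComplex.from_single_hom_ext ?_
    rw [HomologicalComplex.comp_f, hf0, hg0, Category.assoc, reassoc_of% hιq]
    simp
  have hfg0 : (f ≫ g).f 0 = p := by
    rw [HomologicalComplex.comp_f, hf0, hg0, Category.assoc, Iso.inv_hom_id_assoc, hq]
  -- The Laplacian is inverted in positive degrees only, so the homotopy starts at degree zero;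
  -- below it the complex vanishes. The minus sign compares `f ≫ g` with the identity in this order.
  let H : ∀ i j, X.X i ⟶ X.X j := fun i j => if i + 1 = j ∧ 0 ≤ i then -(h i j ≫ Θ j) else 0
  have hH : ∀ i : ℤ, 0 ≤ i → H i (i + 1) = -(h i (i + 1) ≫ Θ (i + 1)) := fun i hi =>
    if_pos ⟨rfl, hi⟩
  refine ⟨f, g, { hom := H, zero := ?_, comm := ?_ }, Homotopy.ofEq hgf⟩
  · intro i j hij
    exact if_neg fun hi => hij hi.1
  · intro i
    rw [dNext_eq H (show (ComplexShape.down ℤ).Rel i (i - 1) from sub_add_cancel i 1),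
      prevD_eq H (show (ComplexShape.down ℤ).Rel (i + 1) i from rfl)]
    rcases lt_trichotomy i 0 with hi | rfl | hi
    · exact (hneg i hi).eq_of_src _ _
    · rw [hfg0, hH 0 le_rfl, (hneg (0 - 1) (by norm_num)).eq_of_tgt (X.d 0 (0 - 1)) 0]
      have e : Θ (0 + 1) ≫ X.d (0 + 1) 0 = Θ 1 ≫ X.d 1 0 := rfl
      rw [Preadditive.neg_comp, Category.assoc, e, HomologicalComplex.id_f]
      simp only [p, zero_comp, zero_add]
      rw [sub_eq_neg_add]
      rfl
    · have e0 : (f ≫ g).f i = 0 := by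
        rw [HomologicalComplex.comp_f, (HomologicalComplex.isZero_single_obj_X _ _ _ _
          hi.ne').eq_of_tgt (f.f i) 0, zero_comp]
      obtain ⟨j, rfl⟩ : ∃ j, i = j + 1 := ⟨i - 1, by ring⟩
      have e1 := hΘ (j + 1) hi
      rw [add_sub_cancel_right] at e1 ⊢
      rw [e0, hH j (by omega), hH (j + 1) hi.le, HomologicalComplex.id_f, ← e1,
        Preadditive.neg_comp, Preadditive.comp_neg, Category.assoc, hd (j + 1) hi,
        Preadditive.add_comp]
      simp only [Category.assoc]
      abel

end Contraction

/-! ### The Laplacian on the terms indexed by integers, including the boundary terms. -/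

section Terms

variable {k : Type u} [Field k] {m n : ℕ} (χ : Equiv.Perm (Fin n) →* ℤˣ)
  (ψ : Equiv.Perm (Fin m) →* ℤˣ)

lemma stepIdem_natCast {l : ℕ} (hm : l ≤ m) (hn : l ≤ n) :
    stepIdem (k := k) χ ψ (l : ℤ) = charIdem χ ψ l :=
  if_pos ⟨by omega, by omega, by omega⟩

lemma stepIdem_eq_zero {L : ℤ} (h : ¬ (0 ≤ L ∧ L ≤ m ∧ L ≤ n)) :
    stepIdem (k := k) χ ψ L = 0 := if_neg h

/-- The value of the functor `stepFunctor` on a module. -/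
noncomputable abbrev stepTerm (M : SymRep k m) (L : ℤ) : SymRep k n := (imageFunctor (stepIdem χ ψ L)).obj M

/-- The value of the cap on a module. -/
noncomputable abbrev capTerm (M : SymRep k m) (L L' : ℤ) :
    stepTerm χ ψ M L ⟶ stepTerm χ ψ M L' :=
  (imageMap (stepIdem χ ψ L) (stepIdem χ ψ L') (capMap m n L.toNat L'.toNat)).app M

/-- The value of the cup on a module. -/
noncomputable abbrev cupTerm (M : SymRep k m) (L L' : ℤ) :
    stepTerm χ ψ M L ⟶ stepTerm χ ψ M L' :=
  (imageMap (stepIdem χ ψ L) (stepIdem χ ψ L') (cupMap m n L.toNat L'.toNat)).app M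

lemma isZero_of_forall_eq_zero {G : Type} [Group G] (A : Rep.{u} k G) (h : ∀ x : A.V, x = 0) :
    IsZero A := by
  refine (IsZero.iff_id_eq_zero A).2 ?_
  ext x
  exact (h x).trans (h _).symm

lemma stepTerm_eq_zero (M : SymRep k m) {L : ℤ} (h : ¬ (0 ≤ L ∧ L ≤ m ∧ L ≤ n))
    (z : (stepTerm χ ψ M L).V) : z = 0 := by
  obtain ⟨_, y, rfl⟩ := z
  apply Subtype.ext
  change ((stepIdem χ ψ L).app M).hom y = 0
  rw [stepIdem_eq_zero χ ψ h]
  rfl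

lemma isZero_stepTerm (M : SymRep k m) {L : ℤ} (h : ¬ (0 ≤ L ∧ L ≤ m ∧ L ≤ n)) :
    IsZero (stepTerm χ ψ M L) :=
  isZero_of_forall_eq_zero _ (stepTerm_eq_zero χ ψ M h)

/-- The projection to the image of the idempotent. -/
noncomputable def stepProj (M : SymRep k m) (L : ℤ) :
    ((indRes m n L.toNat).obj M).V →ₗ[k] (stepTerm χ ψ M L).V :=
  ((stepIdem χ ψ L).app M).hom.toLinearMap.rangeRestrict

/-- The inclusion of the image of the idempotent. -/
noncomputable def stepIncl (M : SymRep k m) (L : ℤ) :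
    (stepTerm χ ψ M L).V →ₗ[k] ((indRes m n L.toNat).obj M).V :=
  (LinearMap.range ((stepIdem χ ψ L).app M).hom.toLinearMap).subtype

lemma stepProj_natCast {l : ℕ} (hm : l ≤ m) (hn : l ≤ n) (M : SymRep k m)
    (g : Equiv.Perm (Fin n)) (v : M.V) :
    (stepProj χ ψ M (l : ℤ) (indResMk n l M g v)).1 = stepGen χ ψ l M g v := by
  rw [stepGen_apply]
  exact congrArg (fun f : indRes (k := k) m n l ⟶ indRes m n l => (f.app M).hom (indResMk n l M g v))
    (stepIdem_natCast χ ψ hm hn)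

lemma capTerm_natCast {l l' : ℕ} (hm : l' ≤ m) (hn : l' ≤ n) (M : SymRep k m)
    (z : (stepTerm χ ψ M (l : ℤ)).V) : ((capTerm χ ψ M (l : ℤ) (l' : ℤ)).hom z).1 =
      ((capMap m n l l' ≫ charIdem χ ψ l').app M).hom z.1 :=
  congrArg (fun f : indRes (k := k) m n l' ⟶ indRes m n l' =>
    ((capMap m n l l' ≫ f).app M).hom z.1) (stepIdem_natCast χ ψ hm hn)

lemma cupTerm_natCast {l l' : ℕ} (hm : l' ≤ m) (hn : l' ≤ n) (M : SymRep k m)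
    (z : (stepTerm χ ψ M (l : ℤ)).V) : ((cupTerm χ ψ M (l : ℤ) (l' : ℤ)).hom z).1 =
      ((cupMap m n l l' ≫ charIdem χ ψ l').app M).hom z.1 :=
  congrArg (fun f : indRes (k := k) m n l' ⟶ indRes m n l' =>
    ((cupMap m n l l' ≫ f).app M).hom z.1) (stepIdem_natCast χ ψ hm hn)

variable [CharZero k]

/-- When no further cap is possible, the capped term is zero and `crossGen` is an empty sum with a
zero factor. -/
lemma cup_cap_stepProj {l : ℕ} (hm : l ≤ m) (hn : l ≤ n) (M : SymRep k m) {L : ℤ} (hL : L = l + 1)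
    (g : Equiv.Perm (Fin n)) (v : M.V) :
    (((n : k) - l) * ((m : k) - l)) • ((cupTerm 1 Equiv.Perm.sign M L l).hom
      ((capTerm 1 Equiv.Perm.sign M l L).hom
        (stepProj 1 Equiv.Perm.sign M (l : ℤ) (indResMk n l M g v)))).1 = crossGen hm hn M g v := by
  obtain rfl : L = ((l + 1 : ℕ) : ℤ) := by omega
  by_cases h : l + 1 ≤ m ∧ l + 1 ≤ n
  · have e := cup_cap_stepGen h.1 h.2 M g v
    rw [Nat.cast_sub hn, Nat.cast_sub hm] at e
    rw [← e]
    congr 1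
    refine (cupTerm_natCast 1 Equiv.Perm.sign hm hn M _).trans ?_
    refine congrArg ((cupMap m n (l + 1) l ≫ charIdem 1 Equiv.Perm.sign l).app M).hom ?_
    refine (capTerm_natCast 1 Equiv.Perm.sign h.1 h.2 M _).trans ?_
    exact congrArg ((capMap m n l (l + 1) ≫ charIdem 1 Equiv.Perm.sign (l + 1)).app M).hom
      (stepProj_natCast 1 Equiv.Perm.sign hm hn M g v)
  · rw [crossGen_eq_zero hm hn h, stepTerm_eq_zero 1 Equiv.Perm.sign M (by omega)
      ((capTerm 1 Equiv.Perm.sign M l _).hom _)]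
    refine smul_eq_zero_of_right _ ?_
    exact congrArg Subtype.val (map_zero (cupTerm (k := k) (n := n) 1 Equiv.Perm.sign M
      ((l + 1 : ℕ) : ℤ) l).hom.toLinearMap)

/-- For `l = 0` no cup is possible, and without letters below `l` the two generator formulas agree.
-/
lemma cap_cup_stepProj {l : ℕ} (hm : l ≤ m) (hn : l ≤ n) (M : SymRep k m) {L : ℤ} (hL : L = l - 1)
    (g : Equiv.Perm (Fin n)) (v : M.V) :
    (((n : k) - l + 1) * ((m : k) - l + 1)) • ((capTerm 1 Equiv.Perm.sign M L l).hom
      ((cupTerm 1 Equiv.Perm.sign M l L).hom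
        (stepProj 1 Equiv.Perm.sign M (l : ℤ) (indResMk n l M g v)))).1 =
      laplaceGen hm hn M g v - crossGen hm hn M g v := by
  rcases l with _ | l
  · rw [laplaceGen_zero, sub_self, stepTerm_eq_zero 1 Equiv.Perm.sign M (by omega)
      ((cupTerm 1 Equiv.Perm.sign M _ L).hom _)]
    refine smul_eq_zero_of_right _ ?_
    exact congrArg Subtype.val (map_zero (capTerm (k := k) (n := n) 1 Equiv.Perm.sign M
      L ((0 : ℕ) : ℤ)).hom.toLinearMap)
  · obtain rfl : L = (l : ℤ) := by push_cast at hL; omega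
    have e := cap_cup_stepGen hm hn M g v
    rw [Nat.cast_sub (by omega), Nat.cast_sub (by omega)] at e
    rw [← e]
    have hc : ((n : k) - (l + 1 : ℕ) + 1) * ((m : k) - (l + 1 : ℕ) + 1) = (n - l) * (m - l) := by
      push_cast
      ring
    rw [hc]
    congr 1
    refine (capTerm_natCast 1 Equiv.Perm.sign hm hn M _).trans ?_
    refine congrArg ((capMap m n l (l + 1) ≫ charIdem 1 Equiv.Perm.sign (l + 1)).app M).hom ?_
    refine (cupTerm_natCast 1 Equiv.Perm.sign (by omega) (by omega) M _).trans ?_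
    exact congrArg ((cupMap m n (l + 1) l ≫ charIdem 1 Equiv.Perm.sign l).app M).hom
      (stepProj_natCast 1 Equiv.Perm.sign hm hn M g v)

/-- On a module on which the sum of all transpositions is a scalar `c`, so is the Laplacian of the
Bernstein complex up to the sum of all transpositions. -/
lemma laplacian_stepTerm {M : SymRep k m} {c : k} (hM : ∀ v : M.V, swapSum M.ρ v = c • v)
    {L L' L'' : ℤ} (hL' : L' = L - 1) (hL'' : L'' = L + 1)
    (z : (stepTerm (n := n) 1 Equiv.Perm.sign M L).V) :
    (2 * (((n : k) - L + 1) * ((m : k) - L + 1))) • ((capTerm 1 Equiv.Perm.sign M L' L).hom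
        ((cupTerm 1 Equiv.Perm.sign M L L').hom z)).1 +
      (2 * (((n : k) - L) * ((m : k) - L))) • ((cupTerm 1 Equiv.Perm.sign M L'' L).hom
        ((capTerm 1 Equiv.Perm.sign M L L'').hom z)).1 =
      swapSum ((indRes m n L.toNat).obj M).ρ z.1 +
        (2 * (m : k) - ((n : k) - (m : k)) ^ 2 - c) • z.1 := by
  by_cases h : 0 ≤ L ∧ L ≤ m ∧ L ≤ n
  swap
  · obtain rfl := stepTerm_eq_zero _ _ M h z
    have e1 : (cupTerm (k := k) (n := n) 1 Equiv.Perm.sign M L L').hom 0 = 0 :=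
      map_zero (cupTerm (k := k) (n := n) 1 Equiv.Perm.sign M L L').hom.toLinearMap
    have e2 : (capTerm (k := k) (n := n) 1 Equiv.Perm.sign M L L'').hom 0 = 0 :=
      map_zero (capTerm (k := k) (n := n) 1 Equiv.Perm.sign M L L'').hom.toLinearMap
    rw [stepTerm_eq_zero _ _ M h ((capTerm (n := n) 1 Equiv.Perm.sign M L' L).hom _),
      stepTerm_eq_zero _ _ M h ((cupTerm (n := n) 1 Equiv.Perm.sign M L'' L).hom _)]
    change _ • (0 : ((indRes m n L.toNat).obj M).V) + _ • (0 : ((indRes m n L.toNat).obj M).V) =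
      swapSum _ (0 : ((indRes m n L.toNat).obj M).V) + _ • (0 : ((indRes m n L.toNat).obj M).V)
    rw [map_zero, smul_zero, smul_zero, smul_zero]
  obtain ⟨l, rfl⟩ := Int.eq_ofNat_of_zero_le h.1
  have hm : l ≤ m := by omega
  have hn : l ≤ n := by omega
  -- Both sides are linear in a preimage under the projection, so generators suffice; there the
  -- `crossGen` contributions cancel.
  obtain ⟨y, rfl⟩ : ∃ y, stepProj 1 Equiv.Perm.sign M (l : ℤ) y = z :=
    LinearMap.surjective_rangeRestrict _ z
  let ι := stepIncl (k := k) (n := n) 1 Equiv.Perm.sign M (l : ℤ)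
  let π := stepProj (k := k) (n := n) 1 Equiv.Perm.sign M (l : ℤ)
  let F₁ : ((indRes (k := k) m n l).obj M).V →ₗ[k] ((indRes m n l).obj M).V :=
    ι ∘ₗ (capTerm 1 Equiv.Perm.sign M L' l).hom.toLinearMap ∘ₗ
      (cupTerm 1 Equiv.Perm.sign M l L').hom.toLinearMap ∘ₗ π
  let F₂ : ((indRes (k := k) m n l).obj M).V →ₗ[k] ((indRes m n l).obj M).V :=
    ι ∘ₗ (cupTerm 1 Equiv.Perm.sign M L'' l).hom.toLinearMap ∘ₗ
      (capTerm 1 Equiv.Perm.sign M l L'').hom.toLinearMap ∘ₗ π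
  let G : ((indRes (k := k) m n l).obj M).V →ₗ[k] ((indRes m n l).obj M).V := ι ∘ₗ π
  refine LinearMap.congr_fun
    (f := (2 * (((n : k) - (l : ℤ) + 1) * ((m : k) - (l : ℤ) + 1))) • F₁ +
      (2 * (((n : k) - (l : ℤ)) * ((m : k) - (l : ℤ)))) • F₂)
    (g := swapSum ((indRes m n l).obj M).ρ ∘ₗ G +
      (2 * (m : k) - ((n : k) - (m : k)) ^ 2 - c) • G) (indRes_linear_ext fun g v => ?_) y
  have e1 := cap_cup_stepProj hm hn M hL' g v
  have e2 := cup_cap_stepProj hm hn M hL'' g v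
  have e3 := two_smul_laplaceGen hm hn M g v
  have e4 := stepProj_natCast 1 Equiv.Perm.sign hm hn M g v
  rw [hM, map_smul] at e3
  change (2 * (((n : k) - (l : ℤ) + 1) * ((m : k) - (l : ℤ) + 1))) • F₁ (indResMk n l M g v) +
      (2 * (((n : k) - (l : ℤ)) * ((m : k) - (l : ℤ)))) • F₂ (indResMk n l M g v) =
    swapSum ((indRes m n l).obj M).ρ (G (indResMk n l M g v)) +
      (2 * (m : k) - ((n : k) - (m : k)) ^ 2 - c) • G (indResMk n l M g v)
  have e1' : (((n : k) - l + 1) * ((m : k) - l + 1)) • F₁ (indResMk n l M g v) =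
    laplaceGen hm hn M g v - crossGen hm hn M g v := e1
  have e2' : (((n : k) - l) * ((m : k) - l)) • F₂ (indResMk n l M g v) =
    crossGen hm hn M g v := e2
  have e4' : G (indResMk n l M g v) = stepGen 1 Equiv.Perm.sign l M g v := e4
  rw [e4', Int.cast_natCast, mul_smul (2 : k), mul_smul (2 : k), e1', e2', ← smul_add, sub_add_cancel, e3]
  module

end Terms

/-! ### Finite dimension, which makes injective Laplacians invertible. -/

section FiniteDimensional

variable {k : Type u} [Field k] {m n : ℕ}

lemma finite_indRes (l : ℕ) (M : SymRep k m) [Module.Finite k M.V] :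
    Module.Finite k ((indRes m n l).obj M).V := by
  let F : (Equiv.Perm (Fin n) → M.V) →ₗ[k] ((indRes m n l).obj M).V :=
    ∑ g, indResMk n l M g ∘ₗ LinearMap.proj g
  have hmem : ∀ g v, indResMk n l M g v ∈ LinearMap.range F := fun g v => by
    classical
    refine ⟨Pi.single g v, ?_⟩
    refine (LinearMap.sum_apply _ _ _).trans ?_
    rw [Finset.sum_eq_single g]
    · exact congrArg (indResMk n l M g)
        (by simp : (LinearMap.proj g : (Equiv.Perm (Fin n) → M.V) →ₗ[k] M.V) (Pi.single g v) = v)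
    · intro b _ hb
      refine (congrArg (indResMk n l M b) (?_ : (LinearMap.proj b :
        (Equiv.Perm (Fin n) → M.V) →ₗ[k] M.V) (Pi.single g v) = 0)).trans (map_zero _)
      simp [hb]
    · intro h
      exact (h (Finset.mem_univ _)).elim
  have h0 : (LinearMap.range F).mkQ = 0 := indRes_linear_ext fun g v =>
    (Submodule.Quotient.mk_eq_zero _).2 (hmem g v)
  refine Module.Finite.of_surjective F (LinearMap.range_eq_top.1 (eq_top_iff.2 fun x _ => ?_))
  exact (Submodule.Quotient.mk_eq_zero _).1 (LinearMap.congr_fun h0 x)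

lemma finite_stepTerm (χ : Equiv.Perm (Fin n) →* ℤˣ) (ψ : Equiv.Perm (Fin m) →* ℤˣ)
    (M : SymRep k m) [Module.Finite k M.V] (L : ℤ) : Module.Finite k (stepTerm χ ψ M L).V :=
  have := finite_indRes (n := n) L.toNat M
  inferInstanceAs (Module.Finite k (LinearMap.range _))

lemma isIso_of_injective {G : Type} [Group G] {A : Rep.{u} k G} [Module.Finite k A.V] (f : A ⟶ A)
    (hf : ∀ x, f.hom x = 0 → x = 0) : IsIso f := by
  refine (ConcreteCategory.isIso_iff_bijective f).2 ?_
  have h : Function.Injective f.hom.toLinearMap := (injective_iff_map_eq_zero _).2 hf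
  exact ⟨h, LinearMap.surjective_of_injective h⟩

end FiniteDimensional

/-! ### The Bernstein complex of a Specht module. -/

section Evaluation

variable {k : Type u} [Field k] {m n r : ℕ}

/-- The value of a complex of functors on a module. -/
def evalComplex (B : ChainComplex (SymRep k m ⥤+ SymRep k n) ℤ) (M : SymRep k m) :
    ChainComplex (SymRep k n) ℤ where
  X i := ((AdditiveFunctor.forget _ _).obj (B.X i)).obj M
  d i j := ((AdditiveFunctor.forget _ _).map (B.d i j)).app M
  shape i j h := by
    rw [B.shape i j h]
    rfl
  d_comp_d' i j l _ _ := congrArg (fun f => ((AdditiveFunctor.forget _ _).map f).app M)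
    (B.d_comp_d i j l)

lemma exists_lift_of_injective {G : Type} [Group G] {A B S : Rep.{u} k G} (ι : S ⟶ B)
    (hι : Function.Injective ι.hom) (f : A ⟶ B) (h : ∀ a, ∃ s, ι.hom s = f.hom a) :
    ∃ f' : A ⟶ S, f' ≫ ι = f := by
  let e := LinearEquiv.ofInjective ι.hom.toLinearMap hι
  let f₀ := e.symm.toLinearMap ∘ₗ f.hom.toLinearMap.codRestrict
    (LinearMap.range ι.hom.toLinearMap) h
  have hf₀ : ∀ a, ι.hom (f₀ a) = f.hom a := fun a => congrArg Subtype.val (e.apply_symm_apply _)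
  refine ⟨Rep.ofHom ⟨f₀, fun g => ?_⟩, ?_⟩
  · ext a
    apply hι
    change ι.hom (f₀ (A.ρ g a)) = ι.hom (S.ρ g (f₀ a))
    rw [hf₀, Rep.hom_comm_apply, Rep.hom_comm_apply, hf₀]
  · ext a
    exact hf₀ a

lemma mono_of_injective {G : Type} [Group G] {A B : Rep.{u} k G} (f : A ⟶ B)
    (hf : Function.Injective f.hom) : Mono f := ConcreteCategory.mono_of_injective f hf

/-- Removing the first row lowers the row index of each of the remaining $m$ boxes by one. -/
lemma casimir_eq_tail (lam : Fin (r + 1) → ℕ) (hm : ∑ i, Fin.tail lam i = m) :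
    casimir lam = (lam 0 : ℤ) ^ 2 + casimir (Fin.tail lam) - 2 * m := by
  subst hm
  rw [casimir, Fin.sum_univ_succ, casimir]
  push_cast
  rw [Finset.mul_sum, add_sub_assoc, ← Finset.sum_sub_distrib]
  congr 1
  · simp
  · refine Finset.sum_congr rfl fun i _ => ?_
    simp [Fin.tail]
    ring

variable [CharZero k] {lam : Fin (r + 1) → ℕ}

lemma exists_lowestTermMap (hlam : Antitone lam) (hsum : ∑ i, lam i = n) (hmn : m ≤ n)
    (h0 : lam 0 = n - m) {L : ℤ} (hL : L = m) :
    ∃ ι : hwRep k n lam ⟶ stepTerm 1 Equiv.Perm.sign (hwRep k m (Fin.tail lam)) L,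
      Function.Injective ι.hom ∧
      (∀ f, swapSum ((indRes m n L.toNat).obj (hwRep k m (Fin.tail lam))).ρ (ι.hom f).1 =
        (casimir lam : k) • (ι.hom f).1) ∧
      ∀ z, swapSum ((indRes m n L.toNat).obj (hwRep k m (Fin.tail lam))).ρ z.1 =
        (casimir lam : k) • z.1 → ∃ f, ι.hom f = z := by
  subst hL
  have hr : LinearMap.range ((stepIdem 1 Equiv.Perm.sign (m : ℤ)).app
      (hwRep k m (Fin.tail lam))).hom.toLinearMap =
      LinearMap.range ((charIdem (n := n) 1 Equiv.Perm.sign m).app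
        (hwRep k m (Fin.tail lam))).hom.toLinearMap :=
    congrArg (fun f : indRes (k := k) m n m ⟶ indRes m n m =>
      LinearMap.range (f.app (hwRep k m (Fin.tail lam))).hom.toLinearMap)
      (stepIdem_natCast 1 Equiv.Perm.sign le_rfl hmn)
  have hmem : ∀ f, (lowestMap lam hmn).hom f ∈ LinearMap.range
      ((stepIdem 1 Equiv.Perm.sign (m : ℤ)).app
        (hwRep k m (Fin.tail lam))).hom.toLinearMap := fun f => by
    rw [hr]
    exact lowestMap_mem_range lam hmn _ f
  refine ⟨Rep.ofHom ⟨(lowestMap lam hmn).hom.toLinearMap.codRestrict _ hmem, fun g => ?_⟩,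
    fun a b h => ?_, fun f => ?_, fun z hz => ?_⟩
  · ext f : 1
    exact Subtype.ext (Rep.hom_comm_apply (lowestMap lam hmn) g f)
  · exact lowestMap_injective hsum hmn h0 (congrArg Subtype.val h)
  · exact swapSum_lowestMap lam hmn f
  · obtain ⟨f, hf⟩ := exists_lowestMap_eq hlam hsum hmn h0 Equiv.Perm.sign (x := z.1)
      (hr ▸ z.2) hz
    exact ⟨f, Subtype.ext hf⟩

lemma stepTerm_eq_zero_of_eigen (hlam : Antitone lam) (hsum : ∑ i, lam i = n) (hmn : m ≤ n)
    (h0 : lam 0 = n - m) {L : ℤ} (hL : L < m)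
    (z : (stepTerm (n := n) 1 Equiv.Perm.sign (hwRep k m (Fin.tail lam)) L).V)
    (hz : swapSum ((indRes m n L.toNat).obj (hwRep k m (Fin.tail lam))).ρ z.1 =
        (casimir lam : k) • z.1) : z = 0 := by
  by_cases hL0 : 0 ≤ L
  swap
  · exact stepTerm_eq_zero _ _ _ (by omega) z
  obtain ⟨l, rfl⟩ := Int.eq_ofNat_of_zero_le hL0
  obtain ⟨y, hy⟩ := z.2
  refine Subtype.ext (eq_zero_of_eigen hlam hsum hmn h0 (by omega) Equiv.Perm.sign (x := z.1)
    ⟨y, ?_⟩ hz)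
  refine Eq.trans ?_ hy
  exact congrArg (fun f : indRes (k := k) m n l ⟶ indRes m n l =>
    (f.app (hwRep k m (Fin.tail lam))).hom y)
    (stepIdem_natCast 1 Equiv.Perm.sign (by omega) (by omega)).symm

/-- The contracting map of the Bernstein complex, a multiple of the cup. -/
noncomputable def bernsteinHomotopy (M : SymRep k m) (i j : ℤ) :
    (evalComplex (bernsteinBlock k m n) M).X i ⟶ (evalComplex (bernsteinBlock k m n) M).X j :=
  -- With $x=n-m+i$ and $y=i$ strands, the factor $2(x+1)(y+1)$ cancels the averaging of the cap
  -- back from degree $i+1$; the $2$ is the one in `two_smul_laplaceGen`.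
  if i + 1 = j then (2 * (((n : k) - m + i + 1) * ((i : k) + 1))) •
    cupTerm 1 Equiv.Perm.sign M (m - i) (m - j) else 0

lemma evalComplex_bernsteinBlock_d (M : SymRep k m) (i j : ℤ) (h : j + 1 = i) :
    (evalComplex (bernsteinBlock k m n) M).d i j =
      capTerm 1 Equiv.Perm.sign M (m - i) (m - j) := by
  change ((AdditiveFunctor.forget _ _).map (if j + 1 = i then
    capStep (k := k) (m := m) (n := n) 1 Equiv.Perm.sign (m - i) (m - j) else 0)).app M = _
  rw [if_pos h]
  rfl

lemma bernsteinHomotopy_eq (M : SymRep k m) (i j : ℤ) (h : i + 1 = j) :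
    bernsteinHomotopy (n := n) M i j = (2 * (((n : k) - m + i + 1) * ((i : k) + 1))) •
      cupTerm 1 Equiv.Perm.sign M (m - i) (m - j) := if_pos h

lemma bernsteinHomotopy_comp (M : SymRep k m) (i : ℤ) :
    bernsteinHomotopy (n := n) M i (i + 1) ≫ bernsteinHomotopy M (i + 1) (i + 1 + 1) = 0 := by
  have h := cupStep_cupStep (k := k) (n := n) (m := m) 1 Equiv.Perm.sign
    (fun l hm hn => by simp [sign_strandSwap])
    (L := m - i) (L' := m - (i + 1)) (L'' := m - (i + 1 + 1)) (by ring) (by ring)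
  have h' := congrArg (fun f => ((AdditiveFunctor.forget _ _).map f).app M) h
  rw [bernsteinHomotopy_eq M _ _ rfl, bernsteinHomotopy_eq M _ _ rfl]
  have h'' : cupTerm (k := k) (n := n) 1 Equiv.Perm.sign M (m - i) (m - (i + 1)) ≫
    cupTerm 1 Equiv.Perm.sign M (m - (i + 1)) (m - (i + 1 + 1)) = 0 := h'
  have h3 : ∀ a b : k, (a • cupTerm (k := k) (n := n) 1 Equiv.Perm.sign M (m - i) (m - (i + 1))) ≫
    (b • cupTerm 1 Equiv.Perm.sign M (m - (i + 1)) (m - (i + 1 + 1))) = 0 := fun a b => by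
      rw [Linear.smul_comp, Linear.comp_smul, h'', smul_zero, smul_zero]
  exact h3 _ _

/-- With $n-m=\lambda_1$, the constant of `laplacian_stepTerm` becomes minus the eigenvalue of
`lam`. So the kernel of the Laplacian is an eigenspace of the sum of all transpositions. -/
lemma bernsteinLaplacian_apply (hsum : ∑ i, lam i = n) (hm : ∑ i, Fin.tail lam i = m) (i : ℤ)
    (z : (stepTerm (n := n) 1 Equiv.Perm.sign (hwRep k m (Fin.tail lam)) (m - i)).V) :
    ((bernsteinHomotopy (hwRep k m (Fin.tail lam)) i (i + 1) ≫
      (evalComplex (bernsteinBlock k m n) (hwRep k m (Fin.tail lam))).d (i + 1) i +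
      (evalComplex (bernsteinBlock k m n) (hwRep k m (Fin.tail lam))).d i (i - 1) ≫
        bernsteinHomotopy (hwRep k m (Fin.tail lam)) (i - 1) i).hom z).1 =
      swapSum ((indRes m n (m - i).toNat).obj (hwRep k m (Fin.tail lam))).ρ z.1 -
        (casimir lam : k) • z.1 := by
  have e := laplacian_stepTerm (n := n) (fun v => swapSum_hwRep (k := k) (lam := Fin.tail lam) v)
    (L := m - i) (L' := m - (i + 1)) (L'' := m - (i - 1)) (by ring) (by ring) z
  have hn : (n : k) = lam 0 + m := by
    rw [← hsum, Fin.sum_univ_succ, ← hm]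
    push_cast
    rfl
  rw [bernsteinHomotopy_eq _ _ _ rfl, bernsteinHomotopy_eq _ (i - 1) i (by ring),
    evalComplex_bernsteinBlock_d _ _ _ rfl, evalComplex_bernsteinBlock_d _ i (i - 1) (by ring)]
  have hc : 2 * (m : k) - ((n : k) - (m : k)) ^ 2 - (casimir (Fin.tail lam) : k) =
      - (casimir lam : k) := by
    rw [casimir_eq_tail lam hm, hn]
    push_cast
    ring
  rw [hc, neg_smul, ← sub_eq_add_neg] at e
  rw [← e]
  have c1 : 2 * (((n : k) - ((m : ℤ) - i : ℤ) + 1) * ((m : k) - ((m : ℤ) - i : ℤ) + 1)) =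
      2 * (((n : k) - m + i + 1) * ((i : k) + 1)) := by
    push_cast
    ring
  have c2 : 2 * (((n : k) - ((m : ℤ) - i : ℤ)) * ((m : k) - ((m : ℤ) - i : ℤ))) =
      2 * (((n : k) - m + (i - 1 : ℤ) + 1) * (((i - 1 : ℤ) : k) + 1)) := by
    push_cast
    ring
  rw [c1, c2]
  have e5 : ∀ c : k, ((c • cupTerm (k := k) (n := n) 1 Equiv.Perm.sign (hwRep k m (Fin.tail lam))
      (m - i) (m - (i + 1))) ≫ capTerm 1 Equiv.Perm.sign (hwRep k m (Fin.tail lam))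
      (m - (i + 1)) (m - i)).hom z = c • (capTerm 1 Equiv.Perm.sign (hwRep k m (Fin.tail lam))
      (m - (i + 1)) (m - i)).hom ((cupTerm (k := k) (n := n) 1 Equiv.Perm.sign
      (hwRep k m (Fin.tail lam)) (m - i) (m - (i + 1))).hom z) := fun c =>
    map_smul (capTerm (k := k) (n := n) 1 Equiv.Perm.sign (hwRep k m (Fin.tail lam))
      (m - (i + 1)) (m - i)).hom.toLinearMap c _
  exact congrArg₂ (· + ·) (congrArg Subtype.val (e5 _)) rfl

/-- The Bernstein operator adds a first row. -/
theorem nonempty_evalComplex_bernsteinBlock (hlam : Antitone lam) (hsum : ∑ i, lam i = n)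
    (hm : ∑ i, Fin.tail lam i = m) :
    Nonempty (HomotopyEquiv (evalComplex (bernsteinBlock k m n) (hwRep k m (Fin.tail lam)))
      ((HomologicalComplex.single _ (ComplexShape.down ℤ) 0).obj (hwRep k n lam))) := by
  have hnm : n = lam 0 + m := by
    rw [← hsum, Fin.sum_univ_succ, ← hm]
    rfl
  have hmn : m ≤ n := by omega
  have h0 : lam 0 = n - m := by omega
  set X := evalComplex (bernsteinBlock k m n) (hwRep k m (Fin.tail lam)) with hX
  let h : ∀ i j, X.X i ⟶ X.X j := bernsteinHomotopy (n := n) (hwRep k m (Fin.tail lam))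
  let Δ : ∀ i, X.X i ⟶ X.X i := fun i =>
    h i (i + 1) ≫ X.d (i + 1) i + X.d i (i - 1) ≫ h (i - 1) i
  have hneg : ∀ i < 0, IsZero (X.X i) := fun i hi => isZero_stepTerm _ _ _ (by omega)
  -- A kernel vector would be an eigenvector for the scalar of `lam` in a term with `L < m`.
  have hΔ : ∀ i : ℤ, 0 < i → IsIso (Δ i) := fun i hi => by
    have : Module.Finite k (X.X i).V :=
      finite_stepTerm (n := n) 1 Equiv.Perm.sign (hwRep k m (Fin.tail lam)) (m - i)
    refine isIso_of_injective (Δ i) fun z hz => ?_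
    refine stepTerm_eq_zero_of_eigen hlam hsum hmn h0 (by omega) z (sub_eq_zero.1 ?_)
    rw [← bernsteinLaplacian_apply hsum hm i z]
    exact congrArg Subtype.val hz
  obtain ⟨ι, hι, hι1, hι2⟩ := exists_lowestTermMap (k := k) hlam hsum hmn h0
    (L := m - 0) (sub_zero _)
  have hd0 : X.d 0 (0 - 1) = 0 := (hneg (0 - 1) (by norm_num)).eq_of_tgt _ _
  have hΔ0 : Δ 0 = h 0 1 ≫ X.d 1 0 := by
    change h 0 1 ≫ X.d 1 0 + X.d 0 (0 - 1) ≫ h (0 - 1) 0 = _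
    rw [hd0, zero_comp, add_zero]
  have hmono : Mono (C := SymRep k n) (X := hwRep k n lam) (Y := X.X 0) ι := mono_of_injective ι hι
  classical
  refine ⟨homotopyEquivSingleOfLaplacian X h (bernsteinHomotopy_comp _) hneg
    (fun i => if hi : 0 < i then (have := hΔ i hi; inv (Δ i)) else 0) (fun i hi => ?_)
    (fun i hi => ?_) (S := hwRep k n lam) ι ?_ fun f hf => ?_⟩
  · rw [dif_pos hi]
    have := hΔ i hi
    exact IsIso.hom_inv_id (Δ i)
  · rw [dif_pos hi]
    have := hΔ i hi
    exact IsIso.inv_hom_id (Δ i)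
  · rw [← hΔ0]
    ext f
    refine Subtype.ext ((bernsteinLaplacian_apply hsum hm 0 (ι.hom f)).trans ?_)
    exact sub_eq_zero.2 (hι1 f)
  -- What `h` kills is killed by the Laplacian of degree zero, so the values of `f` are eigenvectors
  -- and lie in the image of `ι`.
  · refine exists_lift_of_injective ι hι f fun a => hι2 _ (sub_eq_zero.1 ?_)
    refine (bernsteinLaplacian_apply hsum hm 0 (f.hom a)).symm.trans ?_
    have e : f ≫ Δ 0 = 0 := by
      rw [hΔ0, ← Category.assoc, hf, zero_comp]
    exact congrArg Subtype.val (congrArg (fun f : X.X 0 ⟶ X.X 0 => f.hom a) e)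

end Evaluation

/-! ### The dual Bernstein complex of a Specht module. -/

section DualBlock

variable {k : Type u} [Field k] {m n r : ℕ} {lam : Fin (r + 1) → ℕ}

/-- The average over the permutations of the last strands. -/
noncomputable def strandAverage (M : SymRep k m) (l : ℕ) : M.V →ₗ[k] M.V :=
  (Fintype.card (strandPerm m l) : k)⁻¹ • ∑ t : strandPerm m l, M.ρ t

lemma strandAverage_apply (M : SymRep k m) (l : ℕ) (v : M.V) :
    strandAverage M l v = (Fintype.card (strandPerm m l) : k)⁻¹ • ∑ t : strandPerm m l, M.ρ t v := by
  simp [strandAverage, LinearMap.sum_apply]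

lemma strandAverage_val {r : ℕ} {lam : Fin r → ℕ} (l : ℕ) (f : (hwRep k m lam).V)
    (w : Fin m → Fin r) : (strandAverage (hwRep k m lam) l f).1 w =
      (Fintype.card (strandPerm m l) : k)⁻¹ * ∑ t : strandPerm m l, f.1 (w ∘ t.1) := by
  rw [strandAverage_apply]
  change ((Fintype.card (strandPerm m l) : k)⁻¹ •
    (highestWeight k m lam).subtype (∑ t : strandPerm m l, (hwRep k m lam).ρ t f)) w = _
  rw [map_sum, Pi.smul_apply, Finset.sum_apply]
  rfl

lemma strandAverage_mem {r : ℕ} {lam : Fin r → ℕ} (l : ℕ) (f : (hwRep k m lam).V) :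
    (strandAverage (hwRep k m lam) l f).1 ∈ strandInvariants k m r l := fun p q hp hq w => by
  rw [strandAverage_val, strandAverage_val]
  congr 1
  refine Fintype.sum_equiv (Equiv.mulLeft ⟨_, swap_mem_strandPerm hp hq⟩) _ _ fun t => ?_
  rfl

lemma indCoef_one_strandMap (M : SymRep k m) {l : ℕ} (t : strandPerm m l)
    (y : ((indRes m n l).obj M).V) :
    indCoef l M 1 (((strandMap (1 : strandPerm n l) t).app M).hom y) = M.ρ t (indCoef l M 1 y) := by
  classical
  refine LinearMap.congr_fun (f := indCoef l M 1 ∘ₗ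
    ((strandMap (1 : strandPerm n l) t).app M).hom.toLinearMap)
    (g := M.ρ t ∘ₗ indCoef l M 1) (indRes_linear_ext fun g v => ?_) y
  refine (congrArg (indCoef l M 1) (strandMap_mk (1 : strandPerm n l) t M g v)).trans ?_
  change _ = M.ρ t (indCoef l M 1 (indResMk n l M g v))
  rw [indCoef_mk, indCoef_mk, map_sum]
  refine Finset.sum_congr rfl fun σ _ => ?_
  simp only [OneMemClass.coe_one, one_mul]
  split_ifs
  · rw [← Module.End.mul_apply, ← map_mul, ← strandPerm_mul_headPerm le_rfl t.2, map_mul,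
      Module.End.mul_apply]
  · simp

/-- Taking the coefficient of one and restricting words. -/
noncomputable def dualLowestMap (lam : Fin (r + 1) → ℕ) (hnm : n ≤ m) :
    (indRes (k := k) m n n).obj (hwRep k m lam) ⟶ hwRep k n (Fin.tail lam) :=
  Rep.ofHom ⟨restrHighest lam hnm ∘ₗ indCoef n (hwRep k m lam) 1, fun g => by
    refine LinearMap.ext fun x => ?_
    have e : indCoef n (hwRep k m lam) 1 (((indRes m n n).obj (hwRep k m lam)).ρ g x) =
        (hwRep k m lam).ρ (headPerm n m g) (indCoef n (hwRep k m lam) 1 x) := by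
      rw [indCoef_ρ, one_mul, ← indCoef_head, headPerm_self, mul_one]
    refine (congrArg (restrHighest lam hnm) e).trans (Subtype.ext ?_)
    exact restrWord_wordRep hnm g _⟩

lemma indCoef_one_mem_strandInvariants {l r : ℕ} {lam : Fin r → ℕ}
    (χ : Equiv.Perm (Fin n) →* ℤˣ) {x : ((indRes m n l).obj (hwRep k m lam)).V}
    (hx : x ∈ LinearMap.range ((charIdem χ 1 l).app (hwRep k m lam)).hom.toLinearMap) :
    (indCoef l (hwRep k m lam) 1 x).1 ∈ strandInvariants k m r l := fun p q hp hq w => by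
  obtain ⟨y, rfl⟩ := hx
  have h := congrArg (fun f : indRes (k := k) m n l ⟶ indRes m n l =>
    (f.app (hwRep k m lam)).hom y) (charIdem_comp_strandMap (k := k) χ 1 (1 : strandPerm n l)
      (⟨_, swap_mem_strandPerm hp hq⟩ : strandPerm m l))
  have h1 : ((strandMap (1 : strandPerm n l)
      (⟨_, swap_mem_strandPerm hp hq⟩ : strandPerm m l)).app (hwRep k m lam)).hom
      (((charIdem χ 1 l).app (hwRep k m lam)).hom y) =
      ((charIdem χ 1 l).app (hwRep k m lam)).hom y := h.trans (by simp)
  have h2 := indCoef_one_strandMap (hwRep k m lam)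
    (⟨_, swap_mem_strandPerm hp hq⟩ : strandPerm m l)
    (((charIdem (n := n) χ 1 l).app (hwRep k m lam)).hom y)
  rw [h1] at h2
  exact (congrFun (congrArg Subtype.val h2) w).symm

variable [CharZero k]

lemma stepGen_strandAverage (χ : Equiv.Perm (Fin n) →* ℤˣ) (l : ℕ) (M : SymRep k m)
    (g : Equiv.Perm (Fin n)) (v : M.V) :
    stepGen χ 1 l M g (strandAverage M l v) = stepGen χ 1 l M g v := by
  have h : ∀ t : strandPerm m l, stepGen χ 1 l M g (M.ρ t v) = stepGen χ 1 l M g v := fun t => by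
    have := stepGen_strand (k := k) χ 1 M (one_mem (strandPerm n l)) t.2 g v
    rw [one_mul] at this
    simpa using this
  rw [strandAverage_apply, map_smul, map_sum, Finset.sum_congr rfl fun t _ => h t,
    Finset.sum_const, Finset.card_univ, ← Nat.cast_smul_eq_nsmul k, smul_smul,
    inv_mul_cancel₀ (Nat.cast_ne_zero.2 Fintype.card_ne_zero), one_smul]

/-- The symmetrizer on $Q^y$ allows replacing `v` by its average over the last $y=m-L>\lambda_1$
positions, which is zero for lack of letters $0$. -/
lemma dual_stepTerm_eq_zero (hnm : m = lam 0 + n) {L : ℤ} (hL : L < n)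
    (z : (stepTerm (n := n) Equiv.Perm.sign 1 (hwRep k m lam) L).V) : z = 0 := by
  by_cases hL0 : 0 ≤ L
  swap
  · exact stepTerm_eq_zero _ _ _ (by omega) z
  obtain ⟨l, rfl⟩ := Int.eq_ofNat_of_zero_le hL0
  obtain ⟨y, rfl⟩ : ∃ y, stepProj Equiv.Perm.sign 1 (hwRep k m lam) (l : ℤ) y = z :=
    LinearMap.surjective_rangeRestrict _ z
  refine LinearMap.congr_fun (f := stepProj (k := k) Equiv.Perm.sign 1 (hwRep k m lam) (l : ℤ))
    (g := 0) (indRes_linear_ext fun g v => Subtype.ext ?_) y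
  refine (stepProj_natCast Equiv.Perm.sign 1 (by omega) (by omega) (hwRep k m lam) g v).trans ?_
  rw [← stepGen_strandAverage]
  have : strandAverage (hwRep k m lam) l v = 0 := Subtype.ext
    (eq_zero_of_mem_strandInvariants_of_lt (strandAverage (hwRep k m lam) l v).2
      (strandAverage_mem l v) (by omega))
  rw [this, map_zero]
  rfl

/-- Here `l = n`, so the coefficient of one determines all others by equivariance. It is invariant
under the strands of $Q$, where restriction of words is injective. -/
lemma eq_zero_of_dualLowestMap (hnm : m = lam 0 + n) (χ : Equiv.Perm (Fin n) →* ℤˣ)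
    {x : ((indRes (k := k) m n n).obj (hwRep k m lam)).V}
    (hx : x ∈ LinearMap.range ((charIdem χ 1 n).app (hwRep k m lam)).hom.toLinearMap)
    (h : (dualLowestMap lam (by omega)).hom x = 0) : x = 0 := by
  have h1 : indCoef n (hwRep k m lam) 1 x = 0 := Subtype.ext
    (eq_zero_of_restrWord_eq_zero (m := n) (n := m) (by omega) (by omega)
      (indCoef n (hwRep k m lam) 1 x).2 (indCoef_one_mem_strandInvariants χ hx)
      (congrArg Subtype.val h))
  refine eq_zero_of_indCoef _ _ fun g => ?_
  have e := indCoef_head (hwRep k m lam) g 1 x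
  rw [headPerm_self, mul_one, h1, map_zero] at e
  exact e

/-- The strands of $Q$ permute letters $0$ of extended words, so symmetrizing does not affect the
restriction. -/
lemma dualLowestMap_stepGen (hnm : n ≤ m) (f : (hwRep k m lam).V) :
    (dualLowestMap lam hnm).hom (stepGen Equiv.Perm.sign 1 n (hwRep k m lam) 1 f) =
      restrHighest lam hnm f := by
  classical
  have hsub := subsingleton_strandPerm_self n
  refine (map_stepGen Equiv.Perm.sign 1 n (hwRep k m lam) 1 f
    (dualLowestMap lam hnm).hom.toLinearMap).trans ?_
  have h1 : ∀ t : strandPerm m n, (dualLowestMap lam hnm).hom.toLinearMap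
      (indResMk n n (hwRep k m lam) 1 ((hwRep k m lam).ρ t f)) = restrHighest lam hnm f :=
    fun t => by
      refine (congrArg (restrHighest lam hnm) (indCoef_mk n (hwRep k m lam) 1 1 _)).trans ?_
      simp only [headPerm_self, mul_one, Finset.sum_ite_eq', Finset.mem_univ, if_true, map_one,
        Module.End.one_apply]
      apply Subtype.ext
      funext u
      change f.1 (extWord m n u ∘ t.1) = f.1 (extWord m n u)
      rw [extWord_comp_strandPerm u t.2]
  rw [Fintype.sum_subsingleton _ 1, card_strandPerm_self]
  simp only [OneMemClass.coe_one, map_one, MonoidHom.one_apply, one_mul, Units.val_one,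
    Int.cast_one, one_smul, h1, Finset.sum_const, Finset.card_univ, Nat.cast_one, inv_one]
  rw [← Nat.cast_smul_eq_nsmul k, smul_smul,
    inv_mul_cancel₀ (Nat.cast_ne_zero.2 Fintype.card_ne_zero), one_smul]

lemma exists_dualTermMap (hlam : Antitone lam) (hsum : ∑ i, lam i = m)
    (hn : ∑ i, Fin.tail lam i = n) {L : ℤ} (hL : L = n) :
    ∃ π : stepTerm (n := n) Equiv.Perm.sign 1 (hwRep k m lam) L ⟶ hwRep k n (Fin.tail lam),
      Function.Bijective π.hom := by
  subst hL
  have hnm : m = lam 0 + n := by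
    rw [← hsum, Fin.sum_univ_succ, ← hn]
    rfl
  have hnm' : n ≤ m := by omega
  let Φ := (dualLowestMap (k := k) lam hnm').hom.toLinearMap
  let π : stepTerm (n := n) Equiv.Perm.sign 1 (hwRep k m lam) (n : ℤ) ⟶ hwRep k n (Fin.tail lam) :=
    Rep.ofHom ⟨Φ ∘ₗ stepIncl Equiv.Perm.sign 1 (hwRep k m lam) (n : ℤ), fun g => by
      refine LinearMap.ext fun x => ?_
      exact Rep.hom_comm_apply (dualLowestMap lam hnm') g x.1⟩
  have hπ : ∀ f, ∃ z, π.hom z = restrHighest lam hnm' f := fun f => by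
    refine ⟨stepProj Equiv.Perm.sign 1 (hwRep k m lam) (n : ℤ)
      (indResMk n n (hwRep k m lam) 1 f), ?_⟩
    refine Eq.trans ?_ (dualLowestMap_stepGen hnm' f)
    exact congrArg (dualLowestMap lam hnm').hom
      (stepProj_natCast Equiv.Perm.sign 1 hnm' le_rfl (hwRep k m lam) 1 f)
  have hr : LinearMap.range ((stepIdem Equiv.Perm.sign 1 (n : ℤ)).app
      (hwRep k m lam)).hom.toLinearMap =
      LinearMap.range ((charIdem (n := n) Equiv.Perm.sign 1 n).app
        (hwRep k m lam)).hom.toLinearMap :=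
    congrArg (fun f : indRes (k := k) m n n ⟶ indRes m n n =>
      LinearMap.range (f.app (hwRep k m lam)).hom.toLinearMap)
      (stepIdem_natCast Equiv.Perm.sign 1 hnm' le_rfl)
  refine ⟨π, (injective_iff_map_eq_zero π.hom.toLinearMap).2 fun z hz => Subtype.ext ?_, ?_⟩
  · exact eq_zero_of_dualLowestMap hnm Equiv.Perm.sign (x := z.1) (hr ▸ z.2) hz
  · let X := (LinearMap.range π.hom.toLinearMap).map (highestWeight k n (Fin.tail lam)).subtype
    have hX : X = highestWeight k n (Fin.tail lam) := by
      refine highestWeight_irreducible _ hn X ?_ ?_ ?_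
      · rintro g _ ⟨_, ⟨z, rfl⟩, rfl⟩
        refine ⟨_, ⟨(stepTerm Equiv.Perm.sign 1 (hwRep k m lam) (n : ℤ)).ρ g z, rfl⟩, ?_⟩
        exact congrArg Subtype.val (Rep.hom_comm_apply π g z)
      · rintro _ ⟨z, -, rfl⟩
        exact z.2
      -- The restriction of a nonzero strand invariant is a nonzero element of the image;
      -- irreducibility of the target then gives surjectivity.
      · obtain ⟨f, hf, hinv, hne⟩ := exists_strandInvariant_ne_zero (k := k) hnm' (by omega) hsum
          (highestWeight k m lam) (fun g f hf => wordRep_mem_highestWeight g hf) le_rfl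
          (highestWeight_ne_bot hlam hsum)
        obtain ⟨z, hz⟩ := hπ ⟨f, hf⟩
        intro hbot
        have h0 : (π.hom z).1 ∈ X := ⟨_, ⟨z, rfl⟩, rfl⟩
        rw [hbot, Submodule.mem_bot, hz] at h0
        exact hne (eq_zero_of_restrWord_eq_zero hnm' (by omega) hf hinv h0)
    intro f
    obtain ⟨_, ⟨z, rfl⟩, hz⟩ := hX.ge f.2
    exact ⟨z, Subtype.ext hz⟩

/-- The dual Bernstein operator removes the first row. -/
theorem nonempty_evalComplex_dualBernsteinBlock (hlam : Antitone lam) (hsum : ∑ i, lam i = m)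
    (hn : ∑ i, Fin.tail lam i = n) :
    Nonempty (HomotopyEquiv (evalComplex (dualBernsteinBlock k m n) (hwRep k m lam))
      ((HomologicalComplex.single _ (ComplexShape.down ℤ) 0).obj
        (hwRep k n (Fin.tail lam)))) := by
  have hnm : m = lam 0 + n := by
    rw [← hsum, Fin.sum_univ_succ, ← hn]
    rfl
  set X := evalComplex (dualBernsteinBlock k m n) (hwRep k m lam) with hX
  have hzero : ∀ i ≠ 0, IsZero (X.X i) := fun i hi => by
    rcases lt_or_gt_of_ne hi with hi | hi
    · exact isZero_of_forall_eq_zero _ (dual_stepTerm_eq_zero (n := n) hnm (L := n + i) (by omega))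
    · exact isZero_stepTerm (n := n) _ _ _ (L := n + i) (by omega)
  obtain ⟨π, hπ⟩ := exists_dualTermMap (k := k) hlam hsum hn (L := n + 0) (add_zero _)
  let e : X.X 0 ≅ hwRep k n (Fin.tail lam) := repIsoOfBijective π hπ
  -- Only the term of degree zero is nonzero, so the contraction applies with the zero maps.
  exact ⟨homotopyEquivSingleOfLaplacian X (fun _ _ => 0) (fun _ => comp_zero)
    (fun i hi => hzero i hi.ne) (fun _ => 0) (fun i hi => (hzero i hi.ne').eq_of_src _ _)
    (fun i hi => (hzero i hi.ne').eq_of_src _ _) e.inv (by simp)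
    fun f _ => ⟨f ≫ e.hom, by simp⟩⟩

end DualBlock

/-! ### Total complexes: homotopy invariance, and the action on a single module. -/

section Action

variable {k : Type u} [Field k] {m n : ℕ}

open HomologicalComplex

instance forgetAdditive {C D : Type*} [Category* C] [Category* D] [Preadditive C]
    [Preadditive D] : (AdditiveFunctor.forget C D).Additive where
  map_add := rfl

instance forgetObjAdditive {C D : Type*} [Category* C] [Category* D] [Preadditive C]
    [Preadditive D] (F : C ⥤+ D) : ((AdditiveFunctor.forget C D).obj F).Additive := F.property

variable (B : ChainComplex (SymRep k m ⥤+ SymRep k n) ℤ)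

/-- The map between total complexes induced by a map of complexes of modules. -/
noncomputable def actOnMap {X Y : ChainComplex (SymRep k m) ℤ} (f : X ⟶ Y) :
    actOn B X ⟶ actOn B Y :=
  mapBifunctorMap (𝟙 B) f (AdditiveFunctor.forget _ _) (ComplexShape.down ℤ)

lemma actOnMap_id (X : ChainComplex (SymRep k m) ℤ) : actOnMap B (𝟙 X) = 𝟙 _ :=
  (((AdditiveFunctor.forget (SymRep k m) (SymRep k n)).map₂HomologicalComplex
    (ComplexShape.down ℤ) (ComplexShape.down ℤ) (ComplexShape.down ℤ)).obj B).map_id X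

lemma actOnMap_comp {X Y Z : ChainComplex (SymRep k m) ℤ} (f : X ⟶ Y) (g : Y ⟶ Z) :
    actOnMap B (f ≫ g) = actOnMap B f ≫ actOnMap B g :=
  (((AdditiveFunctor.forget (SymRep k m) (SymRep k n)).map₂HomologicalComplex
    (ComplexShape.down ℤ) (ComplexShape.down ℤ) (ComplexShape.down ℤ)).obj B).map_comp f g

/-- Homotopic maps induce homotopic maps between total complexes. -/
noncomputable def actOnHomotopy {X Y : ChainComplex (SymRep k m) ℤ} {f g : X ⟶ Y}
    (h : Homotopy f g) : Homotopy (actOnMap B f) (actOnMap B g) :=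
  mapBifunctorMapHomotopy₂ (𝟙 B) h (AdditiveFunctor.forget _ _) (ComplexShape.down ℤ)

/-- The action preserves homotopy equivalences. -/
noncomputable def actOnHomotopyEquiv {X Y : ChainComplex (SymRep k m) ℤ} (e : HomotopyEquiv X Y) :
    HomotopyEquiv (actOn B X) (actOn B Y) where
  hom := actOnMap B e.hom
  inv := actOnMap B e.inv
  homotopyHomInvId := (Homotopy.ofEq (actOnMap_comp B _ _).symm).trans
    ((actOnHomotopy B e.homotopyHomInvId).trans (Homotopy.ofEq (actOnMap_id B _)))
  homotopyInvHomId := (Homotopy.ofEq (actOnMap_comp B _ _).symm).trans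
    ((actOnHomotopy B e.homotopyInvHomId).trans (Homotopy.ofEq (actOnMap_id B _)))

lemma isZero_actOn {X : ChainComplex (SymRep k m) ℤ} (hX : IsZero X) : IsZero (actOn B X) := by
  refine (IsZero.iff_id_eq_zero _).2 ?_
  rw [← actOnMap_id, hX.eq_of_src (𝟙 X) 0]
  ext j : 1
  refine mapBifunctor.hom_ext fun i₁ i₂ h => ?_
  refine (ι_mapBifunctorMap (𝟙 B) (0 : X ⟶ X) (AdditiveFunctor.forget _ _) (ComplexShape.down ℤ)
    i₁ i₂ j h).trans ?_
  rw [zero_f, Functor.map_zero, zero_comp, comp_zero, zero_f]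
  exact comp_zero.symm

/-- The comparison of a value of a complex of functors with the total complex. -/
noncomputable def evalToActOn (M : SymRep k m) (i : ℤ) :
    ((AdditiveFunctor.forget _ _).obj (B.X i)).obj M ⟶
      (mapBifunctor B ((HomologicalComplex.single _ (ComplexShape.down ℤ) 0).obj M)
        (AdditiveFunctor.forget (SymRep k m) (SymRep k n)) (ComplexShape.down ℤ)).X i :=
  ((AdditiveFunctor.forget _ _).obj (B.X i)).map
    (singleObjXSelf (ComplexShape.down ℤ) 0 M).inv ≫
  ιMapBifunctor B ((HomologicalComplex.single _ (ComplexShape.down ℤ) 0).obj M)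
    (AdditiveFunctor.forget _ _) (ComplexShape.down ℤ) i 0 i (add_zero i)

/-- Only the summand with second index zero is nonzero, since additive functors preserve zero
objects. The inverse is the projection to that summand. -/
lemma isIso_evalToActOn (M : SymRep k m) (i : ℤ) : IsIso (evalToActOn B M i) := by
  let K := (HomologicalComplex.single (SymRep k m) (ComplexShape.down ℤ) 0).obj M
  let F := AdditiveFunctor.forget (SymRep k m) (SymRep k n)
  let s := singleObjXSelf (ComplexShape.down ℤ) 0 M
  obtain ⟨ψ, hψ, hψ'⟩ : ∃ ψ : ∀ (i₁ i₂ : ℤ) (_ : ComplexShape.π (ComplexShape.down ℤ)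
      (ComplexShape.down ℤ) (ComplexShape.down ℤ) (i₁, i₂) = i), (F.obj (B.X i₁)).obj (K.X i₂) ⟶
        (F.obj (B.X i)).obj M, ψ i 0 (add_zero i) = (F.obj (B.X i)).map s.hom ∧
        ∀ i₁ i₂ h, i₂ ≠ 0 → ψ i₁ i₂ h = 0 := by
    refine ⟨fun i₁ i₂ h => if h2 : i₂ = 0 then
      eqToHom (by
        subst h2
        have h : i₁ + 0 = i := h
        rw [add_zero] at h
        rw [h]) ≫ (F.obj (B.X i)).map s.hom
      else 0, ?_, fun i₁ i₂ h h2 => dif_neg h2⟩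
    exact (dif_pos rfl).trans (Category.id_comp _)
  let φ : (mapBifunctor B K F (ComplexShape.down ℤ)).X i ⟶ (F.obj (B.X i)).obj M :=
    mapBifunctorDesc ψ
  have hφ : ∀ i₁ i₂ h, ιMapBifunctor B K F (ComplexShape.down ℤ) i₁ i₂ i h ≫ φ = ψ i₁ i₂ h :=
    fun i₁ i₂ h => ι_mapBifunctorDesc (K₁ := B) (K₂ := K) (F := F) (c := ComplexShape.down ℤ)
      ψ i₁ i₂ h
  have e : evalToActOn B M i = (F.obj (B.X i)).map s.inv ≫
        ιMapBifunctor B K F (ComplexShape.down ℤ) i 0 i (add_zero i) := rfl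
  refine ⟨φ, ?_, ?_⟩
  · rw [e, Category.assoc, hφ, hψ]
    exact ((F.obj (B.X i)).map_comp _ _).symm.trans
      ((congrArg (F.obj (B.X i)).map s.inv_hom_id).trans ((F.obj (B.X i)).map_id _))
  · refine mapBifunctor.hom_ext (K₁ := B) (K₂ := K) (F := F) fun i₁ i₂ h => ?_
    refine (Category.assoc _ _ _).symm.trans ((congrArg (· ≫ evalToActOn B M i)
      (hφ i₁ i₂ h)).trans ?_)
    by_cases h2 : i₂ = 0
    · subst h2
      have h' : i₁ + 0 = i := h
      rw [add_zero] at h'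
      subst h'
      have e1 : (F.obj (B.X i₁)).map s.hom ≫ (F.obj (B.X i₁)).map s.inv = 𝟙 _ :=
        ((F.obj (B.X i₁)).map_comp _ _).symm.trans
          ((congrArg (F.obj (B.X i₁)).map s.hom_inv_id).trans ((F.obj (B.X i₁)).map_id _))
      refine (congrArg (· ≫ evalToActOn B M i₁) hψ).trans ?_
      rw [e]
      refine (Category.assoc _ _ _).symm.trans ((congrArg (· ≫
        ιMapBifunctor B K F (ComplexShape.down ℤ) i₁ 0 i₁ (add_zero i₁)) e1).trans ?_)
      exact (Category.id_comp _).trans (Category.comp_id _).symm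
    · refine IsZero.eq_of_src ?_ _ _
      exact Functor.map_isZero (F.obj (B.X i₁)) (isZero_single_obj_X _ _ _ _ h2)

lemma evalToActOn_comm (M : SymRep k m) (i j : ℤ) (hij : j + 1 = i) :
    evalToActOn B M i ≫
      (mapBifunctor B ((HomologicalComplex.single _ (ComplexShape.down ℤ) 0).obj M)
        (AdditiveFunctor.forget (SymRep k m) (SymRep k n)) (ComplexShape.down ℤ)).d i j =
      ((AdditiveFunctor.forget _ _).map (B.d i j)).app M ≫ evalToActOn B M j := by
  let K := (HomologicalComplex.single (SymRep k m) (ComplexShape.down ℤ) 0).obj M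
  let F := AdditiveFunctor.forget (SymRep k m) (SymRep k n)
  let ι := ιMapBifunctor B K F (ComplexShape.down ℤ)
  let s := singleObjXSelf (ComplexShape.down ℤ) 0 M
  have hd : ι i 0 i (add_zero i) ≫ (mapBifunctor B K F (ComplexShape.down ℤ)).d i j =
      (F.map (B.d i j)).app (K.X 0) ≫ ι j 0 j (add_zero j) := by
    have h1 := mapBifunctor.d_eq B K F (ComplexShape.down ℤ) i j
    have h2 := mapBifunctor.ι_D₁ B K F (ComplexShape.down ℤ) i j i 0 (add_zero i)
    have h3 := mapBifunctor.ι_D₂ B K F (ComplexShape.down ℤ) i j i 0 (add_zero i)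
    -- The module complex has no differential, so only the differential of `B` remains, and it
    -- enters the total complex without a sign.
    have h4 : mapBifunctor.d₂ B K F (ComplexShape.down ℤ) i 0 j = 0 := by
      have hr : (ComplexShape.down ℤ).Rel 0 (-1) := by
        change (-1 : ℤ) + 1 = 0
        norm_num
      rw [mapBifunctor.d₂_eq' B K F (ComplexShape.down ℤ) i hr j]
      rw [show K.d 0 (-1) = 0 from single_obj_d _ _ _ _ _, Functor.map_zero, zero_comp, smul_zero]
    have h5 := mapBifunctor.d₁_eq B K F (ComplexShape.down ℤ)
      (show (ComplexShape.down ℤ).Rel i j from hij) 0 j (add_zero j)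
    rw [h1, Preadditive.comp_add, h2, h3, h4, h5, add_zero]
    exact one_smul _ _
  calc _ = (F.obj (B.X i)).map s.inv ≫ ι i 0 i (add_zero i) ≫
        (mapBifunctor B K F (ComplexShape.down ℤ)).d i j := Category.assoc _ _ _
    _ = (F.obj (B.X i)).map s.inv ≫ (F.map (B.d i j)).app (K.X 0) ≫ ι j 0 j (add_zero j) :=
      congrArg _ hd
    _ = ((F.obj (B.X i)).map s.inv ≫ (F.map (B.d i j)).app (K.X 0)) ≫ ι j 0 j (add_zero j) :=
      (Category.assoc _ _ _).symm
    _ = ((F.map (B.d i j)).app M ≫ (F.obj (B.X j)).map s.inv) ≫ ι j 0 j (add_zero j) :=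
      congrArg (· ≫ ι j 0 j (add_zero j)) ((F.map (B.d i j)).naturality s.inv)
    _ = _ := Category.assoc _ _ _

/-- The action on a module in degree zero is the value of the complex of functors. -/
noncomputable def evalIsoActOn (M : SymRep k m) : evalComplex B M ≅
    actOn B ((HomologicalComplex.single _ (ComplexShape.down ℤ) 0).obj M) :=
  Hom.isoOfComponents (C₁ := evalComplex B M) (C₂ := mapBifunctor B _ _ _)
    (fun i => @asIso _ _ _ _ (evalToActOn B M i) (isIso_evalToActOn B M i))
    fun i j hij => evalToActOn_comm B M i j hij

end Action

/-! ### Assembly over Fock space and induction on the rows. -/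

section Fock

variable {k : Type u} [Field k]

lemma homotopy_comm_down {C : Type*} [Category* C] [Preadditive C] {X Y : ChainComplex C ℤ}
    {f g : X ⟶ Y} (h : Homotopy f g) (i : ℤ) :
    f.f i = X.d i (i - 1) ≫ h.hom (i - 1) i + h.hom i (i + 1) ≫ Y.d (i + 1) i + g.f i := by
  have e := h.comm i
  rwa [dNext_eq _ (show (ComplexShape.down ℤ).Rel i (i - 1) from sub_add_cancel i 1),
    prevD_eq _ (show (ComplexShape.down ℤ).Rel (i + 1) i from rfl)] at e

/-- A homotopy between maps of complexes in homological grading over the integers. -/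
noncomputable def homotopyMkDown {C : Type*} [Category* C] [Preadditive C] {X Y : ChainComplex C ℤ}
    {f g : X ⟶ Y} (h : ∀ i j, X.X i ⟶ Y.X j) (zero : ∀ i j, ¬ i + 1 = j → h i j = 0)
    (comm : ∀ i, f.f i = X.d i (i - 1) ≫ h (i - 1) i + h i (i + 1) ≫ Y.d (i + 1) i + g.f i) :
    Homotopy f g where
  hom := h
  zero := zero
  comm i := by
    rw [dNext_eq _ (show (ComplexShape.down ℤ).Rel i (i - 1) from sub_add_cancel i 1),
      prevD_eq _ (show (ComplexShape.down ℤ).Rel (i + 1) i from rfl)]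
    exact comm i

/-- The map over Fock space with given components. -/
noncomputable def fockAssembleMap {Y Y' : ∀ n, ChainComplex (SymRep k n) ℤ}
    (f : ∀ n, Y n ⟶ Y' n) : fockAssemble Y ⟶ fockAssemble Y' where
  f i := fun n => (f n).f i
  comm' i j _ := funext fun n => (f n).comm i j

/-- The component of a map over Fock space. -/
noncomputable def fockComponentMap {X X' : ChainComplex (Fock k) ℤ} (f : X ⟶ X') (n : ℕ) :
    fockComponent X n ⟶ fockComponent X' n where
  f i := f.f i n
  comm' i j _ := congrFun (f.comm i j) n

/-- Homotopy equivalences of all components give a homotopy equivalence over Fock space. -/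
noncomputable def fockAssembleHomotopyEquiv {Y Y' : ∀ n, ChainComplex (SymRep k n) ℤ}
    (e : ∀ n, HomotopyEquiv (Y n) (Y' n)) : HomotopyEquiv (fockAssemble Y) (fockAssemble Y') where
  hom := fockAssembleMap fun n => (e n).hom
  inv := fockAssembleMap fun n => (e n).inv
  homotopyHomInvId := homotopyMkDown (fun i j n => (e n).homotopyHomInvId.hom i j)
    (fun i j h => funext fun n => (e n).homotopyHomInvId.zero i j h)
    fun i => funext fun n => homotopy_comm_down (e n).homotopyHomInvId i
  homotopyInvHomId := homotopyMkDown (fun i j n => (e n).homotopyInvHomId.hom i j)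
    (fun i j h => funext fun n => (e n).homotopyInvHomId.zero i j h)
    fun i => funext fun n => homotopy_comm_down (e n).homotopyInvHomId i

/-- A homotopy equivalence over Fock space has components. -/
noncomputable def fockComponentHomotopyEquiv {X X' : ChainComplex (Fock k) ℤ}
    (e : HomotopyEquiv X X') (n : ℕ) : HomotopyEquiv (fockComponent X n) (fockComponent X' n) where
  hom := fockComponentMap e.hom n
  inv := fockComponentMap e.inv n
  homotopyHomInvId := homotopyMkDown (fun i j => e.homotopyHomInvId.hom i j n)
    (fun i j h => congrFun (e.homotopyHomInvId.zero i j h) n)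
    fun i => congrFun (homotopy_comm_down e.homotopyHomInvId i) n
  homotopyInvHomId := homotopyMkDown (fun i j => e.homotopyInvHomId.hom i j n)
    (fun i j h => congrFun (e.homotopyInvHomId.zero i j h) n)
    fun i => congrFun (homotopy_comm_down e.homotopyInvHomId i) n

/-- Zero objects are homotopy equivalent. -/
noncomputable def homotopyEquivOfIsZero {n : ℕ} {X Y : ChainComplex (SymRep k n) ℤ} (hX : IsZero X)
    (hY : IsZero Y) : HomotopyEquiv X Y := HomotopyEquiv.ofIso (hX.iso hY)

/-- Isomorphic modules in degree zero. -/
noncomputable def concentratedHomotopyEquiv {n : ℕ} {M N : SymRep k n} (e : M ≅ N) :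
    HomotopyEquiv (concentrated M) (concentrated N) :=
  fockAssembleHomotopyEquiv fun j => HomotopyEquiv.ofIso (by
    by_cases h : n = j
    · subst h
      rw [dif_pos rfl, dif_pos rfl]
      exact (HomologicalComplex.single _ (ComplexShape.down ℤ) 0).mapIso e
    · rw [dif_neg h, dif_neg h])

lemma fockComponent_concentrated {n : ℕ} (M : SymRep k n) :
    fockComponent (concentrated M) n =
      (HomologicalComplex.single _ (ComplexShape.down ℤ) 0).obj M :=
  dif_pos rfl

open scoped ZeroObject in
lemma isZero_fockComponent_concentrated {n j : ℕ} (M : SymRep k n) (h : n ≠ j) :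
    IsZero (fockComponent (concentrated M) j) := by
  have e : fockComponent (concentrated M) j = 0 := dif_neg h
  rw [e]
  exact isZero_zero _

/-- A complex over Fock space with one component equivalent to a module and the others zero. -/
noncomputable def homotopyEquivConcentrated {n : ℕ} (M : SymRep k n)
    (Y : ∀ j, ChainComplex (SymRep k j) ℤ)
    (e : HomotopyEquiv (Y n) ((HomologicalComplex.single _ (ComplexShape.down ℤ) 0).obj M))
    (h : ∀ j, n ≠ j → IsZero (Y j)) : HomotopyEquiv (fockAssemble Y) (concentrated M) :=
  fockAssembleHomotopyEquiv fun j => by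
    by_cases hj : n = j
    · subst hj
      rw [dif_pos rfl]
      exact e
    · exact homotopyEquivOfIsZero (h j hj) (isZero_fockComponent_concentrated M hj)

variable [CharZero k]

/-- The Bernstein operators preserve homotopy equivalences. -/
noncomputable def bernsteinOpHomotopyEquiv (a : ℤ) {X Y : ChainComplex (Fock k) ℤ}
    (e : HomotopyEquiv X Y) : HomotopyEquiv (bernsteinOp a X) (bernsteinOp a Y) :=
  fockAssembleHomotopyEquiv fun n => by
    by_cases h : 0 ≤ (n : ℤ) - a
    · rw [if_pos h, if_pos h]
      exact actOnHomotopyEquiv _ (fockComponentHomotopyEquiv e _)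
    · rw [if_neg h, if_neg h]

/-- The dual Bernstein operators preserve homotopy equivalences. -/
noncomputable def dualBernsteinOpHomotopyEquiv (a : ℤ) {X Y : ChainComplex (Fock k) ℤ}
    (e : HomotopyEquiv X Y) : HomotopyEquiv (dualBernsteinOp a X) (dualBernsteinOp a Y) :=
  fockAssembleHomotopyEquiv fun n => by
    by_cases h : 0 ≤ (n : ℤ) + a
    · rw [if_pos h, if_pos h]
      exact actOnHomotopyEquiv _ (fockComponentHomotopyEquiv e _)
    · rw [if_neg h, if_neg h]

/-- Replacing the acting block on a concentrated complex by its value. -/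
noncomputable def actOnConcentratedHomotopyEquiv {m n : ℕ}
    (B : ChainComplex (SymRep k m ⥤+ SymRep k n) ℤ) (M : SymRep k m) :
    HomotopyEquiv (actOn B (fockComponent (concentrated M) m)) (evalComplex B M) := by
  rw [fockComponent_concentrated]
  exact HomotopyEquiv.ofIso (evalIsoActOn B M).symm

lemma nonempty_bernsteinOp {r m n : ℕ} {lam : Fin (r + 1) → ℕ} (hlam : Antitone lam)
    (hsum : ∑ i, lam i = n) (hm : ∑ i, Fin.tail lam i = m) :
    Nonempty (HomotopyEquiv (bernsteinOp (lam 0 : ℤ) (concentrated (hwRep k m (Fin.tail lam))))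
      (concentrated (hwRep k n lam))) := by
  have hn : n = lam 0 + m := by
    rw [← hsum, Fin.sum_univ_succ, ← hm]
    rfl
  obtain ⟨e⟩ := nonempty_evalComplex_bernsteinBlock (k := k) hlam hsum hm
  refine ⟨homotopyEquivConcentrated _ _ ?_ fun j hj => ?_⟩
  · rw [if_pos (by omega)]
    -- The index of the source component equals `m` only propositionally; naming it first makes the
    -- substitution possible in the dependent types.
    generalize hm' : ((n : ℤ) - (lam 0 : ℤ)).toNat = m'
    obtain rfl : m = m' := by omega
    exact (actOnConcentratedHomotopyEquiv _ _).trans e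
  · split_ifs with h
    · exact isZero_actOn _ (isZero_fockComponent_concentrated _ (by omega))
    · exact isZero_zero _

lemma nonempty_dualBernsteinOp {r m n : ℕ} {lam : Fin (r + 1) → ℕ} (hlam : Antitone lam)
    (hsum : ∑ i, lam i = m) (hn : ∑ i, Fin.tail lam i = n) :
    Nonempty (HomotopyEquiv (dualBernsteinOp (lam 0 : ℤ) (concentrated (hwRep k m lam)))
      (concentrated (hwRep k n (Fin.tail lam)))) := by
  have hm : m = lam 0 + n := by
    rw [← hsum, Fin.sum_univ_succ, ← hn]
    rfl
  obtain ⟨e⟩ := nonempty_evalComplex_dualBernsteinBlock (k := k) hlam hsum hn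
  refine ⟨homotopyEquivConcentrated _ _ ?_ fun j hj => ?_⟩
  · rw [if_pos (by omega)]
    generalize hm' : ((n : ℤ) + (lam 0 : ℤ)).toNat = m'
    obtain rfl : m = m' := by omega
    exact (actOnConcentratedHomotopyEquiv _ _).trans e
  · split_ifs with h
    · exact isZero_actOn _ (isZero_fockComponent_concentrated _ (by omega))
    · exact isZero_zero _

/-- The outermost operator belongs to the largest part: the remaining operators build the lower
rows, and it puts the first row on top. -/
lemma nonempty_foldr_bernsteinOp : ∀ {r : ℕ} {lam : Fin r → ℕ} (_ : Antitone lam) {n : ℕ}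
    (_ : ∑ i, lam i = n) {X : ChainComplex (Fock k) ℤ}
    (_ : HomotopyEquiv X (concentrated (hwRep k 0 (Fin.elim0 : Fin 0 → ℕ)))),
    Nonempty (HomotopyEquiv
      ((List.ofFn lam).foldr (fun (a : ℕ) X => bernsteinOp (a : ℤ) X) X)
      (concentrated (hwRep k n lam)))
  | 0, lam, _, n, hn, X, e => by
    obtain rfl : n = 0 := by simpa using hn.symm
    obtain rfl : lam = Fin.elim0 := funext fun i => i.elim0
    exact ⟨e⟩
  | r + 1, lam, hlam, n, hn, X, e₀ => by
    obtain ⟨e⟩ := nonempty_foldr_bernsteinOp (lam := Fin.tail lam)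
      (fun i j h => hlam (Fin.succ_le_succ_iff.2 h)) rfl e₀
    obtain ⟨e'⟩ := nonempty_bernsteinOp (k := k) hlam hn rfl
    rw [List.ofFn_succ, List.foldr_cons]
    exact ⟨(bernsteinOpHomotopyEquiv _ e).trans e'⟩

/-- The largest part acts first and strips off the first row, leaving the same problem for the tail.
-/
lemma nonempty_foldl_dualBernsteinOp : ∀ {r : ℕ} {lam : Fin r → ℕ} (_ : Antitone lam) {n : ℕ}
    (_ : ∑ i, lam i = n) {X : ChainComplex (Fock k) ℤ}
    (_ : HomotopyEquiv X (concentrated (hwRep k n lam))), Nonempty (HomotopyEquiv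
      ((List.ofFn lam).foldl (fun X (a : ℕ) => dualBernsteinOp (a : ℤ) X) X)
      (concentrated (hwRep k 0 (Fin.elim0 : Fin 0 → ℕ))))
  | 0, lam, _, n, hn, X, e => by
    obtain rfl : n = 0 := by simpa using hn.symm
    obtain rfl : lam = Fin.elim0 := funext fun i => i.elim0
    exact ⟨e⟩
  | r + 1, lam, hlam, n, hn, X, e => by
    obtain ⟨e'⟩ := nonempty_dualBernsteinOp (k := k) hlam hn rfl
    rw [List.ofFn_succ, List.foldl_cons]
    exact nonempty_foldl_dualBernsteinOp (lam := Fin.tail lam)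
      (fun i j h => hlam (Fin.succ_le_succ_iff.2 h)) rfl
      ((dualBernsteinOpHomotopyEquiv _ e).trans e')

/-- The trivial module of the symmetric group on no letters. -/
noncomputable def trivialIsoHwRep : Rep.trivial k (Equiv.Perm (Fin 0)) k ≅
    hwRep k 0 (Fin.elim0 : Fin 0 → ℕ) :=
  repIsoOfBijective (Rep.ofHom ⟨(LinearMap.pi fun _ => LinearMap.id).codRestrict
    (highestWeight k 0 (Fin.elim0 : Fin 0 → ℕ)) fun c =>
      ⟨fun _ _ => funext fun i => i.elim0, fun i => i.elim0⟩, fun g => rfl⟩) (by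
    constructor
    · intro c d h
      exact congrFun (congrArg Subtype.val h) Fin.elim0
    · intro f
      exact ⟨f.1 Fin.elim0, Subtype.ext (funext fun w => congrArg f.1 (Subsingleton.elim _ _))⟩)

end Fock

theorem mainTheorem4 (k : Type u) [Field k] [CharZero k] (r : ℕ) (lam : Fin r → ℕ)
    (hlam : Antitone lam) :
    Nonempty (HomotopyEquiv
      ((List.ofFn lam).foldr (fun (a : ℕ) X => bernsteinOp (a : ℤ) X)
        (concentrated (Rep.trivial k (Equiv.Perm (Fin 0)) k)))
      (concentrated (specht k lam))) ∧
    Nonempty (HomotopyEquiv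
      ((List.ofFn lam).foldl (fun X (a : ℕ) => dualBernsteinOp (a : ℤ) X)
        (concentrated (specht k lam)))
      (concentrated (Rep.trivial k (Equiv.Perm (Fin 0)) k))) := by
  have e₁ := concentratedHomotopyEquiv (trivialIsoHwRep (k := k))
  have e₂ := concentratedHomotopyEquiv (hwRepIsoSpecht (k := k) lam hlam)
  obtain ⟨f₁⟩ := nonempty_foldr_bernsteinOp hlam rfl e₁
  obtain ⟨f₂⟩ := nonempty_foldl_dualBernsteinOp hlam rfl e₂.symm
  exact ⟨⟨f₁.trans e₂⟩, ⟨f₂.trans e₁.symm⟩⟩
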